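/- Let $G$ be a locally compact Hausdorff group and let $\mathbb T$ be the circle group. A *twist* of $G$ is a central extension $1\to\mathbb T\xrightarrow{\iota}E\xrightarrow{q}G\to1$ of locally compact Hausdorff groups (with $\iota,q$ continuous and $q$ open). Two twists are *equivalent* if there is an isomorphism of topological groups between them inducing the identity on $G$ and on $\mathbb T$; $\mathrm{Twist}(G)$ is the set of equivalence classes $[E]$. It is an abelian group with $[E][E']=[E*E']$, where $E*E'=(E\times_GE')/\mathbb T$ with $z\cdot(x,x')=(\iota(z)x,\iota'(\bar z)x')$, $z\mapsto[(\iota(z),e)]$ and $[(x,x')]\mapsto q(x)$; the inverse of $[E]$ is the class of $E$ with $\iota$ replaced by $z\mapsto\iota(\bar z)$. An *action of $G$ on compact operators* is a homomorphism $\alpha:G\to\mathrm{Aut}(\mathcal K(H_\alpha))$, with $H_\alpha\neq0$ a complex Hilbert space, such that $g\mapsto\alpha_g(T)$ is norm continuous for every $T\in\mathcal K(H_\alpha)$. $\mathrm{Br}(G)$ is the set of classes $[\alpha]$ of such actions under $G$-equivariant Morita equivalence (imprimitivity bimodules with a compatible strongly continuous $G$-action). For a twist $E$ let $L^2(E,\iota)$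 be the completion of $\{f\in C_c(E): f(x\,\iota(z))=zf(x)\ \forall x\in E,\ z\in\mathbb T\}$ with respect to $\langle\xi,\eta\rangle=\int_G\overline{\xi(x)}\eta(x)\,dg$, where $g=q(x)$ and $dg$ is left Haar measure, and let $(\rho(x)\xi)(s)=\Delta(q(x))^{1/2}\xi(sx)$, where $\Delta$ is the modular function, normalised so that $\rho$ is unitary. Then $\mathrm{Ad}\,\rho$ factors through an action $\alpha_E$ of $G$ on $\mathcal K(L^2(E,\iota))$. For an action $\alpha$ let $G_\alpha=\{(g,v)\in G\times\mathcal U(H_\alpha):\alpha_g=\mathrm{Ad}\,v\}$ (strong operator topology on $\mathcal U(H_\alpha)$), a twist of $G$ with $\iota(z)=(e,z1)$ and $q(g,v)=g$. The map $[E]\mapsto[\alpha_E]$ is a bijection $\mathrm{Twist}(G)\to\mathrm{Br}(G)$ with inverse $[\alpha]\mapsto[G_\alpha]$. **Proposition.** The group structure on $\mathrm{Br}(G)$ which makes this bijection an isomorphism of groups is given, for all actions $\alpha,\beta$ of $G$ on compact operators, by $$[\alpha][\beta]=[\alpha\otimes\beta]\qquad\text{and}\qquad[\alpha]^{-1}=[\bar\alpha].$$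 Here $\alpha\otimes\beta$ is the diagonal action on $\mathcal K(H_\alpha)\otimes\mathcal K(H_\beta)=\mathcal K(H_\alpha\otimes H_\beta)$, with $(\alpha\otimes\beta)_g(S\otimes T)=\alpha_g(S)\otimes\beta_g(T)$, and $\bar\alpha$ is the conjugate action on $\mathcal K(\overline{H_\alpha})$, with $\bar\alpha_g(\overline T)=\overline{\alpha_g(T)}$, where $\overline{H_\alpha}$ is the conjugate Hilbert space and $\overline T\,\overline\xi=\overline{T\xi}$. -/

import Mathlib

universe u

open scoped TensorProduct InnerProductSpace Topology ComplexConjugate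

noncomputable section

namespace GroupTwists

section CompactOperators

variable {H : Type u} [NormedAddCommGroup H] [InnerProductSpace ℂ H] [CompleteSpace H]

/-- The Hilbert space adjoint of a compact operator is compact. -/
theorem isCompactOperator_adjoint {T : H →L[ℂ] H} (hT : IsCompactOperator T) :
    IsCompactOperator (ContinuousLinearMap.adjoint T) := by
  have hS : IsCompactOperator (T ∘L ContinuousLinearMap.adjoint T) := hT.comp_clm _
  have key : TotallyBounded ((ContinuousLinearMap.adjoint T : H → H) '' Metric.ball 0 1) := by
    have hS' := IsCompactOperator.isCompact_closure_image_ball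
      (f := ((T ∘L ContinuousLinearMap.adjoint T : H →L[ℂ] H) : H →ₗ[ℂ] H)) hS 1
    have hb := hS'.totallyBounded.subset subset_closure
    rw [Metric.totallyBounded_iff]
    intro ε hε
    obtain ⟨t, hts, htf, hcov⟩ := Metric.finite_approx_of_totallyBounded hb (ε ^ 2 / 2)
      (by positivity)
    have hts' : ∀ z : H, ∃ y : H, z ∈ t → y ∈ Metric.ball (0 : H) 1 ∧
        T (ContinuousLinearMap.adjoint T y) = z := fun z => by
      by_cases hz : z ∈ t
      · obtain ⟨y, hy, hyz⟩ := hts hz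
        exact ⟨y, fun _ => ⟨hy, hyz⟩⟩
      · exact ⟨0, fun h => absurd h hz⟩
    choose g hg using hts'
    refine ⟨(fun z => ContinuousLinearMap.adjoint T (g z)) '' t, htf.image _, ?_⟩
    rintro _ ⟨x, hx, rfl⟩
    have hx' := hcov (Set.mem_image_of_mem _ hx)
    simp only [Set.mem_iUnion] at hx'
    obtain ⟨z, hz, hxz⟩ := hx'
    simp only [Set.mem_iUnion, Set.mem_image, exists_prop]
    refine ⟨_, ⟨z, hz, rfl⟩, ?_⟩
    obtain ⟨hgz, hgz'⟩ := hg z hz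
    rw [Metric.mem_ball, dist_eq_norm] at hxz ⊢
    rw [← hgz'] at hxz
    simp only [ContinuousLinearMap.coe_coe, ContinuousLinearMap.comp_apply] at hxz
    have h1 : ‖x - g z‖ ≤ 2 := by
      have := norm_sub_le x (g z)
      rw [mem_ball_zero_iff] at hx hgz
      linarith
    have h2 : ‖ContinuousLinearMap.adjoint T (x - g z)‖ ^ 2 ≤
        ‖T (ContinuousLinearMap.adjoint T (x - g z))‖ * ‖x - g z‖ := by
      rw [← inner_self_eq_norm_sq (𝕜 := ℂ), ContinuousLinearMap.adjoint_inner_right]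
      exact (Complex.re_le_norm _).trans (norm_inner_le_norm _ _)
    rw [← map_sub, ← map_sub] at hxz
    rw [← map_sub]
    have h3 : ‖ContinuousLinearMap.adjoint T (x - g z)‖ ^ 2 < ε ^ 2 := by
      have h4 := norm_nonneg (T (ContinuousLinearMap.adjoint T (x - g z)))
      nlinarith
    exact lt_of_pow_lt_pow_left₀ 2 hε.le h3
  exact (isCompactOperator_iff_isCompact_closure_image_ball
    (f := (ContinuousLinearMap.adjoint T : H →ₗ[ℂ] H)) (r := 1) one_pos).2
      (key.closure.isCompact_of_isClosed isClosed_closure)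

variable (H) in
/-- The C⋆-algebra of compact operators on a Hilbert space, as a closed ideal (here: a
non-unital star subalgebra) of the bounded operators with the operator norm. -/
def compactOps : NonUnitalStarSubalgebra ℂ (H →L[ℂ] H) where
  carrier := {T | IsCompactOperator T}
  add_mem' ha hb := ha.add hb
  zero_mem' := isCompactOperator_zero
  mul_mem' {_ b} ha _ := ha.comp_clm b
  smul_mem' c _ ha := ha.smul c
  star_mem' ha := isCompactOperator_adjoint ha

variable (H) in
/-- `𝓚 H` is the C⋆-algebra of compact operators on `H`. -/
abbrev K : Type u := ↥(compactOps H)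

instance : IsClosed ((compactOps H : NonUnitalStarSubalgebra ℂ (H →L[ℂ] H)) : Set (H →L[ℂ] H)) :=
  isClosed_setOfPred_isCompactOperator

theorem K.isCompactOperator (T : K H) : IsCompactOperator (T : H →L[ℂ] H) := T.2

instance : NonUnitalCStarAlgebra (K H) := inferInstance
instance : NonUnitalNormedRing (K H) := inferInstance
instance : NonUnitalNonAssocSemiring (K H) := inferInstance
instance : AddCommGroup (K H) := inferInstance
instance : AddCommMonoid (K H) := inferInstance
instance : AddMonoid (K H) := inferInstance
instance : AddZeroClass (K H) := inferInstance
instance : Add (K H) := inferInstance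
instance : Mul (K H) := inferInstance
instance : Star (K H) := inferInstance
instance : Module ℂ (K H) := inferInstance
instance : SMul ℂ (K H) := inferInstance

/-- The rank one operator `x ↦ ⟪ξ, x⟫ • η` as a compact operator. -/
def rk (η ξ : H) : K H :=
  ⟨InnerProductSpace.rankOne ℂ η ξ,
    (((isCompactOperator_id_iff_finiteDimensional (𝕜 := ℂ) (E := ℂ)).2 inferInstance).comp_clm
      (innerSL ℂ ξ)).clm_comp (ContinuousLinearMap.toSpanSingleton ℂ η)⟩

theorem rk_apply (η ξ x : H) : (rk η ξ : H →L[ℂ] H) x = inner ℂ ξ x • η := rfl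

theorem K.ext {S T : K H} (h : ∀ x, (S : H →L[ℂ] H) x = (T : H →L[ℂ] H) x) : S = T :=
  Subtype.ext (ContinuousLinearMap.ext h)

theorem K.mul_apply (S T : K H) (x : H) :
    ((S * T : K H) : H →L[ℂ] H) x = (S : H →L[ℂ] H) ((T : H →L[ℂ] H) x) := rfl

end CompactOperators

section Unitaries

variable {H : Type u} [NormedAddCommGroup H] [InnerProductSpace ℂ H]

/-- The strong operator topology (pointwise convergence in norm) on the unitary group of `H`. -/
instance : TopologicalSpace (H ≃ₗᵢ[ℂ] H) :=
  .induced (fun (v : H ≃ₗᵢ[ℂ] H) (x : H) => v x) inferInstance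

theorem continuous_unitary_iff {X : Type*} [TopologicalSpace X] {f : X → (H ≃ₗᵢ[ℂ] H)} :
    Continuous f ↔ ∀ x : H, Continuous fun t => f t x := by
  rw [continuous_induced_rng, continuous_pi_iff]
  rfl

theorem continuousOn_unitary_iff {X : Type*} [TopologicalSpace X] {f : X → (H ≃ₗᵢ[ℂ] H)}
    {s : Set X} : ContinuousOn f s ↔ ∀ x : H, ContinuousOn (fun t => f t x) s := by
  rw [continuousOn_iff_continuous_domRestrict, continuous_unitary_iff]
  simp_rw [continuousOn_iff_continuous_domRestrict]
  rfl

theorem continuous_unitary_apply :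
    Continuous fun p : (H ≃ₗᵢ[ℂ] H) × H => p.1 p.2 := by
  have h0 : ∀ x : H, Continuous fun v : H ≃ₗᵢ[ℂ] H => v x :=
    continuous_unitary_iff.1 continuous_id
  rw [continuous_iff_continuousAt]
  rintro ⟨v, x⟩
  rw [ContinuousAt, tendsto_iff_norm_sub_tendsto_zero]
  have h1 : Filter.Tendsto (fun p : (H ≃ₗᵢ[ℂ] H) × H => ‖p.2 - x‖ + ‖p.1 x - v x‖)
      (𝓝 (v, x)) (𝓝 0) := by
    have : Continuous fun p : (H ≃ₗᵢ[ℂ] H) × H => ‖p.2 - x‖ + ‖p.1 x - v x‖ := by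
      have := (h0 x).comp (continuous_fst (X := H ≃ₗᵢ[ℂ] H) (Y := H))
      have h2 : Continuous fun p : (H ≃ₗᵢ[ℂ] H) × H => p.1 x := this
      fun_prop
    simpa using this.tendsto (v, x)
  refine squeeze_zero (fun _ => norm_nonneg _) (fun p => ?_) h1
  calc ‖p.1 p.2 - v x‖ = ‖p.1 (p.2 - x) + (p.1 x - v x)‖ := by rw [map_sub]; congr 1; abel
    _ ≤ ‖p.1 (p.2 - x)‖ + ‖p.1 x - v x‖ := norm_add_le _ _
    _ = _ := by rw [LinearIsometryEquiv.norm_map]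

instance : IsTopologicalGroup (H ≃ₗᵢ[ℂ] H) where
  continuous_mul := continuous_unitary_iff.2 fun x =>
    continuous_unitary_apply.comp (continuous_fst.prodMk
      ((continuous_unitary_iff.1 continuous_id x).comp continuous_snd))
  continuous_inv := continuous_unitary_iff.2 fun x => by
    rw [continuous_iff_continuousAt]
    intro v
    rw [ContinuousAt, tendsto_iff_norm_sub_tendsto_zero]
    have h : Continuous fun w : H ≃ₗᵢ[ℂ] H => ‖v (v⁻¹ x) - w (v⁻¹ x)‖ :=
      (continuous_const.sub (continuous_unitary_iff.1 continuous_id _)).norm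
    have h' := h.tendsto v
    rw [sub_self, norm_zero] at h'
    refine h'.congr fun w => ?_
    have e1 : v (v⁻¹ x) = x := v.apply_symm_apply x
    have e2 : w (w⁻¹ x) = x := w.apply_symm_apply x
    calc ‖v (v⁻¹ x) - w (v⁻¹ x)‖ = ‖w (w⁻¹ x - v⁻¹ x)‖ := by rw [map_sub, e1, e2]
      _ = _ := LinearIsometryEquiv.norm_map _ _

instance : T2Space (H ≃ₗᵢ[ℂ] H) :=
  T2Space.of_injective_continuous (f := fun (v : H ≃ₗᵢ[ℂ] H) (x : H) => v x)
    (fun _ _ h => LinearIsometryEquiv.ext fun x => congrFun h x) continuous_induced_dom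

variable (H) in
/-- The scalar unitaries. -/
def scalarUnitary : Circle →* (H ≃ₗᵢ[ℂ] H) where
  toFun z :=
    { LinearEquiv.smulOfUnit (M := H) (R := ℂ) (Circle.toUnits z) with
      norm_map' := fun x => by
        change ‖(z : ℂ) • x‖ = ‖x‖
        rw [norm_smul, Circle.norm_coe, one_mul] }
  map_one' := by ext x; change ((1 : Circle) : ℂ) • x = x; simp
  map_mul' z w := by
    ext x; change ((z * w : Circle) : ℂ) • x = (z : ℂ) • (w : ℂ) • x
    rw [Circle.coe_mul, mul_smul]

@[simp] theorem scalarUnitary_apply (z : Circle) (x : H) : scalarUnitary H z x = (z : ℂ) • x := rfl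

theorem continuous_scalarUnitary : Continuous (scalarUnitary H) :=
  continuous_unitary_iff.2 fun x => by simp only [scalarUnitary_apply]; fun_prop

theorem injective_scalarUnitary [Nontrivial H] : Function.Injective (scalarUnitary H) := by
  intro z w h
  obtain ⟨x, hx⟩ := exists_ne (0 : H)
  have := DFunLike.congr_fun h x
  rw [scalarUnitary_apply, scalarUnitary_apply] at this
  exact Circle.ext (smul_left_injective ℂ hx this)

variable [CompleteSpace H]

theorem conj_mem (v : H ≃ₗᵢ[ℂ] H) (T : K H) : v.conjStarAlgEquiv (T : H →L[ℂ] H) ∈ compactOps H :=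
  (T.2.comp_clm (v.symm : H →L[ℂ] H)).clm_comp (v : H →L[ℂ] H)

/-- Conjugation by a unitary, `Ad v (T) = v T v⁻¹`, as an automorphism of the compact operators. -/
def Ad : (H ≃ₗᵢ[ℂ] H) →* (K H ≃⋆ₐ[ℂ] K H) where
  toFun v :=
    { toFun := fun T => ⟨v.conjStarAlgEquiv T, conj_mem v T⟩
      invFun := fun T => ⟨v.symm.conjStarAlgEquiv T, conj_mem v.symm T⟩
      left_inv := fun T => by ext; simp
      right_inv := fun T => by ext; simp
      map_mul' := fun S T => Subtype.ext (map_mul _ _ _)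
      map_add' := fun S T => Subtype.ext (map_add _ _ _)
      map_star' := fun S => Subtype.ext (map_star _ _)
      map_smul' := fun c S => Subtype.ext (map_smul _ _ _) }
  map_one' := by ext; rfl
  map_mul' v w := by ext; rfl

theorem Ad_apply_apply (v : H ≃ₗᵢ[ℂ] H) (T : K H) (x : H) :
    (Ad v T : H →L[ℂ] H) x = v ((T : H →L[ℂ] H) (v⁻¹ x)) := rfl

theorem Ad_scalarUnitary (z : Circle) : Ad (scalarUnitary H z) = 1 := by
  refine StarAlgEquiv.ext fun T => K.ext fun x => ?_
  have h : scalarUnitary H z ((scalarUnitary H z)⁻¹ x) = x :=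
    (scalarUnitary H z).apply_symm_apply x
  rw [Ad_apply_apply, scalarUnitary_apply, ← map_smul, ← scalarUnitary_apply, h]
  rfl

/-- A unitary which acts trivially on the compact operators is a scalar. -/
theorem eq_scalar_of_Ad_eq_one [Nontrivial H] {v : H ≃ₗᵢ[ℂ] H} (h : Ad v = 1) :
    ∃ z : Circle, v = scalarUnitary H z := by
  obtain ⟨ξ, hξ⟩ := exists_norm_eq H zero_le_one
  have key : ∀ η, v η = inner ℂ ξ (v ξ) • η := fun η => by
    have h1 := congrArg (fun T : K H => (T : H →L[ℂ] H) (v ξ)) (DFunLike.congr_fun h (rk η ξ))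
    have e : v⁻¹ (v ξ) = ξ := v.symm_apply_apply ξ
    simp only [Ad_apply_apply, e, rk_apply, StarAlgEquiv.one_apply] at h1
    rw [inner_self_eq_norm_sq_to_K, hξ] at h1
    simpa using h1
  have hn : ‖(inner ℂ ξ (v ξ) : ℂ)‖ = 1 := by
    have := congrArg norm (key ξ)
    rwa [LinearIsometryEquiv.norm_map, norm_smul, hξ, mul_one, eq_comm] at this
  exact ⟨⟨_, mem_sphere_zero_iff_norm.2 hn⟩, LinearIsometryEquiv.ext key⟩

end Unitaries

section Continuity

variable {H : Type u} [NormedAddCommGroup H] [InnerProductSpace ℂ H] [CompleteSpace H]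

theorem conj_sub_conj {R : Type*} [Ring R] [StarRing R] (a b s : R) :
    a * s * star a - b * s * star b =
      (a * s - b * s) * star a + b * star (a * star s - b * star s) := by
  simp only [star_sub, star_mul, star_star]
  noncomm_ring

/-- Strongly continuous families of unitaries are norm continuous against a compact operator. -/
theorem continuous_unitary_comp {X : Type*} [TopologicalSpace X] {u : X → (H ≃ₗᵢ[ℂ] H)}
    (hu : Continuous u) (T : K H) :
    Continuous fun x => ((u x : H →L[ℂ] H) ∘L (T : H →L[ℂ] H)) := by
  rw [continuous_iff_continuousAt]
  intro x₀
  rw [ContinuousAt, Metric.tendsto_nhds]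
  intro ε hε
  obtain ⟨C, hC, hTC⟩ := IsCompactOperator.image_closedBall_subset_compact
    (f := ((T : H →L[ℂ] H) : H →ₗ[ℂ] H)) T.2 1
  have hP : ∀ y ∈ C, ∀ᶠ z : X × H in 𝓝 (x₀, y), dist (u z.1 z.2) (u x₀ z.2) < ε / 2 := by
    intro y _
    have h1 : Continuous fun z : X × H => dist (u z.1 z.2) (u x₀ z.2) := by
      have h2 : Continuous fun z : X × H => u z.1 z.2 :=
        continuous_unitary_apply.comp ((hu.comp continuous_fst).prodMk continuous_snd)
      have h3 : Continuous fun z : X × H => u x₀ z.2 := (u x₀).continuous.comp continuous_snd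
      exact h2.dist h3
    have h4 := h1.tendsto (x₀, y)
    rw [dist_self] at h4
    exact h4.eventually_lt_const (by positivity)
  filter_upwards [hC.eventually_forall_of_forall_eventually
    (P := fun x y => dist (u x y) (u x₀ y) < ε / 2) hP] with x hx
  rw [dist_eq_norm]
  refine lt_of_le_of_lt (ContinuousLinearMap.opNorm_le_of_unit_norm (C := ε / 2) (by positivity)
    fun y hy => ?_) (half_lt_self hε)
  have := hx (T.1 y) (hTC ⟨y, by simp [hy], rfl⟩)
  rw [dist_eq_norm] at this
  exact this.le

/-- If `u` is a strongly continuous family of unitaries, then `x ↦ u x T (u x)⁻¹` is norm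
continuous for every compact operator `T`. -/
theorem continuous_Ad {X : Type*} [TopologicalSpace X] {u : X → (H ≃ₗᵢ[ℂ] H)}
    (hu : Continuous u) (T : K H) : Continuous fun x => Ad (u x) T := by
  have h1 := continuous_unitary_comp hu T
  have h2 := continuous_unitary_comp hu (star T)
  have hst : ∀ v : H ≃ₗᵢ[ℂ] H, star (v : H →L[ℂ] H) = (v.symm : H →L[ℂ] H) := fun v =>
    LinearIsometryEquiv.adjoint_eq_symm v
  have hAd : ∀ v : H ≃ₗᵢ[ℂ] H, ((Ad v T : K H) : H →L[ℂ] H) =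
      (v : H →L[ℂ] H) * (T : H →L[ℂ] H) * star (v : H →L[ℂ] H) := fun v => by
    rw [hst]; rfl
  have hn : ∀ v : H ≃ₗᵢ[ℂ] H, ‖(v : H →L[ℂ] H)‖ ≤ 1 := fun v =>
    ContinuousLinearMap.opNorm_le_bound _ zero_le_one fun x => by
      rw [one_mul]; exact (v.norm_map x).le
  rw [continuous_iff_continuousAt]
  intro x₀
  have h1' := (tendsto_iff_norm_sub_tendsto_zero.1 (h1.tendsto x₀))
  have h2' := (tendsto_iff_norm_sub_tendsto_zero.1 (h2.tendsto x₀))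
  have h3 := h1'.add h2'
  rw [add_zero] at h3
  rw [ContinuousAt, tendsto_iff_norm_sub_tendsto_zero]
  refine squeeze_zero (fun _ => norm_nonneg _) (fun x => ?_) h3
  set A : H →L[ℂ] H := (u x : H →L[ℂ] H) with hA
  set B : H →L[ℂ] H := (u x₀ : H →L[ℂ] H) with hB
  set S : H →L[ℂ] H := (T : H →L[ℂ] H) with hS
  have e : ‖Ad (u x) T - Ad (u x₀) T‖ = ‖(A * S - B * S) * star A + B * star (A * star S - B * star S)‖ := by
    change ‖((Ad (u x) T : K H) : H →L[ℂ] H) - ((Ad (u x₀) T : K H) : H →L[ℂ] H)‖ = _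
    rw [hAd, hAd]
    exact congrArg norm (conj_sub_conj A B S)
  rw [e]
  calc _ ≤ ‖A * S - B * S‖ * ‖star A‖ + ‖B‖ * ‖star (A * star S - B * star S)‖ :=
        (norm_add_le _ _).trans (add_le_add (norm_mul_le _ _) (norm_mul_le _ _))
    _ ≤ ‖A * S - B * S‖ * 1 + 1 * ‖A * star S - B * star S‖ := by
        rw [norm_star, norm_star]
        gcongr
        · exact hn _
        · exact hn _
    _ = _ := by rw [mul_one, one_mul]; rfl

end Continuity

section Twists

variable (G : Type u) [Group G] [TopologicalSpace G]

/-- A *twist* of `G`: a central extension `1 → 𝕋 → E → G → 1` of (Hausdorff) locally compact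
groups, `𝕋` being the circle group.  The map `ι` is automatically a homeomorphism onto its image. -/
structure GroupTwist where
  E : Type u
  [group : Group E]
  [topologicalSpace : TopologicalSpace E]
  [isTopologicalGroup : IsTopologicalGroup E]
  [locallyCompactSpace : LocallyCompactSpace E]
  [t2Space : T2Space E]
  ι : Circle →* E
  q : E →* G
  continuous_ι : Continuous ι
  injective_ι : Function.Injective ι
  central : ∀ (z : Circle) (x : E), ι z * x = x * ι z
  continuous_q : Continuous q
  isOpenMap_q : IsOpenMap q
  surjective_q : Function.Surjective q
  exact : q.ker = ι.range

attribute [instance] GroupTwist.group GroupTwist.topologicalSpace GroupTwist.isTopologicalGroup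
  GroupTwist.locallyCompactSpace GroupTwist.t2Space

variable {G}

/-- Equivalence of twists: an isomorphism of topological groups inducing the identity on `G` and
on `𝕋`. -/
def GroupTwist.Equivalent (A B : GroupTwist G) : Prop :=
  ∃ φ : A.E ≃ₜ* B.E, (∀ z, φ (A.ι z) = B.ι z) ∧ ∀ x, B.q (φ x) = A.q x

variable (G) in
/-- Twists up to equivalence. -/
instance GroupTwist.setoid : Setoid (GroupTwist G) where
  r := GroupTwist.Equivalent
  iseqv :=
    { refl := fun A => ⟨.refl _, fun _ => rfl, fun _ => rfl⟩
      symm := fun {A B} ⟨φ, h1, h2⟩ => ⟨φ.symm, fun z => by rw [← h1]; exact φ.symm_apply_apply _,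
        fun x => by rw [← h2]; exact congrArg _ (φ.apply_symm_apply x)⟩
      trans := fun {A B C} ⟨φ, h1, h2⟩ ⟨ψ, h3, h4⟩ => ⟨φ.trans ψ,
        fun z => (congrArg ψ (h1 z)).trans (h3 z), fun x => (h4 _).trans (h2 x)⟩ }

variable (G) in
/-- The set `Twist(G)` of equivalence classes of twists of `G`. -/
def Twist : Type (u + 1) := Quotient (GroupTwist.setoid G)

/-- The class `[A]` of a twist. -/
def Twist.mk (A : GroupTwist G) : Twist G := Quotient.mk _ A

namespace GroupTwist

variable (A B : GroupTwist G)

theorem q_ι (z : Circle) : A.q (A.ι z) = 1 := by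
  have : A.ι z ∈ A.q.ker := A.exact ▸ ⟨z, rfl⟩
  exact this

theorem exists_ι {x : A.E} (h : A.q x = 1) : ∃ z, A.ι z = x := by
  have : x ∈ A.ι.range := A.exact ▸ h
  exact this

theorem isOpenQuotientMap_q : IsOpenQuotientMap A.q :=
  ⟨A.surjective_q, A.continuous_q, A.isOpenMap_q⟩

/-- The conjugate twist: the same extension with `ι` replaced by `z ↦ ι (z⁻¹) = ι (conj z)`. -/
def conjTwist : GroupTwist G where
  E := A.E
  ι := A.ι.comp invMonoidHom
  q := A.q
  continuous_ι := A.continuous_ι.comp continuous_inv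
  injective_ι := A.injective_ι.comp inv_injective
  central z x := A.central _ x
  continuous_q := A.continuous_q
  isOpenMap_q := A.isOpenMap_q
  surjective_q := A.surjective_q
  exact := by
    ext x
    rw [A.exact]
    exact ⟨fun ⟨z, hz⟩ => ⟨z⁻¹, by simpa using hz⟩, fun ⟨z, hz⟩ => ⟨z⁻¹, hz⟩⟩

/-- The fibred product `A ×_G B`. -/
def fibre : Subgroup (A.E × B.E) :=
  (A.q.comp (MonoidHom.fst _ _)).eqLocus (B.q.comp (MonoidHom.snd _ _))

theorem mem_fibre {p : A.E × B.E} : p ∈ A.fibre B ↔ A.q p.1 = B.q p.2 := Iff.rfl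

/-- The projection `A ×_G B → G`. -/
def fibreProj : A.fibre B →* G := (A.q.comp (MonoidHom.fst _ _)).comp (A.fibre B).subtype

/-- The antidiagonal embedding `z ↦ (ι z, ι z⁻¹)` of `𝕋` into `A ×_G B`. -/
def antidiag : Circle →* A.fibre B where
  toFun z := ⟨(A.ι z, B.ι z⁻¹), by rw [mem_fibre, q_ι, q_ι]⟩
  map_one' := by ext <;> simp
  map_mul' z w := by
    ext
    · exact map_mul _ _ _
    · change B.ι (z * w)⁻¹ = B.ι z⁻¹ * B.ι w⁻¹
      rw [← map_mul, mul_inv]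

instance normal_antidiag : (A.antidiag B).range.Normal where
  conj_mem := by
    rintro _ ⟨z, rfl⟩ g
    have : g * A.antidiag B z * g⁻¹ = A.antidiag B z := by
      rw [mul_inv_eq_iff_eq_mul]
      ext
      · exact (A.central _ _).symm
      · exact (B.central _ _).symm
    rw [this]
    exact ⟨z, rfl⟩

theorem continuous_antidiag : Continuous (A.antidiag B) :=
  (A.continuous_ι.prodMk (B.continuous_ι.comp continuous_inv)).subtype_mk _

instance isClosed_antidiag : IsClosed ((A.antidiag B).range : Set (A.fibre B)) := by
  have : IsCompact (Set.range (A.antidiag B)) := isCompact_range (A.continuous_antidiag B)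
  exact this.isClosed

theorem isOpenQuotientMap_fibreProj : IsOpenQuotientMap (A.fibreProj B) where
  surjective g := by
    obtain ⟨x, hx⟩ := A.surjective_q g
    obtain ⟨y, hy⟩ := B.surjective_q g
    exact ⟨⟨(x, y), hx.trans hy.symm⟩, hx⟩
  continuous := A.continuous_q.comp (continuous_fst.comp continuous_subtype_val)
  isOpenMap := by
    rw [isOpenMap_iff_nhds_le]
    rintro ⟨⟨x, y⟩, hxy⟩
    intro s hs
    rw [Filter.mem_map, mem_nhds_subtype] at hs
    obtain ⟨t, ht, hts⟩ := hs
    obtain ⟨U, hU, V, hV, hUV⟩ := mem_nhds_prod_iff.1 ht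
    have h1 : A.q '' U ∈ 𝓝 (A.q x) := A.isOpenMap_q.image_mem_nhds hU
    have h2 : B.q '' V ∈ 𝓝 (A.q x) := by
      have h : A.q x = B.q y := hxy
      rw [h]; exact B.isOpenMap_q.image_mem_nhds hV
    refine Filter.mem_of_superset (Filter.inter_mem h1 h2) ?_
    rintro _ ⟨⟨a, ha, rfl⟩, b, hb, hab⟩
    exact hts (a := ⟨(a, b), hab.symm⟩) (hUV ⟨ha, hb⟩)

variable [T2Space G]

instance locallyCompactSpace_fibre : LocallyCompactSpace (A.fibre B) := by
  have : IsClosed ((A.fibre B : Set (A.E × B.E))) :=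
    isClosed_eq (A.continuous_q.comp continuous_fst) (B.continuous_q.comp continuous_snd)
  exact this.isClosedEmbedding_subtypeVal.locallyCompactSpace

/-- The embedding `z ↦ (ι z, 1)` of `𝕋` into `A ×_G B`. -/
def fibreEmb : Circle →* A.fibre B where
  toFun z := ⟨(A.ι z, 1), by rw [mem_fibre, q_ι, map_one]⟩
  map_one' := by ext <;> simp
  map_mul' z w := by ext <;> simp

/-- The product `A * B = (A ×_G B) / 𝕋` of two twists, where `z ∈ 𝕋` acts by
`(x, y) ↦ (z x, z⁻¹ y)`, with `ι z = [(z, 1)]` and `q [(x, y)] = q x = q y`. -/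
def baer : GroupTwist G where
  E := (A.fibre B) ⧸ (A.antidiag B).range
  group := inferInstance
  topologicalSpace := inferInstance
  isTopologicalGroup := QuotientGroup.instIsTopologicalGroup _
  locallyCompactSpace := inferInstance
  t2Space := inferInstance
  ι := (QuotientGroup.mk' (A.antidiag B).range).comp (A.fibreEmb B)
  q := QuotientGroup.lift _ (A.fibreProj B) (by
    rintro _ ⟨z, rfl⟩
    exact A.q_ι z)
  continuous_ι := continuous_quot_mk.comp
    ((A.continuous_ι.prodMk continuous_const).subtype_mk _)
  injective_ι := by
    rw [injective_iff_map_eq_one]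
    intro z hz
    obtain ⟨w, hw⟩ := (QuotientGroup.eq_one_iff _).1 hz
    have h1 : A.ι w = A.ι z := congrArg (fun p : A.fibre B => p.1.1) hw
    have h2 : B.ι w⁻¹ = 1 := congrArg (fun p : A.fibre B => p.1.2) hw
    rw [← A.injective_ι h1]
    exact inv_eq_one.1 (B.injective_ι (h2.trans (map_one _).symm))
  central z x := by
    obtain ⟨x, rfl⟩ := QuotientGroup.mk_surjective x
    refine congrArg (QuotientGroup.mk (s := (A.antidiag B).range))
      (?_ : A.fibreEmb B z * x = x * A.fibreEmb B z)
    ext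
    · exact A.central _ _
    · exact (one_mul _).trans (mul_one _).symm
  continuous_q := continuous_quot_lift _ (A.isOpenQuotientMap_fibreProj B).continuous
  isOpenMap_q := fun U hU => by
    have h := (A.isOpenQuotientMap_fibreProj B).isOpenMap _
      (hU.preimage (QuotientGroup.continuous_mk (N := (A.antidiag B).range)))
    convert h using 1
    ext g
    constructor
    · rintro ⟨x, hx, rfl⟩
      obtain ⟨x, rfl⟩ := QuotientGroup.mk_surjective x
      exact ⟨x, hx, rfl⟩
    · rintro ⟨x, hx, rfl⟩
      exact ⟨_, hx, rfl⟩
  surjective_q g := by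
    obtain ⟨x, hx⟩ := (A.isOpenQuotientMap_fibreProj B).surjective g
    exact ⟨x, hx⟩
  exact := by
    ext x
    constructor
    · intro hx
      obtain ⟨⟨⟨a, b⟩, hab⟩, rfl⟩ := QuotientGroup.mk_surjective x
      have ha : A.q a = 1 := hx
      have hb : B.q b = 1 := ((A.mem_fibre B).1 hab).symm.trans ha
      obtain ⟨z, rfl⟩ := A.exists_ι ha
      obtain ⟨w, rfl⟩ := B.exists_ι hb
      refine ⟨z * w, QuotientGroup.eq.2 ⟨w⁻¹, ?_⟩⟩
      ext
      · change A.ι w⁻¹ = (A.ι (z * w))⁻¹ * A.ι z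
        rw [← map_inv, ← map_mul]; congr 1; rw [mul_inv]; simp [mul_comm]
      · change B.ι w⁻¹⁻¹ = 1⁻¹ * B.ι w
        simp
    · rintro ⟨z, rfl⟩
      exact A.q_ι z

end GroupTwist

end Twists

section Actions

variable (G : Type u) [Group G] [TopologicalSpace G]

/-- An action of `G` on an algebra of compact operators: a nonzero complex Hilbert space `H` and
a homomorphism `G → Aut(𝓚 H)` for which all orbit maps are norm continuous. -/
structure CompactAction where
  H : Type u
  [normedAddCommGroup : NormedAddCommGroup H]
  [innerProductSpace : InnerProductSpace ℂ H]
  [completeSpace : CompleteSpace H]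
  [nontrivial : Nontrivial H]
  act : G →* (K H ≃⋆ₐ[ℂ] K H)
  continuous_act : ∀ T : K H, Continuous fun g => act g T

attribute [instance] CompactAction.normedAddCommGroup CompactAction.innerProductSpace
  CompactAction.completeSpace CompactAction.nontrivial

/-- An imprimitivity bimodule (equivalence bimodule) between C⋆-algebras `A` and `B`: a Banach
space `X` with commuting left `A`- and right `B`-module structures and with full inner products
`lin x y = ₐ⟨x, y⟩ ∈ A` (linear in `x`) and `rin x y = ⟨x, y⟩ᵦ ∈ B` (linear in `y`), which induce
the norm of `X` and satisfy `ₐ⟨x, y⟩ z = x ⟨y, z⟩ᵦ`. -/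
structure ImprimitivityBimodule (A B : Type u) [NonUnitalCStarAlgebra A]
    [NonUnitalCStarAlgebra B] where
  X : Type u
  [normedAddCommGroup : NormedAddCommGroup X]
  [normedSpace : NormedSpace ℂ X]
  [completeSpace : CompleteSpace X]
  /-- `lsmul a x = a x` -/
  lsmul : A →ₗ[ℂ] X →ₗ[ℂ] X
  /-- `rsmul b x = x b` -/
  rsmul : B →ₗ[ℂ] X →ₗ[ℂ] X
  lin : X → X → A
  rin : X → X → B
  lsmul_mul : ∀ a a' x, lsmul (a * a') x = lsmul a (lsmul a' x)
  rsmul_mul : ∀ b b' x, rsmul (b * b') x = rsmul b' (rsmul b x)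
  lsmul_rsmul : ∀ a b x, lsmul a (rsmul b x) = rsmul b (lsmul a x)
  lin_add : ∀ x y z, lin (x + y) z = lin x z + lin y z
  lin_smul : ∀ (c : ℂ) x y, lin (c • x) y = c • lin x y
  lin_lsmul : ∀ a x y, lin (lsmul a x) y = a * lin x y
  star_lin : ∀ x y, star (lin x y) = lin y x
  lin_self_nonneg : ∀ x, ∃ a, lin x x = star a * a
  norm_lin_self : ∀ x, ‖lin x x‖ = ‖x‖ ^ 2
  rin_add : ∀ x y z, rin x (y + z) = rin x y + rin x z
  rin_smul : ∀ (c : ℂ) x y, rin x (c • y) = c • rin x y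
  rin_rsmul : ∀ b x y, rin x (rsmul b y) = rin x y * b
  star_rin : ∀ x y, star (rin x y) = rin y x
  rin_self_nonneg : ∀ x, ∃ b, rin x x = star b * b
  norm_rin_self : ∀ x, ‖rin x x‖ = ‖x‖ ^ 2
  lin_rsmul : ∀ b x y, lin (rsmul b x) y = lin x (rsmul (star b) y)
  rin_lsmul : ∀ a x y, rin (lsmul a x) y = rin x (lsmul (star a) y)
  lin_rin : ∀ x y z, lsmul (lin x y) z = rsmul (rin y z) x
  full_lin : Dense (Submodule.span ℂ {a | ∃ x y, lin x y = a} : Set A)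
  full_rin : Dense (Submodule.span ℂ {b | ∃ x y, rin x y = b} : Set B)

attribute [instance] ImprimitivityBimodule.normedAddCommGroup ImprimitivityBimodule.normedSpace
  ImprimitivityBimodule.completeSpace

variable {G}

/-- Morita equivalence of actions of `G` on compact operators: an imprimitivity bimodule `X` with
a strongly continuous linear action `γ` of `G` which is compatible with the given actions, i.e.
`ₐ⟨γ x, γ y⟩ = α (ₐ⟨x, y⟩)` and `⟨γ x, γ y⟩ᵦ = β (⟨x, y⟩ᵦ)`, `γ (a x b) = α (a) γ (x) β (b)`. -/
def CompactAction.MoritaEquivalent (α β : CompactAction G) : Prop :=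
  ∃ (M : ImprimitivityBimodule (K α.H) (K β.H)) (γ : G →* (M.X ≃ₗ[ℂ] M.X)),
    (∀ x, Continuous fun g => γ g x) ∧
    (∀ g a x, γ g (M.lsmul a x) = M.lsmul (α.act g a) (γ g x)) ∧
    (∀ g b x, γ g (M.rsmul b x) = M.rsmul (β.act g b) (γ g x)) ∧
    (∀ g x y, M.lin (γ g x) (γ g y) = α.act g (M.lin x y)) ∧
    (∀ g x y, M.rin (γ g x) (γ g y) = β.act g (M.rin x y))

variable (G) in
/-- The set `Br(G)` of Morita equivalence classes of actions of `G` on algebras of compact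
operators.  Two actions have the same class if and only if they are Morita equivalent, as Morita
equivalence is an equivalence relation. -/
def Br : Type (u + 1) := Quot (CompactAction.MoritaEquivalent (G := G))

/-- The class `[α]` of an action. -/
def Br.mk (α : CompactAction G) : Br G := Quot.mk _ α

end Actions

section Implementation

variable {H : Type u} [NormedAddCommGroup H] [InnerProductSpace ℂ H] [CompleteSpace H]

theorem K.star_inner (T : K H) (x y : H) :
    inner ℂ ((T : H →L[ℂ] H) x) y = inner ℂ x (((star T : K H) : H →L[ℂ] H) y) :=
  (ContinuousLinearMap.adjoint_inner_right _ _ _).symm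

theorem star_rk_mul_rk (η η' ξ : H) : star (rk η ξ) * rk η' ξ = inner ℂ η η' • rk ξ ξ := by
  refine K.ext fun x => ?_
  have h : star (rk η ξ) = rk ξ η := Subtype.ext (InnerProductSpace.adjoint_rankOne η ξ)
  rw [h, K.mul_apply, rk_apply, rk_apply, inner_smul_right, mul_smul]
  change _ = inner ℂ η η' • ((rk ξ ξ : H →L[ℂ] H) x)
  rw [rk_apply, smul_comm]

theorem mul_rk (T : K H) (η ξ : H) : T * rk η ξ = rk ((T : H →L[ℂ] H) η) ξ :=
  K.ext fun x => by rw [K.mul_apply, rk_apply, rk_apply, map_smul]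

/-- An automorphism `a` of the compact operators is implemented by the unitary
`η ↦ a(|η⟩⟨ξ|) ζ`, for `ξ` a unit vector and `ζ` a unit vector in the range of the projection
`a(|ξ⟩⟨ξ|)`. -/
theorem exists_implementing (a : K H ≃⋆ₐ[ℂ] K H) {ξ ζ : H} (hζ : ‖ζ‖ = 1)
    (h : (a (rk ξ ξ) : H →L[ℂ] H) ζ = ζ) :
    ∃ v : H ≃ₗᵢ[ℂ] H, (∀ η, v η = (a (rk η ξ) : H →L[ℂ] H) ζ) ∧ a = Ad v := by
  have hadd : ∀ η η', (a (rk (η + η') ξ) : H →L[ℂ] H) ζ =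
      (a (rk η ξ) : H →L[ℂ] H) ζ + (a (rk η' ξ) : H →L[ℂ] H) ζ := fun η η' => by
    have : rk (η + η') ξ = rk η ξ + rk η' ξ := K.ext fun x => smul_add _ _ _
    rw [this, map_add]; rfl
  have hsmul : ∀ (c : ℂ) η, (a (rk (c • η) ξ) : H →L[ℂ] H) ζ =
      c • (a (rk η ξ) : H →L[ℂ] H) ζ := fun c η => by
    have : rk (c • η) ξ = c • rk η ξ := K.ext fun x => smul_comm _ _ _
    rw [this, map_smul]; rfl
  have hstar : ∀ T, a (star T) = star (a T) := a.map_star'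
  have hinner : ∀ η η', inner ℂ ((a (rk η ξ) : H →L[ℂ] H) ζ) ((a (rk η' ξ) : H →L[ℂ] H) ζ) =
      inner ℂ η η' := fun η η' => by
    rw [K.star_inner, ← K.mul_apply, ← hstar, ← map_mul, star_rk_mul_rk, map_smul]
    change inner ℂ ζ (inner ℂ η η' • (a (rk ξ ξ) : H →L[ℂ] H) ζ) = _
    rw [h, inner_smul_right, inner_self_eq_norm_sq_to_K, hζ]
    simp
  have hmul : ∀ (T : K H) η, (a (rk ((T : H →L[ℂ] H) η) ξ) : H →L[ℂ] H) ζ =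
      (a T : H →L[ℂ] H) ((a (rk η ξ) : H →L[ℂ] H) ζ) := fun T η => by
    rw [← mul_rk, map_mul, K.mul_apply]
  let f : H →ₗᵢ[ℂ] H := LinearMap.isometryOfInner
    { toFun := fun η => (a (rk η ξ) : H →L[ℂ] H) ζ
      map_add' := hadd
      map_smul' := hsmul } hinner
  have hsurj : Function.Surjective f := fun y => by
    refine ⟨((a.symm (rk y ζ) : K H) : H →L[ℂ] H) ξ, ?_⟩
    change (a (rk (((a.symm (rk y ζ) : K H) : H →L[ℂ] H) ξ) ξ) : H →L[ℂ] H) ζ = y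
    rw [hmul, a.apply_symm_apply, h, rk_apply, inner_self_eq_norm_sq_to_K, hζ]
    simp
  let v : H ≃ₗᵢ[ℂ] H := LinearIsometryEquiv.ofSurjective f hsurj
  have hv : ∀ η, v η = (a (rk η ξ) : H →L[ℂ] H) ζ := fun η => rfl
  refine ⟨v, hv, StarAlgEquiv.ext fun T => K.ext fun x => ?_⟩
  have e : v (v⁻¹ x) = x := v.apply_symm_apply x
  rw [Ad_apply_apply, hv, hmul, ← hv, e]

theorem isProj_apply (a : K H ≃⋆ₐ[ℂ] K H) {ξ : H} (hξ : ‖ξ‖ = 1) (x : H) :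
    (a (rk ξ ξ) : H →L[ℂ] H) ((a (rk ξ ξ) : H →L[ℂ] H) x) = (a (rk ξ ξ) : H →L[ℂ] H) x := by
  rw [← K.mul_apply, ← map_mul, mul_rk, rk_apply, inner_self_eq_norm_sq_to_K, hξ]
  simp

/-- Every automorphism of the compact operators is implemented by a unitary. -/
theorem Ad_surjective [Nontrivial H] : Function.Surjective (Ad : (H ≃ₗᵢ[ℂ] H) →* _) := by
  intro a
  obtain ⟨ξ, hξ⟩ := exists_norm_eq H zero_le_one
  have hne : a (rk ξ ξ) ≠ 0 := fun h0 => by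
    have h1 : rk ξ ξ = 0 := EquivLike.injective a (by rw [h0, map_zero])
    have h2 := congrArg (fun T : K H => (T : H →L[ℂ] H) ξ) h1
    simp only [rk_apply, inner_self_eq_norm_sq_to_K, hξ] at h2
    have h3 : ξ = 0 := by simpa using h2
    rw [h3, norm_zero] at hξ
    exact zero_ne_one hξ
  obtain ⟨x, hx⟩ : ∃ x, (a (rk ξ ξ) : H →L[ℂ] H) x ≠ 0 := by
    by_contra! hcon
    exact hne (K.ext hcon)
  obtain ⟨v, -, hv⟩ := exists_implementing a (ξ := ξ)
    (ζ := ((‖(a (rk ξ ξ) : H →L[ℂ] H) x‖ : ℂ)⁻¹) • (a (rk ξ ξ) : H →L[ℂ] H) x)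
    (by rw [norm_smul, norm_inv, Complex.norm_real, norm_norm, inv_mul_cancel₀ (norm_ne_zero_iff.2 hx)])
    (by rw [map_smul, isProj_apply a hξ])
  exact ⟨v, hv.symm⟩

end Implementation

namespace CompactAction

variable {G : Type u} [Group G] [TopologicalSpace G] (α : CompactAction G)

/-- The group `G_α = {(g, v) ∈ G × 𝒰(H) : α_g = Ad v}`, with the subspace topology of the product
of the topology of `G` and the strong operator topology. -/
def grp : Subgroup (G × (α.H ≃ₗᵢ[ℂ] α.H)) :=
  (α.act.comp (MonoidHom.fst _ _)).eqLocus (Ad.comp (MonoidHom.snd _ _))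

theorem mem_grp {p : G × (α.H ≃ₗᵢ[ℂ] α.H)} : p ∈ α.grp ↔ α.act p.1 = Ad p.2 := Iff.rfl

/-- The inclusion `z ↦ (1, z 1_H)` of `𝕋` into `G_α`. -/
def grpι : Circle →* α.grp where
  toFun z := ⟨(1, scalarUnitary α.H z), by rw [mem_grp, map_one, Ad_scalarUnitary]⟩
  map_one' := by ext : 1; simp
  map_mul' z w := by ext : 1; simp

/-- The projection `(g, v) ↦ g` of `G_α` onto `G`. -/
def grpq : α.grp →* G := (MonoidHom.fst _ _).comp α.grp.subtype

theorem continuous_grpι : Continuous α.grpι :=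
  (continuous_const.prodMk continuous_scalarUnitary).subtype_mk _

theorem continuous_grpq : Continuous α.grpq := continuous_fst.comp continuous_subtype_val

theorem grpq_surjective : Function.Surjective α.grpq := fun g => by
  obtain ⟨v, hv⟩ := Ad_surjective (α.act g)
  exact ⟨⟨(g, v), hv.symm⟩, rfl⟩

theorem exists_grpι {x : α.grp} (hx : α.grpq x = 1) : ∃ z, α.grpι z = x := by
  obtain ⟨⟨g, v⟩, h⟩ := x
  have hg : g = 1 := hx
  subst hg
  rw [mem_grp] at h
  obtain ⟨z, hz⟩ := eq_scalar_of_Ad_eq_one (v := v) (by rw [← h, map_one])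
  exact ⟨z, Subtype.ext (Prod.ext rfl hz.symm)⟩

/-- There is a section of `G_α → G` which is continuous on a neighbourhood of `1`. -/
theorem exists_section : ∃ (U : Set G) (s : G → α.grp), IsOpen U ∧ 1 ∈ U ∧ s 1 = 1 ∧
    ContinuousOn s U ∧ ∀ g ∈ U, α.grpq (s g) = g := by
  obtain ⟨ξ, hξ⟩ := exists_norm_eq α.H zero_le_one
  have hc : ∀ (T : K α.H), Continuous fun g => ((α.act g T : K α.H) : α.H →L[ℂ] α.H) := fun T =>
    continuous_subtype_val.comp (α.continuous_act T)
  let y : G → α.H := fun g => (α.act g (rk ξ ξ) : α.H →L[ℂ] α.H) ξ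
  have hy : Continuous y := (hc _).clm_apply continuous_const
  let ζ : G → α.H := fun g => ((‖y g‖ : ℂ)⁻¹) • y g
  have hy1 : y 1 = ξ := by
    change (α.act 1 (rk ξ ξ) : α.H →L[ℂ] α.H) ξ = ξ
    rw [map_one, StarAlgEquiv.one_apply, rk_apply, inner_self_eq_norm_sq_to_K, hξ]
    simp
  have hζ1 : ζ 1 = ξ := by
    change ((‖y 1‖ : ℂ)⁻¹) • y 1 = ξ
    rw [hy1, hξ]; simp
  have hex : ∀ g, ∃ v : α.H ≃ₗᵢ[ℂ] α.H, y g ≠ 0 →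
      (∀ η, v η = (α.act g (rk η ξ) : α.H →L[ℂ] α.H) (ζ g)) ∧ α.act g = Ad v := fun g => by
    by_cases hg : y g = 0
    · exact ⟨1, fun h => absurd hg h⟩
    · obtain ⟨v, hv⟩ := exists_implementing (α.act g) (ξ := ξ) (ζ := ζ g)
        (by rw [norm_smul, norm_inv, Complex.norm_real, norm_norm,
          inv_mul_cancel₀ (norm_ne_zero_iff.2 hg)])
        (by rw [map_smul, isProj_apply _ hξ])
      exact ⟨v, fun _ => hv⟩
  choose v hv using hex
  let U : Set G := {g | y g ≠ 0}
  have hU : IsOpen U := isOpen_ne_fun hy continuous_const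
  have h1U : (1 : G) ∈ U := by
    change y 1 ≠ 0
    rw [hy1, ← norm_ne_zero_iff, hξ]; exact one_ne_zero
  classical
  let s : G → α.grp := fun g => if h : g ∈ U then ⟨(g, v g), (hv g h).2⟩ else 1
  have hs : ∀ g (h : g ∈ U), s g = ⟨(g, v g), (hv g h).2⟩ := fun g h => dif_pos h
  have hvc : ContinuousOn v U := by
    rw [continuousOn_unitary_iff]
    intro η
    have h1 : ContinuousOn (fun g => (α.act g (rk η ξ) : α.H →L[ℂ] α.H) (ζ g)) U := by
      refine (hc _).continuousOn.clm_apply ?_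
      refine ContinuousOn.smul (ContinuousOn.inv₀ ?_ fun g hg => ?_) hy.continuousOn
      · exact (Complex.continuous_ofReal.comp hy.norm).continuousOn
      · exact Complex.ofReal_ne_zero.2 (norm_ne_zero_iff.2 hg)
    exact h1.congr fun g hg => (hv g hg).1 η
  refine ⟨U, s, hU, h1U, ?_, ?_, fun g hg => by rw [hs g hg]; rfl⟩
  · rw [hs 1 h1U]
    refine Subtype.ext (Prod.ext rfl (LinearIsometryEquiv.ext fun η => ?_))
    change v 1 η = η
    rw [(hv 1 h1U).1, hζ1, map_one, StarAlgEquiv.one_apply, rk_apply, inner_self_eq_norm_sq_to_K, hξ]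
    simp
  · rw [Topology.IsInducing.subtypeVal.continuousOn_iff]
    exact (continuousOn_id.prodMk hvc).congr fun g hg => by
      simp only [Function.comp, hs g hg, id]

variable [IsTopologicalGroup G]

theorem isOpenMap_grpq : IsOpenMap α.grpq := by
  obtain ⟨U, s, hU, h1, hs1, hs, hsq⟩ := α.exists_section
  rw [isOpenMap_iff_nhds_le]
  intro x N hN
  have hm : ContinuousAt (fun g => g * (α.grpq x)⁻¹) (α.grpq x) := by fun_prop
  have hsc : ContinuousAt s (α.grpq x * (α.grpq x)⁻¹) := by
    rw [mul_inv_cancel]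
    exact hs.continuousAt (hU.mem_nhds h1)
  have hc : ContinuousAt (fun g => s (g * (α.grpq x)⁻¹) * x) (α.grpq x) :=
    (ContinuousAt.comp (f := fun g => g * (α.grpq x)⁻¹) hsc hm).mul continuousAt_const
  have hN' : α.grpq ⁻¹' N ∈ 𝓝 (s (α.grpq x * (α.grpq x)⁻¹) * x) := by
    rw [mul_inv_cancel, hs1, one_mul]
    exact hN
  filter_upwards [hc.preimage_mem_nhds hN', hm.preimage_mem_nhds
    (hU.mem_nhds (by rw [mul_inv_cancel]; exact h1))] with g hg hgU
  have := hsq _ hgU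
  have e : α.grpq (s (g * (α.grpq x)⁻¹) * x) = g := by
    rw [map_mul, this, inv_mul_cancel_right]
  rw [← e]
  exact hg

theorem locallyCompactSpace_grp [LocallyCompactSpace G] : LocallyCompactSpace α.grp := by
  obtain ⟨U, s, hU, h1, hs1, hs, hsq⟩ := α.exists_section
  obtain ⟨C, hC1, hCU, hC⟩ := local_compact_nhds (hU.mem_nhds h1)
  have hcomp : IsCompact ((fun p : G × Circle => s p.1 * α.grpι p.2) '' (C ×ˢ Set.univ)) := by
    refine (hC.prod isCompact_univ).image_of_continuousOn ?_
    exact ((hs.mono hCU).comp continuousOn_fst fun p hp => hp.1).mul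
      (α.continuous_grpι.comp continuous_snd).continuousOn
  refine hcomp.locallyCompactSpace_of_mem_nhds_of_group (x := 1) ?_
  have hn : α.grpq ⁻¹' C ∈ 𝓝 (1 : α.grp) :=
    α.continuous_grpq.continuousAt.preimage_mem_nhds (by rw [map_one]; exact hC1)
  refine Filter.mem_of_superset hn fun x hx => ?_
  obtain ⟨z, hz⟩ := α.exists_grpι (x := (s (α.grpq x))⁻¹ * x)
    (by rw [map_mul, map_inv, hsq _ (hCU hx), inv_mul_cancel])
  exact ⟨(α.grpq x, z), ⟨hx, trivial⟩, by simp [hz]⟩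

/-- The twist `1 → 𝕋 → G_α → G → 1` of an action `α` of `G` on compact operators. -/
def twist [LocallyCompactSpace G] [T2Space G] : GroupTwist G where
  E := α.grp
  locallyCompactSpace := α.locallyCompactSpace_grp
  ι := α.grpι
  q := α.grpq
  continuous_ι := α.continuous_grpι
  injective_ι z w h := injective_scalarUnitary (congrArg (fun p : α.grp => p.1.2) h)
  central z x := by
    refine Subtype.ext (Prod.ext ((one_mul _).trans (mul_one _).symm)
      (LinearIsometryEquiv.ext fun y => ?_))
    exact (map_smul x.1.2 (z : ℂ) y).symm
  continuous_q := α.continuous_grpq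
  isOpenMap_q := α.isOpenMap_grpq
  surjective_q := α.grpq_surjective
  exact := by
    ext x
    exact ⟨fun hx => α.exists_grpι hx, fun ⟨z, hz⟩ => by rw [← hz]; rfl⟩

end CompactAction

section Completion

open UniformSpace

variable {V : Type u} [SeminormedAddCommGroup V] [InnerProductSpace ℂ V]

theorem completion_comp_symm (v : V ≃ₗᵢ[ℂ] V) (x : Completion V) :
    (v : V →L[ℂ] V).completion ((v.symm : V →L[ℂ] V).completion x) = x := by
  refine Completion.induction_on x (isClosed_eq ((ContinuousLinearMap.continuous _).comp
    (ContinuousLinearMap.continuous _)) continuous_id) fun a => ?_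
  rw [ContinuousLinearMap.completion_apply_coe, ContinuousLinearMap.completion_apply_coe]
  exact congrArg _ (v.apply_symm_apply a)

theorem norm_completion (v : V ≃ₗᵢ[ℂ] V) (x : Completion V) :
    ‖(v : V →L[ℂ] V).completion x‖ = ‖x‖ := by
  refine Completion.induction_on x
    (isClosed_eq (ContinuousLinearMap.continuous _).norm continuous_norm) fun a => ?_
  rw [ContinuousLinearMap.completion_apply_coe, Completion.norm_coe, Completion.norm_coe]
  exact v.norm_map a

/-- The extension of a unitary of an inner product space to its completion. -/
def complUnitary : (V ≃ₗᵢ[ℂ] V) →* (Completion V ≃ₗᵢ[ℂ] Completion V) where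
  toFun v :=
    { toFun := (v : V →L[ℂ] V).completion
      invFun := (v.symm : V →L[ℂ] V).completion
      map_add' := map_add _
      map_smul' := map_smul _
      left_inv := completion_comp_symm v.symm
      right_inv := completion_comp_symm v
      norm_map' := fun x => by
        exact norm_completion v x }
  map_one' := LinearIsometryEquiv.ext fun x => by
    refine Completion.induction_on x
      (isClosed_eq (ContinuousLinearMap.continuous _) continuous_id) fun a => ?_
    exact ContinuousLinearMap.completion_apply_coe _ _
  map_mul' v w := LinearIsometryEquiv.ext fun x => by
    change ((v * w : V ≃ₗᵢ[ℂ] V) : V →L[ℂ] V).completion x =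
      (v : V →L[ℂ] V).completion ((w : V →L[ℂ] V).completion x)
    refine Completion.induction_on x (isClosed_eq (ContinuousLinearMap.continuous _)
      ((ContinuousLinearMap.continuous _).comp (ContinuousLinearMap.continuous _))) fun a => ?_
    rw [ContinuousLinearMap.completion_apply_coe, ContinuousLinearMap.completion_apply_coe,
      ContinuousLinearMap.completion_apply_coe]
    rfl

theorem complUnitary_coe (v : V ≃ₗᵢ[ℂ] V) (x : V) :
    complUnitary v (x : Completion V) = (v x : V) := by
  exact ContinuousLinearMap.completion_apply_coe _ _

theorem continuous_complUnitary {X : Type*} [TopologicalSpace X] {f : X → (V ≃ₗᵢ[ℂ] V)}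
    (hf : ∀ x : V, Continuous fun t => f t x) : Continuous fun t => complUnitary (f t) := by
  rw [continuous_unitary_iff]
  intro y
  rw [continuous_iff_continuousAt]
  intro t₀
  rw [ContinuousAt, Metric.tendsto_nhds]
  intro ε hε
  obtain ⟨_, hx, ⟨x, rfl⟩⟩ := Metric.dense_iff.1 (Completion.denseRange_coe (α := V)) y (ε / 3)
    (by positivity)
  have h := (hf x).tendsto t₀
  rw [Metric.tendsto_nhds] at h
  filter_upwards [h (ε / 3) (by positivity)] with t ht
  have h1 : dist (complUnitary (f t) y) (complUnitary (f t) (x : Completion V)) < ε / 3 := by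
    rw [LinearIsometryEquiv.dist_map, dist_comm]; exact hx
  have h2 : dist (complUnitary (f t₀) (x : Completion V)) (complUnitary (f t₀) y) < ε / 3 := by
    rw [LinearIsometryEquiv.dist_map]; exact hx
  have h3 : dist (complUnitary (f t) (x : Completion V)) (complUnitary (f t₀) (x : Completion V))
      < ε / 3 := by
    rw [complUnitary_coe, complUnitary_coe, Completion.dist_eq]; exact ht
  linarith [dist_triangle4 (complUnitary (f t) y) (complUnitary (f t) (x : Completion V))
    (complUnitary (f t₀) (x : Completion V)) (complUnitary (f t₀) y)]

end Completion

section OfRep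

variable {G : Type u} [Group G]

/-- Let `q : E → G` be a surjective homomorphism and `u` a unitary representation of `E` on `H`
such that `Ad u` is trivial on `ker q`.  Then `Ad u` factors through `G`. -/
def actOfRep {E : Type u} [Group E] {q : E →* G} (hq : Function.Surjective q) {H : Type u}
    [NormedAddCommGroup H] [InnerProductSpace ℂ H] [CompleteSpace H] (u : E →* (H ≃ₗᵢ[ℂ] H))
    (hker : ∀ x, q x = 1 → Ad (u x) = 1) : G →* (K H ≃⋆ₐ[ℂ] K H) :=
  q.liftOfSurjective hq ⟨Ad.comp u, fun x hx => hker x hx⟩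

theorem actOfRep_apply {E : Type u} [Group E] {q : E →* G} (hq : Function.Surjective q)
    {H : Type u} [NormedAddCommGroup H] [InnerProductSpace ℂ H] [CompleteSpace H]
    (u : E →* (H ≃ₗᵢ[ℂ] H)) (hker : ∀ x, q x = 1 → Ad (u x) = 1) (x : E) :
    actOfRep hq u hker (q x) = Ad (u x) :=
  MonoidHom.liftOfRightInverse_comp_apply q _ _ ⟨Ad.comp u, fun x hx => hker x hx⟩ x

theorem continuous_actOfRep [TopologicalSpace G] {E : Type u} [Group E] [TopologicalSpace E] {q : E →* G}
    (hq : IsOpenQuotientMap q) {H : Type u}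
    [NormedAddCommGroup H] [InnerProductSpace ℂ H] [CompleteSpace H] (u : E →* (H ≃ₗᵢ[ℂ] H))
    (hu : Continuous u) (hker : ∀ x, q x = 1 → Ad (u x) = 1) (T : K H) :
    Continuous fun g => actOfRep hq.surjective u hker g T := by
  rw [hq.isQuotientMap.continuous_iff]
  exact (continuous_Ad hu T).congr fun x =>
    (DFunLike.congr_fun (actOfRep_apply hq.surjective u hker x) T).symm

end OfRep

section Tensor

open UniformSpace

variable (H H₂ : Type u) [NormedAddCommGroup H] [InnerProductSpace ℂ H]
  [NormedAddCommGroup H₂] [InnerProductSpace ℂ H₂]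

/-- The Hilbert space tensor product: the completion of the algebraic tensor product with respect
to the inner product `⟪x ⊗ y, x' ⊗ y'⟫ = ⟪x, x'⟫ ⟪y, y'⟫`. -/
def HilbertTensor : Type u := Completion (H ⊗[ℂ] H₂)

instance : NormedAddCommGroup (HilbertTensor H H₂) :=
  inferInstanceAs (NormedAddCommGroup (Completion (H ⊗[ℂ] H₂)))

instance : InnerProductSpace ℂ (HilbertTensor H H₂) :=
  inferInstanceAs (InnerProductSpace ℂ (Completion (H ⊗[ℂ] H₂)))

instance : CompleteSpace (HilbertTensor H H₂) :=
  inferInstanceAs (CompleteSpace (Completion (H ⊗[ℂ] H₂)))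

instance [Nontrivial H] [Nontrivial H₂] : Nontrivial (HilbertTensor H H₂) := by
  obtain ⟨x, hx⟩ := exists_ne (0 : H)
  obtain ⟨y, hy⟩ := exists_ne (0 : H₂)
  change Nontrivial (Completion (H ⊗[ℂ] H₂))
  refine ⟨⟨((x ⊗ₜ[ℂ] y : H ⊗[ℂ] H₂) : Completion (H ⊗[ℂ] H₂)), 0, fun h => ?_⟩⟩
  have h1 := congrArg norm h
  rw [Completion.norm_coe, TensorProduct.norm_tmul, norm_zero] at h1
  exact mul_ne_zero (norm_ne_zero_iff.2 hx) (norm_ne_zero_iff.2 hy) h1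

variable {H H₂}

/-- The elementary tensor `x ⊗ y`. -/
def htmul (x : H) (y : H₂) : HilbertTensor H H₂ := ((x ⊗ₜ[ℂ] y : H ⊗[ℂ] H₂) : Completion (H ⊗[ℂ] H₂))

/-- The tensor product `v ⊗ w` of two unitaries. -/
def tensorUnitary : (H ≃ₗᵢ[ℂ] H) × (H₂ ≃ₗᵢ[ℂ] H₂) →*
    (HilbertTensor H H₂ ≃ₗᵢ[ℂ] HilbertTensor H H₂) :=
  complUnitary.comp
    { toFun := fun p => TensorProduct.congrIsometry p.1 p.2
      map_one' := TensorProduct.congrIsometry_refl_refl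
      map_mul' := fun p r => by
        apply LinearIsometryEquiv.toLinearEquiv_injective
        apply LinearEquiv.toLinearMap_injective
        ext x y
        rfl }

theorem tensorUnitary_htmul (p : (H ≃ₗᵢ[ℂ] H) × (H₂ ≃ₗᵢ[ℂ] H₂)) (x : H) (y : H₂) :
    tensorUnitary p (htmul x y) = htmul (p.1 x) (p.2 y) :=
  complUnitary_coe (TensorProduct.congrIsometry p.1 p.2) (x ⊗ₜ[ℂ] y)

theorem continuous_tensorUnitary :
    Continuous (tensorUnitary : (H ≃ₗᵢ[ℂ] H) × (H₂ ≃ₗᵢ[ℂ] H₂) → _) := by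
  refine continuous_complUnitary fun z => ?_
  induction z using TensorProduct.induction_on with
  | zero => simpa using continuous_const
  | tmul x y =>
    have h1 : Continuous fun p : (H ≃ₗᵢ[ℂ] H) × (H₂ ≃ₗᵢ[ℂ] H₂) => p.1 x :=
      (continuous_unitary_iff.1 continuous_id x).comp continuous_fst
    have h2 : Continuous fun p : (H ≃ₗᵢ[ℂ] H) × (H₂ ≃ₗᵢ[ℂ] H₂) => p.2 y :=
      (continuous_unitary_iff.1 continuous_id y).comp continuous_snd
    exact TensorProduct.continuous_tmul.comp (h1.prodMk h2)
  | add a b ha hb =>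
    refine (ha.add hb).congr fun p => ?_
    exact (map_add _ _ _).symm

theorem HilbertTensor.ext_continuous {f g : HilbertTensor H H₂ →+ HilbertTensor H H₂}
    (hf : Continuous f) (hg : Continuous g)
    (h : ∀ (x : H) (y : H₂), f (htmul x y) = g (htmul x y)) (z : HilbertTensor H H₂) :
    f z = g z := by
  refine Completion.induction_on z (isClosed_eq hf hg) fun a => ?_
  induction a using TensorProduct.induction_on with
  | zero => exact (map_zero f).trans (map_zero g).symm
  | tmul x y => exact h x y
  | add a b ha hb =>
    rw [Completion.coe_add]
    exact (map_add f _ _).trans ((congrArg₂ (· + ·) ha hb).trans (map_add g _ _).symm)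

theorem HilbertTensor.ext {S T : K (HilbertTensor H H₂)}
    (h : ∀ (x : H) (y : H₂), (S : HilbertTensor H H₂ →L[ℂ] HilbertTensor H H₂) (htmul x y) =
      (T : HilbertTensor H H₂ →L[ℂ] HilbertTensor H H₂) (htmul x y)) :
    S = T :=
  K.ext (HilbertTensor.ext_continuous (f := ((S : HilbertTensor H H₂ →L[ℂ] HilbertTensor H H₂) :
      HilbertTensor H H₂ →ₗ[ℂ] HilbertTensor H H₂).toAddMonoidHom)
    (g := ((T : HilbertTensor H H₂ →L[ℂ] HilbertTensor H H₂) :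
      HilbertTensor H H₂ →ₗ[ℂ] HilbertTensor H H₂).toAddMonoidHom)
    (ContinuousLinearMap.continuous _) (ContinuousLinearMap.continuous _) h)

theorem HilbertTensor.ext_unitary {v w : HilbertTensor H H₂ ≃ₗᵢ[ℂ] HilbertTensor H H₂}
    (h : ∀ (x : H) (y : H₂), v (htmul x y) = w (htmul x y)) : v = w := by
  exact LinearIsometryEquiv.ext (HilbertTensor.ext_continuous
    (f := ((v : HilbertTensor H H₂ →L[ℂ] HilbertTensor H H₂) :
      HilbertTensor H H₂ →ₗ[ℂ] HilbertTensor H H₂).toAddMonoidHom)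
    (g := ((w : HilbertTensor H H₂ →L[ℂ] HilbertTensor H H₂) :
      HilbertTensor H H₂ →ₗ[ℂ] HilbertTensor H H₂).toAddMonoidHom)
    v.continuous w.continuous h)

theorem smul_htmul_smul (c d : ℂ) (x : H) (y : H₂) :
    htmul (c • x) (d • y) = (c * d) • htmul x y := by
  change ((_ : H ⊗[ℂ] H₂) : Completion (H ⊗[ℂ] H₂)) = _
  rw [TensorProduct.smul_tmul_smul, Completion.coe_smul]
  rfl

variable [CompleteSpace H] [CompleteSpace H₂]

/-- `C` is the tensor product `S ⊗ T` of the compact operators `S` and `T`. -/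
def IsTensor (S : K H) (T : K H₂) (C : K (HilbertTensor H H₂)) : Prop :=
  ∀ x y, (C : HilbertTensor H H₂ →L[ℂ] HilbertTensor H H₂) (htmul x y) =
    htmul ((S : H →L[ℂ] H) x) ((T : H₂ →L[ℂ] H₂) y)

end Tensor

namespace CompactAction

variable {G : Type u} [Group G] [TopologicalSpace G] [IsTopologicalGroup G]
  [LocallyCompactSpace G] [T2Space G] (α β : CompactAction G)

/-- The representation `(g, v) ↦ v` of `G_α` on `H_α`. -/
def rep : α.twist.E →* (α.H ≃ₗᵢ[ℂ] α.H) := (MonoidHom.snd G _).comp α.grp.subtype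

theorem continuous_rep : Continuous α.rep := continuous_snd.comp continuous_subtype_val

theorem act_q (x : α.twist.E) : α.act (α.twist.q x) = Ad (α.rep x) := x.2

theorem rep_ι (z : Circle) : α.rep (α.twist.ι z) = scalarUnitary α.H z := rfl

/-- The representation `(g, v, w) ↦ v ⊗ w` of `G_α ×_G G_β` on `H_α ⊗ H_β`. -/
def tensorRep : α.twist.fibre β.twist →*
    (HilbertTensor α.H β.H ≃ₗᵢ[ℂ] HilbertTensor α.H β.H) :=
  tensorUnitary.comp ((α.rep.prodMap β.rep).comp (α.twist.fibre β.twist).subtype)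

theorem continuous_tensorRep : Continuous (α.tensorRep β) :=
  continuous_tensorUnitary.comp
    ((α.continuous_rep.prodMap β.continuous_rep).comp continuous_subtype_val)

theorem tensorRep_htmul (p : α.twist.fibre β.twist) (x : α.H) (y : β.H) :
    α.tensorRep β p (htmul x y) = htmul (α.rep p.1.1 x) (β.rep p.1.2 y) :=
  tensorUnitary_htmul _ x y

theorem Ad_tensorRep (p : α.twist.fibre β.twist) (hp : α.twist.fibreProj β.twist p = 1) :
    Ad (α.tensorRep β p) = 1 := by
  have ha : α.twist.q p.1.1 = 1 := hp
  have hb : β.twist.q p.1.2 = 1 := Eq.trans (Eq.symm p.2) ha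
  obtain ⟨z, hz⟩ := α.twist.exists_ι ha
  obtain ⟨w, hw⟩ := β.twist.exists_ι hb
  have : α.tensorRep β p = scalarUnitary _ (z * w) := by
    apply HilbertTensor.ext_unitary
    intro x y
    rw [tensorRep_htmul, ← hz, ← hw, rep_ι, rep_ι, scalarUnitary_apply, scalarUnitary_apply,
      scalarUnitary_apply, Circle.coe_mul, smul_htmul_smul]
  exact (congrArg Ad this).trans (Ad_scalarUnitary _)

/-- The diagonal action `α ⊗ β` on `𝓚(H_α) ⊗ 𝓚(H_β) = 𝓚(H_α ⊗ H_β)` as a homomorphism, given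
by `(α ⊗ β)_g = Ad (v ⊗ w)` if `α_g = Ad v` and `β_g = Ad w`.  It is the action with
`(α ⊗ β)_g (S ⊗ T) = α_g(S) ⊗ β_g(T)`, see `tensorAct_tmul`. -/
def tensorAct : G →* (K (HilbertTensor α.H β.H) ≃⋆ₐ[ℂ] K (HilbertTensor α.H β.H)) :=
  actOfRep (α.twist.isOpenQuotientMap_fibreProj β.twist).surjective (α.tensorRep β)
    (α.Ad_tensorRep β)

/-- `(α ⊗ β)_g = Ad (v ⊗ w)` whenever `α_g = Ad v` and `β_g = Ad w`. -/
theorem tensorAct_eq {g : G} {v : α.H ≃ₗᵢ[ℂ] α.H} {w : β.H ≃ₗᵢ[ℂ] β.H} (hv : α.act g = Ad v)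
    (hw : β.act g = Ad w) : α.tensorAct β g = Ad (tensorUnitary (v, w)) :=
  actOfRep_apply (α.twist.isOpenQuotientMap_fibreProj β.twist).surjective (α.tensorRep β)
    (α.Ad_tensorRep β) ⟨(⟨(g, v), hv⟩, ⟨(g, w), hw⟩), rfl⟩

/-- If `C` is the compact operator `S ⊗ T`, then `(α ⊗ β)_g C` is the compact operator
`α_g(S) ⊗ β_g(T)`. -/
theorem tensorAct_tmul (g : G) {S : K α.H} {T : K β.H} {C : K (HilbertTensor α.H β.H)}
    (hC : IsTensor S T C) : IsTensor (α.act g S) (β.act g T) (α.tensorAct β g C) := by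
  intro x y
  obtain ⟨v, hv⟩ := Ad_surjective (α.act g)
  obtain ⟨w, hw⟩ := Ad_surjective (β.act g)
  rw [α.tensorAct_eq β hv.symm hw.symm, ← hv, ← hw, Ad_apply_apply, Ad_apply_apply,
    Ad_apply_apply]
  have h : (tensorUnitary (v, w))⁻¹ (htmul x y) = htmul (v⁻¹ x) (w⁻¹ y) := by
    rw [← map_inv]; exact tensorUnitary_htmul _ _ _
  rw [h, hC, tensorUnitary_htmul]

/-- The diagonal action `α ⊗ β` of `G` on `𝓚(H_α) ⊗ 𝓚(H_β) = 𝓚(H_α ⊗ H_β)`. -/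
def tensor : CompactAction G where
  H := HilbertTensor α.H β.H
  act := α.tensorAct β
  continuous_act := continuous_actOfRep (α.twist.isOpenQuotientMap_fibreProj β.twist)
    (α.tensorRep β) (α.continuous_tensorRep β) (α.Ad_tensorRep β)

end CompactAction

section Conjugate

variable (H : Type u)

/-- The conjugate of a complex Hilbert space: the same additive group with the same norm, with
scalar multiplication `c • ξ̄ = (conj c • ξ)‾` and inner product `⟪ξ̄, η̄⟫ = ⟪η, ξ⟫`. -/
def Conjugate : Type u := H

variable {H} in
/-- The conjugate linear bijection `ξ ↦ ξ̄`. -/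
def toConj : H ≃ Conjugate H := Equiv.refl H

namespace Conjugate

variable [NormedAddCommGroup H]

instance : NormedAddCommGroup (Conjugate H) := inferInstanceAs (NormedAddCommGroup H)

instance [Nontrivial H] : Nontrivial (Conjugate H) := inferInstanceAs (Nontrivial H)

instance [CompleteSpace H] : CompleteSpace (Conjugate H) := inferInstanceAs (CompleteSpace H)

variable [InnerProductSpace ℂ H]

instance : Module ℂ (Conjugate H) := Module.compHom H (starRingEnd ℂ)

theorem smul_toConj (c : ℂ) (x : H) : c • toConj x = toConj (conj c • x) := rfl

theorem toConj_symm_smul (c : ℂ) (x : Conjugate H) :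
    toConj.symm (c • x) = conj c • toConj.symm x := rfl

instance : InnerProductSpace ℂ (Conjugate H) where
  norm_smul_le c x := by
    change ‖(conj c • (toConj.symm x : H) : H)‖ ≤ ‖c‖ * ‖(toConj.symm x : H)‖
    rw [norm_smul, RCLike.norm_conj]
  inner x y := inner ℂ (toConj.symm y) (toConj.symm x)
  norm_sq_eq_re_inner x := norm_sq_eq_re_inner (𝕜 := ℂ) (toConj.symm x)
  conj_inner_symm x y := inner_conj_symm _ _
  add_left x y z := inner_add_right (𝕜 := ℂ) (toConj.symm z) (toConj.symm x) (toConj.symm y)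
  smul_left x y c := inner_smul_right (𝕜 := ℂ) (toConj.symm y) (toConj.symm x) (conj c)

end Conjugate

variable {H} [NormedAddCommGroup H] [InnerProductSpace ℂ H] [CompleteSpace H]

/-- The conjugate linear bijection `T ↦ T̄`, `T̄ ξ̄ = (T ξ)‾`, of compact operators. -/
def barK : K H ≃ K (Conjugate H) where
  toFun T :=
    ⟨{ toFun := fun x => toConj ((T : H →L[ℂ] H) (toConj.symm x))
       map_add' := fun x y => map_add (T : H →L[ℂ] H) (toConj.symm x) (toConj.symm y)
       map_smul' := fun c x => map_smul (T : H →L[ℂ] H) (conj c) (toConj.symm x)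
       cont := (T : H →L[ℂ] H).continuous }, T.2⟩
  invFun T :=
    ⟨{ toFun := fun x => toConj.symm ((T : Conjugate H →L[ℂ] Conjugate H) (toConj x))
       map_add' := fun x y => map_add (T : Conjugate H →L[ℂ] Conjugate H) (toConj x) (toConj y)
       map_smul' := fun c x => by
        have := map_smul (T : Conjugate H →L[ℂ] Conjugate H) (conj c) (toConj x)
        rw [Conjugate.smul_toConj, Complex.conj_conj] at this
        rw [this, Conjugate.toConj_symm_smul, Complex.conj_conj]
        rfl
       cont := (T : Conjugate H →L[ℂ] Conjugate H).continuous }, T.2⟩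
  left_inv T := rfl
  right_inv T := rfl

theorem barK_apply (T : K H) (x : H) :
    ((barK T : K (Conjugate H)) : Conjugate H →L[ℂ] Conjugate H) (toConj x) =
      toConj ((T : H →L[ℂ] H) x) := rfl

theorem barK_add (S T : K H) : barK (S + T) = barK S + barK T := rfl

theorem barK_mul (S T : K H) : barK (S * T) = barK S * barK T := rfl

theorem barK_smul (c : ℂ) (T : K H) : barK (c • T) = conj c • barK T := by
  refine K.ext fun x => ?_
  change toConj (c • (T : H →L[ℂ] H) (toConj.symm x)) =
    toConj (conj (conj c) • (T : H →L[ℂ] H) (toConj.symm x))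
  rw [Complex.conj_conj]

theorem barK_star (T : K H) : barK (star T) = star (barK T) := by
  refine K.ext fun x => ?_
  refine ext_inner_right ℂ fun y => ?_
  rw [K.star_inner (star (barK T)), star_star]
  change inner ℂ (toConj.symm y) (((star T : K H) : H →L[ℂ] H) (toConj.symm x)) = _
  rw [← K.star_inner]
  rfl

theorem norm_barK (T : K H) : ‖barK T‖ = ‖T‖ := by
  apply le_antisymm
  · exact ContinuousLinearMap.opNorm_le_bound _ (norm_nonneg _) fun x =>
      ContinuousLinearMap.le_opNorm (T : H →L[ℂ] H) (toConj.symm x)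
  · exact ContinuousLinearMap.opNorm_le_bound _ (norm_nonneg _) fun x =>
      ContinuousLinearMap.le_opNorm ((barK T : K (Conjugate H)) : Conjugate H →L[ℂ] Conjugate H)
        (toConj x)

theorem continuous_barK : Continuous (barK : K H → K (Conjugate H)) := by
  refine Isometry.continuous (Isometry.of_dist_eq fun S T => ?_)
  rw [dist_eq_norm, dist_eq_norm, ← norm_barK (S - T)]
  rfl

/-- The automorphism `ā` of `𝓚(H̄)` given by `ā(T̄) = (a(T))‾`, for an automorphism `a`. -/
def conjAut (a : K H ≃⋆ₐ[ℂ] K H) : K (Conjugate H) ≃⋆ₐ[ℂ] K (Conjugate H) where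
  toFun T := barK (a (barK.symm T))
  invFun T := barK (a.symm (barK.symm T))
  left_inv T := by
    change barK (a.symm (a (barK.symm T))) = T
    rw [StarAlgEquiv.symm_apply_apply, Equiv.apply_symm_apply]
  right_inv T := by
    change barK (a (a.symm (barK.symm T))) = T
    rw [StarAlgEquiv.apply_symm_apply, Equiv.apply_symm_apply]
  map_mul' S T := by
    change barK (a (barK.symm S * barK.symm T)) = _
    rw [map_mul a, barK_mul]
  map_add' S T := by
    change barK (a (barK.symm S + barK.symm T)) = _
    rw [map_add a, barK_add]
  map_star' S := by
    obtain ⟨S, rfl⟩ := barK.surjective S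
    have h : a (star S) = star (a S) := a.map_star' S
    rw [← barK_star, Equiv.symm_apply_apply, Equiv.symm_apply_apply, ← barK_star, h]
  map_smul' c S := by
    obtain ⟨S, rfl⟩ := barK.surjective S
    have h : c • barK S = barK (conj c • S) := by rw [barK_smul, Complex.conj_conj]
    rw [h, Equiv.symm_apply_apply, Equiv.symm_apply_apply, map_smul a, barK_smul,
      Complex.conj_conj]

theorem conjAut_barK (a : K H ≃⋆ₐ[ℂ] K H) (T : K H) : conjAut a (barK T) = barK (a T) := rfl

variable {G : Type u} [Group G] [TopologicalSpace G]

/-- The conjugate action `ᾱ` of `G` on `𝓚(H̄)`, given by `ᾱ_g(T̄) = (α_g(T))‾`. -/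
def CompactAction.conjAction (α : CompactAction G) : CompactAction G where
  H := Conjugate α.H
  act :=
    { toFun := fun g => conjAut (α.act g)
      map_one' := by rw [map_one]; rfl
      map_mul' := fun g h => by rw [map_mul]; rfl }
  continuous_act T := continuous_barK.comp (α.continuous_act (barK.symm T))

end Conjugate

section HaarIntegral

open MeasureTheory

variable {G : Type*} [Group G] [TopologicalSpace G] [IsTopologicalGroup G] [LocallyCompactSpace G]

/-- The integral with respect to (left) Haar measure on `G`. -/
def haarInt (f : G → ℂ) : ℂ :=
  letI : MeasurableSpace G := borel G
  haveI : BorelSpace G := ⟨rfl⟩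
  ∫ g, f g ∂Measure.haar

theorem haarInt_add {f f' : G → ℂ} (hf : Continuous f) (hf' : HasCompactSupport f)
    (hg : Continuous f') (hg' : HasCompactSupport f') :
    haarInt (fun g => f g + f' g) = haarInt f + haarInt f' := by
  borelize G
  exact integral_add (hf.integrable_of_hasCompactSupport hf')
    (hg.integrable_of_hasCompactSupport hg')

theorem haarInt_const_mul (c : ℂ) (f : G → ℂ) :
    haarInt (fun g => c * f g) = c * haarInt f := by
  borelize G
  exact integral_const_mul c f

theorem haarInt_conj (f : G → ℂ) : haarInt (fun g => conj (f g)) = conj (haarInt f) := by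
  borelize G
  exact integral_conj

theorem haarInt_nonneg {r : G → ℝ} (hr : ∀ g, 0 ≤ r g) :
    0 ≤ (haarInt fun g => (r g : ℂ)).re := by
  borelize G
  have h : (haarInt fun g => (r g : ℂ)) = ((∫ g, r g ∂Measure.haar : ℝ) : ℂ) := integral_ofReal
  rw [h, Complex.ofReal_re]
  exact integral_nonneg hr

theorem haarInt_pos {r : G → ℝ} (hr : ∀ g, 0 ≤ r g) (hc : Continuous r) (hs : HasCompactSupport r)
    {g₀ : G} (h0 : r g₀ ≠ 0) : 0 < (haarInt fun g => (r g : ℂ)).re := by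
  borelize G
  have h : (haarInt fun g => (r g : ℂ)) = ((∫ g, r g ∂Measure.haar : ℝ) : ℂ) := integral_ofReal
  rw [h, Complex.ofReal_re]
  exact hc.integral_pos_of_hasCompactSupport_nonneg_nonzero hs hr h0

theorem haarInt_mul_left (f : G → ℂ) (h : G) : haarInt (fun g => f (h * g)) = haarInt f := by
  borelize G
  exact integral_mul_left_eq_self f h

theorem haarInt_mul_right {r : G → ℝ} (hc : Continuous r) (hs : HasCompactSupport r) (h : G) :
    (haarInt fun g => (r (g * h) : ℂ)) =
      (Measure.modularCharacterFun h : ℝ) * haarInt fun g => (r g : ℂ) := by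
  borelize G
  have h1 : ∀ r : G → ℝ, (haarInt fun g => (r g : ℂ)) = ((∫ g, r g ∂Measure.haar : ℝ) : ℂ) :=
    fun r => integral_ofReal
  rw [h1, h1 r, ← Complex.ofReal_mul, Complex.ofReal_inj]
  have h2 := Measure.integral_isMulLeftInvariant_eq_smul_of_hasCompactSupport
    (Measure.map (· * h) Measure.haar) (Measure.haar (G := G)) hc hs
  rw [integral_smul_nnreal_measure, integral_map (by fun_prop) hc.aestronglyMeasurable,
    ← Measure.modularCharacterFun_eq_haarScalarFactor] at h2
  exact h2

theorem continuousOn_haarInt {X : Type*} [TopologicalSpace X] {f : X → G → ℂ} {s : Set X}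
    {C : Set G} (hC : IsCompact C) (hf : Continuous fun p : X × G => f p.1 p.2)
    (hfC : ∀ x ∈ s, ∀ g ∉ C, f x g = 0) : ContinuousOn (fun x => haarInt (f x)) s := by
  borelize G
  exact continuousOn_integral_of_compact_support hC hf.continuousOn fun x g hx hg => hfC x hx g hg

theorem continuous_haarInt {X : Type*} [TopologicalSpace X] {f : X → G → ℂ}
    {C : Set G} (hC : IsCompact C) (hf : Continuous fun p : X × G => f p.1 p.2)
    (hfC : ∀ x, ∀ g ∉ C, f x g = 0) : Continuous (fun x => haarInt (f x)) := by
  rw [← continuousOn_univ]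
  exact continuousOn_haarInt hC hf fun x _ => hfC x

theorem continuous_modularCharacterFun [T2Space G] :
    Continuous fun g : G => (Measure.modularCharacterFun g : ℝ) := by
  obtain ⟨⟨r, hc⟩, hs, h0, h1⟩ := exists_continuous_nonneg_pos (1 : G)
  have hpos := haarInt_pos h0 hc hs h1
  have he : ∀ g : G, (Measure.modularCharacterFun g : ℝ) =
      (haarInt fun x => (r (x * g) : ℂ)).re / (haarInt fun x => (r x : ℂ)).re := fun g => by
    rw [haarInt_mul_right hc hs, Complex.re_ofReal_mul]
    exact (mul_div_cancel_right₀ _ hpos.ne').symm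
  rw [continuous_congr he]
  refine Continuous.div_const (Complex.continuous_re.comp ?_) _
  rw [continuous_iff_continuousAt]
  intro g₀
  obtain ⟨W, hW, hW'⟩ := exists_compact_mem_nhds g₀
  have hcomp : IsCompact ((fun p : G × G => p.1 * p.2⁻¹) '' (tsupport r ×ˢ W)) :=
    (hs.isCompact.prod hW).image (by fun_prop)
  refine (continuousOn_haarInt (s := W) hcomp (by fun_prop) ?_).continuousAt hW'
  intro g hg x hx
  by_contra hne
  refine hx ⟨(x * g, g), ⟨subset_tsupport _ fun h => hne ?_, hg⟩, by simp⟩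
  simp [h]

/-- The modular function `Δ` of `G`, normalised by `Δ(h) ∫ f(g h) dg = ∫ f(g) dg` for left Haar
measure `dg`. -/
def modular (h : G) : ℝ := ((Measure.modularCharacterFun h : ℝ))⁻¹

theorem modular_pos (h : G) : 0 < modular h :=
  inv_pos.2 (NNReal.coe_pos.2 (Measure.modularCharacterFun_pos h))

theorem modular_mul (g h : G) : modular (g * h) = modular g * modular h := by
  unfold modular
  rw [Measure.modularCharacterFun_map_mul, NNReal.coe_mul, mul_inv]

theorem modular_one : modular (1 : G) = 1 := by
  unfold modular
  rw [Measure.modularCharacterFun_map_one, NNReal.coe_one, inv_one]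

theorem continuous_modular [T2Space G] : Continuous (modular : G → ℝ) :=
  continuous_modularCharacterFun.inv₀ fun h => (NNReal.coe_pos.2
    (Measure.modularCharacterFun_pos h)).ne'

theorem modular_mul_haarInt {r : G → ℝ} (hc : Continuous r) (hs : HasCompactSupport r) (h : G) :
    ((modular h : ℝ) : ℂ) * (haarInt fun g => (r (g * h) : ℂ)) = haarInt fun g => (r g : ℂ) := by
  rw [haarInt_mul_right hc hs, ← mul_assoc, ← Complex.ofReal_mul]
  unfold modular
  rw [inv_mul_cancel₀ (NNReal.coe_pos.2 (Measure.modularCharacterFun_pos h)).ne',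
    Complex.ofReal_one, one_mul]

end HaarIntegral

section RegularRepresentation

set_option linter.unusedSectionVars false

open MeasureTheory

variable {G : Type u} [Group G] [TopologicalSpace G]

namespace GroupTwist

variable (A : GroupTwist G)

/-- The space `C_c(E, ι)` of continuous compactly supported functions `f : E → ℂ` with
`f (x ι(z)) = z f(x)`. -/
def ccSubmodule : Submodule ℂ (A.E → ℂ) where
  carrier := {f | Continuous f ∧ HasCompactSupport f ∧ ∀ x z, f (x * A.ι z) = z * f x}
  add_mem' := fun {f f'} ⟨h1, h2, h3⟩ ⟨h1', h2', h3'⟩ =>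
    ⟨h1.add h1', h2.add h2', fun x z => by simp only [Pi.add_apply, h3, h3', mul_add]⟩
  zero_mem' := ⟨continuous_const, HasCompactSupport.zero, fun x z => by simp⟩
  smul_mem' := fun c f ⟨h1, h2, h3⟩ =>
    ⟨h1.const_smul c, h2.mono' (Function.support_const_smul_subset c f |>.trans subset_closure),
      fun x z => by simp only [Pi.smul_apply, h3, smul_eq_mul]; ring⟩

/-- `C_c(E, ι)` as a type of its own, to be equipped with its `L²`-inner product. -/
def Cc : Type u := A.ccSubmodule

instance : AddCommGroup A.Cc := inferInstanceAs (AddCommGroup A.ccSubmodule)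

instance : Module ℂ A.Cc := inferInstanceAs (Module ℂ A.ccSubmodule)

instance : CoeFun A.Cc fun _ => A.E → ℂ := ⟨fun f => f.1⟩

variable {A}

theorem Cc.ext {f f' : A.Cc} (h : ∀ x, f x = f' x) : f = f' := Subtype.ext (funext h)

theorem Cc.continuous (f : A.Cc) : Continuous f := f.2.1

theorem Cc.hasCompactSupport (f : A.Cc) : HasCompactSupport f := f.2.2.1

theorem Cc.apply_mul_ι (f : A.Cc) (x : A.E) (z : Circle) : f (x * A.ι z) = z * f x := f.2.2.2 x z

theorem Cc.add_apply (f f' : A.Cc) (x : A.E) : (f + f') x = f x + f' x := rfl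

theorem Cc.smul_apply (c : ℂ) (f : A.Cc) (x : A.E) : (c • f) x = c * f x := rfl

variable (A) in
/-- A (not necessarily continuous) section of `q`. -/
def sec (g : G) : A.E := Function.surjInv A.surjective_q g

theorem q_sec (g : G) : A.q (A.sec g) = g := Function.surjInv_eq _ g

theorem exists_sec (x : A.E) : ∃ z, A.sec (A.q x) = x * A.ι z := by
  obtain ⟨z, hz⟩ := A.exists_ι (x := x⁻¹ * A.sec (A.q x)) (by
    rw [map_mul, map_inv, q_sec, inv_mul_cancel])
  exact ⟨z, by rw [hz, mul_inv_cancel_left]⟩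

/-- The function `q x ↦ conj (ξ x) η x` on `G`; it is well defined, see `prodFun_q`. -/
def prodFun (ξ η : A.Cc) (g : G) : ℂ := conj (ξ (A.sec g)) * η (A.sec g)

theorem prodFun_q (ξ η : A.Cc) (x : A.E) : prodFun ξ η (A.q x) = conj (ξ x) * η x := by
  obtain ⟨z, hz⟩ := A.exists_sec x
  have hz1 : conj (z : ℂ) * (z : ℂ) = 1 := by
    rw [← Complex.normSq_eq_conj_mul_self, Complex.normSq_eq_norm_sq, Circle.norm_coe]; simp
  unfold prodFun
  rw [hz, Cc.apply_mul_ι, Cc.apply_mul_ι, map_mul]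
  linear_combination (conj (ξ x) * η x) * hz1

theorem continuous_prodFun (ξ η : A.Cc) : Continuous (prodFun ξ η) := by
  rw [A.isOpenQuotientMap_q.isQuotientMap.continuous_iff]
  refine Continuous.congr (f := fun x => conj (ξ x) * η x) ?_ fun x => (prodFun_q ξ η x).symm
  exact (Complex.continuous_conj.comp ξ.continuous).mul η.continuous

theorem prodFun_eq_zero (ξ η : A.Cc) {g : G} (hg : g ∉ A.q '' tsupport ξ) : prodFun ξ η g = 0 := by
  have h : ξ (A.sec g) = 0 := by
    by_contra h
    exact hg ⟨A.sec g, subset_tsupport _ h, q_sec g⟩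
  unfold prodFun
  rw [h, map_zero, zero_mul]

theorem prodFun_self (ξ : A.Cc) (g : G) : prodFun ξ ξ g = ((‖ξ (A.sec g)‖ ^ 2 : ℝ) : ℂ) := by
  unfold prodFun
  rw [← Complex.normSq_eq_conj_mul_self, Complex.normSq_eq_norm_sq]

theorem isCompact_q_tsupport (ξ : A.Cc) : IsCompact (A.q '' tsupport ξ) :=
  ξ.hasCompactSupport.isCompact.image A.continuous_q

theorem hasCompactSupport_prodFun [T2Space G] (ξ η : A.Cc) : HasCompactSupport (prodFun ξ η) :=
  HasCompactSupport.intro (isCompact_q_tsupport ξ) fun _ hg => prodFun_eq_zero ξ η hg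

theorem continuous_normSq (ξ : A.Cc) : Continuous fun g => ‖ξ (A.sec g)‖ ^ 2 := by
  have h : (fun g => ‖ξ (A.sec g)‖ ^ 2) = fun g => (prodFun ξ ξ g).re :=
    funext fun g => by rw [prodFun_self, Complex.ofReal_re]
  rw [h]
  exact Complex.continuous_re.comp (continuous_prodFun ξ ξ)

theorem hasCompactSupport_normSq [T2Space G] (ξ : A.Cc) :
    HasCompactSupport fun g => ‖ξ (A.sec g)‖ ^ 2 :=
  HasCompactSupport.intro (isCompact_q_tsupport ξ) fun g hg => by
    have := prodFun_eq_zero ξ ξ hg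
    rw [prodFun_self] at this
    exact_mod_cast this

variable [IsTopologicalGroup G] [LocallyCompactSpace G] [T2Space G]

variable (A) in
/-- The inner product `⟪ξ, η⟫ = ∫_G conj (ξ x) η x dg`, `g = q x`, on `C_c(E, ι)`. -/
@[reducible] def ccCore : PreInnerProductSpace.Core ℂ A.Cc where
  inner ξ η := haarInt (prodFun ξ η)
  conj_inner_symm ξ η := by
    change conj (haarInt (prodFun η ξ)) = haarInt (prodFun ξ η)
    rw [← haarInt_conj]
    congr 1
    funext g
    unfold prodFun
    rw [map_mul, Complex.conj_conj, mul_comm]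
  re_inner_nonneg ξ := by
    change 0 ≤ (haarInt (prodFun ξ ξ)).re
    rw [funext (prodFun_self ξ)]
    exact haarInt_nonneg fun g => sq_nonneg _
  add_left ξ ξ' η := by
    change haarInt (prodFun (ξ + ξ') η) = haarInt (prodFun ξ η) + haarInt (prodFun ξ' η)
    rw [← haarInt_add (continuous_prodFun ξ η) (hasCompactSupport_prodFun ξ η)
      (continuous_prodFun ξ' η) (hasCompactSupport_prodFun ξ' η)]
    congr 1
    funext g
    unfold prodFun
    rw [Cc.add_apply, map_add, add_mul]
  smul_left ξ η c := by
    change haarInt (prodFun (c • ξ) η) = conj c * haarInt (prodFun ξ η)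
    rw [← haarInt_const_mul]
    congr 1
    funext g
    unfold prodFun
    rw [Cc.smul_apply, map_mul, mul_assoc]

instance : SeminormedAddCommGroup A.Cc :=
  @InnerProductSpace.Core.toSeminormedAddCommGroup ℂ A.Cc _ _ _ A.ccCore

instance : InnerProductSpace ℂ A.Cc := InnerProductSpace.ofCore A.ccCore

theorem Cc.inner_def (ξ η : A.Cc) : inner ℂ ξ η = haarInt (prodFun ξ η) := rfl

theorem Cc.norm_sq (ξ : A.Cc) : ((‖ξ‖ ^ 2 : ℝ) : ℂ) = haarInt fun g => ((‖ξ (A.sec g)‖ ^ 2 : ℝ) : ℂ) := by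
  have h := inner_self_eq_norm_sq_to_K (𝕜 := ℂ) ξ
  rw [Cc.inner_def, funext (prodFun_self ξ)] at h
  rw [h]
  norm_cast

/-- Right translation `(ρ(x) ξ)(s) = Δ(q x)^{1/2} ξ(s x)` on `C_c(E, ι)`. -/
def transFun (x : A.E) (ξ : A.Cc) : A.Cc :=
  ⟨fun s => (Real.sqrt (modular (A.q x)) : ℂ) * ξ (s * x),
    continuous_const.mul (ξ.continuous.comp (continuous_mul_const x)),
    (ξ.hasCompactSupport.comp_homeomorph (Homeomorph.mulRight x)).mul_left,
    fun s z => by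
      change (Real.sqrt (modular (A.q x)) : ℂ) * ξ (s * A.ι z * x) =
        z * ((Real.sqrt (modular (A.q x)) : ℂ) * ξ (s * x))
      rw [mul_assoc s, A.central, ← mul_assoc s, Cc.apply_mul_ι]
      ring⟩

theorem transFun_apply (x : A.E) (ξ : A.Cc) (s : A.E) :
    transFun x ξ s = (Real.sqrt (modular (A.q x)) : ℂ) * ξ (s * x) := rfl

theorem transFun_mul (x y : A.E) (ξ : A.Cc) : transFun (x * y) ξ = transFun x (transFun y ξ) :=
  Cc.ext fun s => by
    rw [transFun_apply, transFun_apply, transFun_apply, map_mul, modular_mul,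
      Real.sqrt_mul (modular_pos _).le, Complex.ofReal_mul, mul_assoc, ← mul_assoc s]

theorem transFun_one (ξ : A.Cc) : transFun 1 ξ = ξ :=
  Cc.ext fun s => by
    rw [transFun_apply, map_one, modular_one, Real.sqrt_one, Complex.ofReal_one, one_mul, mul_one]

theorem norm_apply_sec (ξ : A.Cc) (x : A.E) : ‖ξ (A.sec (A.q x))‖ = ‖ξ x‖ := by
  obtain ⟨z, hz⟩ := A.exists_sec x
  rw [hz, Cc.apply_mul_ι, norm_mul, Circle.norm_coe, one_mul]

theorem norm_transFun (x : A.E) (ξ : A.Cc) : ‖transFun x ξ‖ = ‖ξ‖ := by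
  have h1 : ∀ g, ((‖transFun x ξ (A.sec g)‖ ^ 2 : ℝ) : ℂ) =
      ((modular (A.q x) : ℝ) : ℂ) * ((‖ξ (A.sec (g * A.q x))‖ ^ 2 : ℝ) : ℂ) := fun g => by
    have h2 : A.q (A.sec g * x) = g * A.q x := by rw [map_mul, q_sec]
    rw [← h2, norm_apply_sec, transFun_apply, norm_mul, mul_pow, Complex.norm_real,
      Real.norm_eq_abs, sq_abs, Real.sq_sqrt (modular_pos _).le, Complex.ofReal_mul]
  have h3 : ((‖transFun x ξ‖ ^ 2 : ℝ) : ℂ) = ((‖ξ‖ ^ 2 : ℝ) : ℂ) := by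
    rw [Cc.norm_sq, Cc.norm_sq, funext h1, haarInt_const_mul,
      modular_mul_haarInt (r := fun g => ‖ξ (A.sec g)‖ ^ 2) (continuous_normSq ξ)
        (hasCompactSupport_normSq ξ)]
  have h4 : ‖transFun x ξ‖ ^ 2 = ‖ξ‖ ^ 2 := Complex.ofReal_injective h3
  exact (pow_left_inj₀ (norm_nonneg _) (norm_nonneg _) two_ne_zero).1 h4

variable (A) in
/-- The representation `ρ` of `E` on `C_c(E, ι)` by right translation. -/
def trans : A.E →* (A.Cc ≃ₗᵢ[ℂ] A.Cc) where
  toFun x :=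
    { toFun := transFun x
      invFun := transFun x⁻¹
      left_inv := fun ξ => by rw [← transFun_mul, inv_mul_cancel, transFun_one]
      right_inv := fun ξ => by rw [← transFun_mul, mul_inv_cancel, transFun_one]
      map_add' := fun ξ η => Cc.ext fun s => by
        rw [Cc.add_apply, transFun_apply, transFun_apply, transFun_apply, Cc.add_apply, mul_add]
      map_smul' := fun c ξ => Cc.ext fun s => by
        rw [RingHom.id_apply, Cc.smul_apply, transFun_apply, transFun_apply, Cc.smul_apply]
        ring
      norm_map' := norm_transFun x }
  map_one' := LinearIsometryEquiv.ext transFun_one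
  map_mul' x y := LinearIsometryEquiv.ext (transFun_mul x y)

theorem trans_apply (x : A.E) (ξ : A.Cc) : A.trans x ξ = transFun x ξ := rfl

theorem continuous_inner_transFun (η ξ : A.Cc) :
    Continuous fun x => inner ℂ η (transFun x ξ) := by
  simp_rw [Cc.inner_def]
  refine continuous_haarInt (isCompact_q_tsupport η) ?_
    fun x g hg => prodFun_eq_zero η (transFun x ξ) hg
  have hq : IsOpenQuotientMap (Prod.map (id : A.E → A.E) A.q) :=
    IsOpenQuotientMap.id.prodMap A.isOpenQuotientMap_q
  rw [hq.isQuotientMap.continuous_iff]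
  refine Continuous.congr (f := fun p : A.E × A.E => conj (η p.2) *
    ((Real.sqrt (modular (A.q p.1)) : ℂ) * ξ (p.2 * p.1))) ?_
      fun p => (prodFun_q η (transFun p.1 ξ) p.2).symm
  refine (Complex.continuous_conj.comp (η.continuous.comp continuous_snd)).mul
    (Continuous.mul ?_ (ξ.continuous.comp (continuous_snd.mul continuous_fst)))
  exact Complex.continuous_ofReal.comp (Real.continuous_sqrt.comp
    (continuous_modular.comp (A.continuous_q.comp continuous_fst)))

theorem continuous_transFun (ξ : A.Cc) : Continuous fun x => transFun x ξ := by
  rw [continuous_iff_continuousAt]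
  intro x₀
  rw [ContinuousAt, tendsto_iff_norm_sub_tendsto_zero]
  have h1 : ∀ x, ‖transFun x ξ - transFun x₀ ξ‖ =
      Real.sqrt (2 * ‖ξ‖ ^ 2 - 2 * (inner ℂ (transFun x₀ ξ) (transFun x ξ) : ℂ).re) := fun x => by
    rw [← Real.sqrt_sq (norm_nonneg (transFun x ξ - transFun x₀ ξ)),
      norm_sub_rev, norm_sub_sq (𝕜 := ℂ), norm_transFun, norm_transFun]
    congr 1
    change ‖ξ‖ ^ 2 - 2 * (inner ℂ (transFun x₀ ξ) (transFun x ξ) : ℂ).re + ‖ξ‖ ^ 2 = _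
    ring
  have h2 : Continuous fun x => ‖transFun x ξ - transFun x₀ ξ‖ := by
    rw [continuous_congr h1]
    exact Real.continuous_sqrt.comp (continuous_const.sub (continuous_const.mul
      (Complex.continuous_re.comp (continuous_inner_transFun (transFun x₀ ξ) ξ))))
  have h3 := h2.tendsto x₀
  rwa [sub_self, norm_zero] at h3

theorem exists_Cc_ne_zero : ∃ (ξ : A.Cc) (x : A.E), ξ x ≠ 0 := by
  have hcoe : Continuous fun z : Circle => (z : ℂ) := continuous_subtype_val
  have hclosed : IsClosed {z : Circle | (z : ℂ).re ≤ 0} :=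
    isClosed_le (Complex.continuous_re.comp hcoe) continuous_const
  have ht : IsClosed (A.ι '' {z : Circle | (z : ℂ).re ≤ 0}) :=
    (hclosed.isCompact.image A.continuous_ι).isClosed
  have hdisj : Disjoint ({1} : Set A.E) (A.ι '' {z : Circle | (z : ℂ).re ≤ 0}) := by
    rw [Set.disjoint_singleton_left]
    rintro ⟨z, hz, hz1⟩
    have : z = 1 := A.injective_ι (by rw [hz1, map_one])
    rw [this] at hz
    norm_num at hz
  obtain ⟨φ, hφ1, hφt, hφs, hφ01⟩ :=
    exists_continuous_one_zero_of_isCompact isCompact_singleton ht hdisj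
  have hφι : ∀ z : Circle, (z : ℂ).re ≤ 0 → φ (A.ι z) = 0 := fun z hz => hφt ⟨z, hz, rfl⟩
  set F : A.E → Circle → ℂ := fun x z => conj (z : ℂ) * ((φ (x * A.ι z) : ℝ) : ℂ) with hF
  have hFc : Continuous fun p : A.E × Circle => F p.1 p.2 := by
    refine (Complex.continuous_conj.comp (hcoe.comp continuous_snd)).mul
      (Complex.continuous_ofReal.comp (φ.continuous.comp
        (continuous_fst.mul (A.continuous_ι.comp continuous_snd))))
  have hcs : ∀ f : Circle → ℂ, HasCompactSupport f := fun f =>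
    HasCompactSupport.intro isCompact_univ fun x hx => (hx (Set.mem_univ x)).elim
  have hsupp : IsCompact ((fun p : A.E × Circle => p.1 * (A.ι p.2)⁻¹) '' (tsupport φ ×ˢ Set.univ)) :=
    (hφs.isCompact.prod isCompact_univ).image
      (continuous_fst.mul (A.continuous_ι.comp continuous_snd).inv)
  refine ⟨⟨fun x => haarInt (F x), continuous_haarInt isCompact_univ hFc
    fun x z hz => (hz (Set.mem_univ z)).elim, HasCompactSupport.intro hsupp fun x hx => ?_,
    fun x w => ?_⟩, 1, ?_⟩
  · have h0 : F x = fun z => 0 * F x z := by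
      funext z
      have h1 : φ (x * A.ι z) = 0 := by
        by_contra hne
        exact hx ⟨(x * A.ι z, z), ⟨subset_tsupport _ hne, Set.mem_univ z⟩,
          mul_inv_cancel_right x (A.ι z)⟩
      rw [hF]
      simp only [h1, Complex.ofReal_zero, mul_zero]
    change haarInt (F x) = 0
    rw [h0, haarInt_const_mul, zero_mul]
  · change haarInt (F (x * A.ι w)) = w * haarInt (F x)
    rw [← haarInt_mul_left (F x) w, ← haarInt_const_mul]
    congr 1
    funext z
    have hz1 : (w : ℂ) * conj (w : ℂ) = 1 := by
      rw [Complex.mul_conj, Complex.normSq_eq_norm_sq, Circle.norm_coe]; simp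
    simp only [hF]
    rw [Circle.coe_mul, map_mul conj, map_mul A.ι, mul_assoc x]
    linear_combination (-conj (z : ℂ) * ((φ (x * (A.ι w * A.ι z)) : ℝ) : ℂ)) * hz1
  · change haarInt (F 1) ≠ 0
    intro h0
    have hF1 : Continuous (F 1) := hFc.comp (continuous_const.prodMk continuous_id)
    have h2 := haarInt_add hF1 (hcs _) (Complex.continuous_conj.comp hF1) (hcs _)
    have h3 : (fun z => F 1 z + (conj ∘ F 1) z) =
        fun z : Circle => ((2 * ((z : ℂ).re * φ (A.ι z)) : ℝ) : ℂ) := by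
      funext z
      have h4 := Complex.add_conj (F 1 z)
      refine h4.trans ?_
      simp only [hF]
      rw [Complex.re_mul_ofReal, Complex.conj_re, one_mul]
    rw [h3, show haarInt (conj ∘ F 1) = conj (haarInt (F 1)) from haarInt_conj _, h0] at h2
    have h5 := haarInt_pos (r := fun z : Circle => 2 * ((z : ℂ).re * φ (A.ι z))) (g₀ := 1) ?_ ?_
      (HasCompactSupport.intro isCompact_univ fun x hx => (hx (Set.mem_univ x)).elim) ?_
    · rw [h2] at h5
      simp at h5
    · intro z
      by_cases hz : (z : ℂ).re ≤ 0
      · rw [hφι z hz]; simp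
      · have := (hφ01 (A.ι z)).1
        have hz' := (not_le.1 hz).le
        positivity
    · exact continuous_const.mul ((Complex.continuous_re.comp hcoe).mul
        (φ.continuous.comp A.continuous_ι))
    · have h6 : φ (A.ι 1) = 1 := hφ1 (by rw [map_one]; rfl)
      rw [h6]
      norm_num

variable (A) in
/-- The Hilbert space `L²(E, ι)`: the completion of `C_c(E, ι)`. -/
def L2 : Type u := UniformSpace.Completion A.Cc

instance : NormedAddCommGroup A.L2 :=
  inferInstanceAs (NormedAddCommGroup (UniformSpace.Completion A.Cc))

instance : InnerProductSpace ℂ A.L2 :=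
  inferInstanceAs (InnerProductSpace ℂ (UniformSpace.Completion A.Cc))

instance : CompleteSpace A.L2 :=
  inferInstanceAs (CompleteSpace (UniformSpace.Completion A.Cc))

instance : Nontrivial A.L2 := by
  change Nontrivial (UniformSpace.Completion A.Cc)
  obtain ⟨ξ, x, hx⟩ := A.exists_Cc_ne_zero
  refine ⟨⟨(ξ : UniformSpace.Completion A.Cc), 0, fun h => ?_⟩⟩
  have h1 := congrArg norm h
  rw [UniformSpace.Completion.norm_coe, norm_zero] at h1
  have h2 := Cc.norm_sq ξ
  have h3 := haarInt_pos (r := fun g => ‖ξ (A.sec g)‖ ^ 2) (g₀ := A.q x) (fun g => sq_nonneg _)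
    (continuous_normSq ξ) (hasCompactSupport_normSq ξ)
    (pow_ne_zero 2 (by rw [norm_apply_sec]; exact norm_ne_zero_iff.2 hx))
  rw [← h2, h1] at h3
  simp at h3

variable (A) in
/-- The unitary representation `ρ` of `E` on `L²(E, ι)` by right translation,
`(ρ(x) ξ)(s) = Δ(q x)^{1/2} ξ(s x)`. -/
def regularRep : A.E →* (A.L2 ≃ₗᵢ[ℂ] A.L2) :=
  (complUnitary (V := A.Cc)).comp A.trans

theorem continuous_regularRep : Continuous A.regularRep :=
  continuous_complUnitary (V := A.Cc) fun ξ => continuous_transFun ξ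

theorem regularRep_ι (z : Circle) : A.regularRep (A.ι z) = scalarUnitary A.L2 z := by
  refine LinearIsometryEquiv.ext fun y => ?_
  refine UniformSpace.Completion.induction_on y (isClosed_eq
    (A.regularRep (A.ι z)).continuous (scalarUnitary A.L2 z).continuous) fun ξ => ?_
  refine (complUnitary_coe (V := A.Cc) (A.trans (A.ι z)) ξ).trans ?_
  have : A.trans (A.ι z) ξ = (z : ℂ) • ξ := Cc.ext fun s => by
    rw [trans_apply, transFun_apply, q_ι, modular_one, Real.sqrt_one, Complex.ofReal_one, one_mul,
      Cc.apply_mul_ι, Cc.smul_apply]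
  rw [this]
  exact UniformSpace.Completion.coe_smul _ _

theorem Ad_regularRep (x : A.E) (hx : A.q x = 1) : Ad (A.regularRep x) = 1 := by
  obtain ⟨z, rfl⟩ := A.exists_ι hx
  rw [regularRep_ι, Ad_scalarUnitary]

variable (A) in
/-- The action of `G` on `𝓚(L²(E, ι))` induced by `Ad ρ`. -/
def regularAction : CompactAction G where
  H := A.L2
  act := actOfRep A.surjective_q A.regularRep A.Ad_regularRep
  continuous_act := continuous_actOfRep A.isOpenQuotientMap_q A.regularRep A.continuous_regularRep
    A.Ad_regularRep

end GroupTwist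

end RegularRepresentation

end GroupTwists

end

noncomputable section

namespace GroupTwists

open scoped Pointwise

/-! ### Properness over `G` and equivalence of twists -/

namespace GroupTwist

/-! The group law on `Br(G)` is transported from `Twist(G)` along `[α] ↦ [G_α]`, so both formulas
become statements about twists. They hold because `G_α` is the group of unitaries implementing `α`.
If `v` and `w` implement `α_g` and `β_g`, then `v ⊗ w` implements `(α ⊗ β)_g`, and scalars multiply,
`z ⊗ w = zw`; hence `G_α * G_β ≅ G_{α ⊗ β}` (`baer_equivalent_twist_tensor`). Likewise the conjugate
unitary `v̄` implements `ᾱ_g`, and the scalar `z` becomes `conj z`; hence the conjugate twist of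
`G_α` is `G_{ᾱ}` (`conjTwist_equivalent_twist_conjAction`).

The bijection itself is also proved. A Morita equivalence yields an equivalence of twists
(`MoritaEquivalent.twist_equivalent`): elements `η ⊗ ζ*` of the bimodule are built from one unit
vector in a one-dimensional corner, and on them `γ_g` has the form `vη ⊗ (wζ)*`, where each `v`
implementing `α_g` determines a unique `w`; the pairs `(v, w)` form the graph of an isomorphism.
Conversely, an isomorphism `G_α ≅ G_β` makes `T ↦ v T w⁻¹` a well defined action of `G` on the
bimodule of compact operators `H_β → H_α` (`moritaEquivalent_of_twist_equivalent`). Surjectivity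
comes from `x ↦ (q x, ρ(x))`, which identifies `E` with the twist of `α_E`
(`equivalent_twist_regularAction`).

No countability is assumed, so topological isomorphisms are not obtained from an open mapping
theorem. Instead, `q` is proper because the circle is compact, and therefore continuous
homomorphisms over `G` are closed maps. The criterion `equivalent_of_cover` packages this: it
produces an equivalence from a group that is proper over `G` and maps to both twists. The group laws
of `Twist(G)` and all comparisons made from homomorphisms below reduce to it. -/

/-- If `f : X → Y × Y` is proper, then so is its restriction to the preimage of the diagonal, as a
map to `Y`. -/
theorem isProperMap_of_diag {X Y : Type*} [TopologicalSpace X]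
    [TopologicalSpace Y] [T2Space Y] {S : Set X} {f : X → Y × Y}
    (hf : IsProperMap f) (hS : ∀ x, x ∈ S ↔ (f x).1 = (f x).2) :
    IsProperMap fun x : S => (f x).1 := by
  have hS' : IsClosed S := by
    have : S = {x | (f x).1 = (f x).2} := Set.ext hS
    rw [this]
    exact isClosed_eq (continuous_fst.comp hf.continuous) (continuous_snd.comp hf.continuous)
  have h1 : IsProperMap fun x : S => f x := hf.comp hS'.isClosedEmbedding_subtypeVal.isProperMap
  -- Followed by the diagonal `g ↦ (g, g)`, the map becomes the restriction of `f` to the closed set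
  -- `S`, which is proper.
  refine isProperMap_of_comp_of_inj (g := fun g : Y => (g, g))
    (continuous_fst.comp h1.continuous) (by fun_prop) ?_ fun a b h => congrArg Prod.fst h
  have h2 : (fun g : Y => (g, g)) ∘ (fun x : S => (f x).1) = fun x : S => f x :=
    funext fun x => Prod.ext rfl ((hS x).1 x.2)
  rw [h2]
  exact h1

variable {G : Type u} [Group G] [TopologicalSpace G]

/-- The projection of a twist is proper, as its kernel is compact. -/
theorem isProperMap_q (A : GroupTwist G) : IsProperMap A.q := by
  have hT : IsCompact (Set.range A.ι) := isCompact_range A.continuous_ι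
  -- The saturation of a set is its product with the compact group `ι(𝕋)`, hence closed if the set
  -- is closed and compact if it is a point.
  have hfib : ∀ s : Set A.E, A.q ⁻¹' (A.q '' s) = s * Set.range A.ι := fun s => by
    ext x
    constructor
    · rintro ⟨y, hy, hyx⟩
      obtain ⟨z, hz⟩ := A.exists_ι (x := y⁻¹ * x) (by rw [map_mul, map_inv, hyx, inv_mul_cancel])
      exact ⟨y, hy, A.ι z, ⟨z, rfl⟩, by simp [hz]⟩
    · rintro ⟨y, hy, _, ⟨z, rfl⟩, rfl⟩
      exact ⟨y, hy, by simp [q_ι]⟩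
  rw [isProperMap_iff_isClosedMap_and_compact_fibers]
  refine ⟨A.continuous_q, fun C hC => ?_, fun g => ?_⟩
  · rw [← A.isOpenQuotientMap_q.isQuotientMap.isClosed_preimage, hfib]
    exact hC.mul_right_of_isCompact hT
  · obtain ⟨x, rfl⟩ := A.surjective_q g
    rw [← Set.image_singleton, hfib]
    exact isCompact_singleton.mul hT

/-- If a group `F` is proper over `G` and maps onto a twist `A` and to a twist `B`, compatibly with
the projections and with the circle subgroups, and if the kernel of the first map is contained in
the kernel of the second, then `A` and `B` are equivalent. -/
theorem equivalent_of_cover {A B : GroupTwist G} {F : Type*} [Group F] [TopologicalSpace F]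
    (p : F →* A.E) (r : F →* B.E) (hp : Continuous p) (hr : Continuous r)
    (hF : IsProperMap fun f => A.q (p f)) (hsurj : Function.Surjective p)
    (hq : ∀ f, B.q (r f) = A.q (p f)) (hker : ∀ f, p f = 1 → r f = 1)
    (hι : ∀ z, ∃ f, p f = A.ι z ∧ r f = B.ι z) : A.Equivalent B := by
  -- Since `q ∘ p` is proper and `A.E` is Hausdorff, `p` is proper; a closed continuous surjection
  -- is a quotient map, so the factorisation `φ` of `r` through `p` is continuous.
  have hpq : Topology.IsQuotientMap p :=
    (isProperMap_of_comp_of_t2 (g := A.q) hp A.continuous_q hF).isClosedMap.isQuotientMap hp hsurj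
  let φ : A.E →* B.E := p.liftOfSurjective hsurj ⟨r, fun f hf => hker f hf⟩
  have hφ : ∀ f, φ (p f) = r f :=
    MonoidHom.liftOfRightInverse_comp_apply p _ _ ⟨r, fun f hf => hker f hf⟩
  have hφc : Continuous φ := by
    rw [hpq.continuous_iff]
    exact hr.congr fun f => (hφ f).symm
  have hφq : ∀ x, B.q (φ x) = A.q x := fun x => by
    obtain ⟨f, rfl⟩ := hsurj x
    rw [hφ, hq]
  have hφι : ∀ z, φ (A.ι z) = B.ι z := fun z => by
    obtain ⟨f, h1, h2⟩ := hι z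
    rw [← h1, hφ, h2]
  -- As `φ` lies over `G`, its kernel is contained in `ι(𝕋)`, where `φ` is the injective map `B.ι`.
  have hinj : Function.Injective φ := by
    rw [injective_iff_map_eq_one]
    intro x hx
    obtain ⟨z, rfl⟩ := A.exists_ι (x := x) (by rw [← hφq, hx, map_one])
    have : z = 1 := B.injective_ι (by rw [← hφι, hx, map_one])
    rw [this, map_one]
  have hsur : Function.Surjective φ := fun y => by
    obtain ⟨x, hx⟩ := A.surjective_q (B.q y)
    obtain ⟨z, hz⟩ := B.exists_ι (x := (φ x)⁻¹ * y)
      (by rw [map_mul, map_inv, hφq, hx, inv_mul_cancel])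
    exact ⟨x * A.ι z, by rw [map_mul, hφι, hz, mul_inv_cancel_left]⟩
  -- The same properness argument, applied to `B.q ∘ φ = A.q`, makes the inverse of `φ` continuous.
  have hcl : IsClosedMap φ := by
    refine (isProperMap_of_comp_of_t2 (g := B.q) hφc B.continuous_q ?_).isClosedMap
    have : B.q ∘ φ = A.q := funext hφq
    rw [this]
    exact A.isProperMap_q
  let e : A.E ≃ B.E := Equiv.ofBijective φ ⟨hinj, hsur⟩
  let h : A.E ≃ₜ B.E := e.toHomeomorphOfContinuousClosed hφc hcl
  exact ⟨{ h with map_mul' := map_mul φ }, hφι, hφq⟩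

/-- The case where the covering group is `A.E` itself: the five lemma gives bijectivity, and
properness over `G` gives continuity of the inverse. -/
theorem equivalent_of_hom {A B : GroupTwist G} (φ : A.E →* B.E) (hφ : Continuous φ)
    (hι : ∀ z, φ (A.ι z) = B.ι z) (hq : ∀ x, B.q (φ x) = A.q x) : A.Equivalent B :=
  equivalent_of_cover (MonoidHom.id A.E) φ continuous_id hφ A.isProperMap_q
    Function.surjective_id hq (fun f hf => by rw [show f = 1 from hf, map_one])
    fun z => ⟨A.ι z, rfl, hι z⟩

theorem conjTwist_congr {A B : GroupTwist G} (h : A.Equivalent B) :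
    A.conjTwist.Equivalent B.conjTwist := by
  obtain ⟨φ, h1, h2⟩ := h
  exact ⟨φ, fun z => h1 z⁻¹, h2⟩

/-! ### The product of twists and its group laws -/

variable [T2Space G]

/-- The fibred product is the preimage of the diagonal of `G × G` under the proper map `q × q`. -/
theorem isProperMap_fibreProj (A B : GroupTwist G) : IsProperMap (A.fibreProj B) :=
  isProperMap_of_diag (S := (A.fibre B : Set (A.E × B.E)))
    (A.isProperMap_q.prodMap B.isProperMap_q) fun _ => Iff.rfl

/-- The class of `(x, y)` in the product of two twists. -/
def baerMk (A B : GroupTwist G) : A.fibre B →* (A.baer B).E :=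
  QuotientGroup.mk' (A.antidiag B).range

theorem continuous_baerMk (A B : GroupTwist G) : Continuous (A.baerMk B) := continuous_quot_mk

theorem surjective_baerMk (A B : GroupTwist G) : Function.Surjective (A.baerMk B) :=
  QuotientGroup.mk'_surjective _

theorem baerMk_eq_one_iff {A B : GroupTwist G} {f : A.fibre B} :
    A.baerMk B f = 1 ↔ ∃ z : Circle, f.1.1 = A.ι z ∧ f.1.2 = B.ι z⁻¹ := by
  refine (QuotientGroup.eq_one_iff f).trans ⟨?_, ?_⟩
  · rintro ⟨z, rfl⟩
    exact ⟨z, rfl, rfl⟩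
  · rintro ⟨z, h1, h2⟩
    exact ⟨z, Subtype.ext (Prod.ext h1.symm h2.symm)⟩

theorem baerMk_ι (A B : GroupTwist G) (z : Circle) :
    A.baerMk B (A.fibreEmb B z) = (A.baer B).ι z := rfl

/-- Dividing by the antidiagonal lets circle elements pass from one factor to the other, so a pair
of them is seen only through its product. -/
theorem baerMk_eq_ι {A B : GroupTwist G} {f : A.fibre B} {z w : Circle} (h1 : f.1.1 = A.ι z)
    (h2 : f.1.2 = B.ι w) : A.baerMk B f = (A.baer B).ι (z * w) := by
  rw [← baerMk_ι, ← mul_inv_eq_one, ← map_inv, ← map_mul, baerMk_eq_one_iff]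
  -- The quotient of `(ι z, ι w)` by `(ι (z * w), 1)` is `(ι w⁻¹, ι w)`, the antidiagonal element of
  -- `w⁻¹`.
  refine ⟨w⁻¹, ?_, ?_⟩
  · change f.1.1 * (A.ι (z * w))⁻¹ = _
    rw [h1, ← map_inv, ← map_mul, mul_inv, mul_inv_cancel_left]
  · change f.1.2 * (1 : B.E)⁻¹ = _
    rw [h2, inv_one, mul_one, inv_inv]

/-- A twist receiving a homomorphism from `A ×_G B` which restricts to the product on `𝕋 × 𝕋` is
equivalent to the product of `A` and `B`. -/
theorem baer_equivalent_of_hom {A B C : GroupTwist G} (r : A.fibre B →* C.E) (hr : Continuous r)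
    (hq : ∀ f, C.q (r f) = A.q f.1.1)
    (hι : ∀ (f : A.fibre B) (z w : Circle), f.1.1 = A.ι z → f.1.2 = B.ι w → r f = C.ι (z * w)) :
    (A.baer B).Equivalent C := by
  refine equivalent_of_cover (A.baerMk B) r (A.continuous_baerMk B) hr (A.isProperMap_fibreProj B)
    (A.surjective_baerMk B) hq (fun f hf => ?_) fun z => ⟨A.fibreEmb B z, rfl, ?_⟩
  -- A kernel element is `(ι z, ι z⁻¹)`, which `r` sends to `ι (z * z⁻¹)`.
  · obtain ⟨z, h1, h2⟩ := baerMk_eq_one_iff.1 hf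
    rw [hι f _ _ h1 h2, mul_inv_cancel, map_one]
  · rw [hι _ z 1 rfl (map_one _).symm, mul_one]

theorem baer_congr {A A' B B' : GroupTwist G} (hA : A.Equivalent A') (hB : B.Equivalent B') :
    (A.baer B).Equivalent (A'.baer B') := by
  obtain ⟨φ, hφι, hφq⟩ := hA
  obtain ⟨ψ, hψι, hψq⟩ := hB
  have hmem : ∀ f : A.fibre B, (φ f.1.1, ψ f.1.2) ∈ A'.fibre B' := fun f => by
    rw [mem_fibre, hφq, hψq]
    exact f.2
  let s : A.fibre B →* A'.fibre B' :=
    { toFun := fun f => ⟨(φ f.1.1, ψ f.1.2), hmem f⟩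
      map_one' := Subtype.ext (Prod.ext (map_one φ) (map_one ψ))
      map_mul' := fun f g => Subtype.ext (Prod.ext (map_mul φ _ _) (map_mul ψ _ _)) }
  have hs : Continuous s := Continuous.subtype_mk
    ((φ.continuous.comp (continuous_fst.comp continuous_subtype_val)).prodMk
      (ψ.continuous.comp (continuous_snd.comp continuous_subtype_val))) hmem
  refine baer_equivalent_of_hom ((A'.baerMk B').comp s) ((A'.continuous_baerMk B').comp hs)
    (fun f => hφq _) fun f z w h1 h2 => ?_
  refine baerMk_eq_ι ?_ ?_
  · exact (congrArg φ h1).trans (hφι z)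
  · exact (congrArg ψ h2).trans (hψι w)

theorem baer_comm (A B : GroupTwist G) : (A.baer B).Equivalent (B.baer A) := by
  let s : A.fibre B →* B.fibre A :=
    { toFun := fun f => ⟨(f.1.2, f.1.1), f.2.symm⟩
      map_one' := rfl
      map_mul' := fun f g => rfl }
  have hs : Continuous s := Continuous.subtype_mk
    ((continuous_snd.comp continuous_subtype_val).prodMk
      (continuous_fst.comp continuous_subtype_val)) _
  refine baer_equivalent_of_hom ((B.baerMk A).comp s) ((B.continuous_baerMk A).comp hs)
    (fun f => f.2.symm) fun f z w h1 h2 => ?_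
  rw [mul_comm]
  exact baerMk_eq_ι h2 h1

/-- The triple fibred product `(A ×_G B) ×_G C`. -/
def fibre₃ (A B C : GroupTwist G) : Subgroup (A.fibre B × C.E) :=
  ((A.fibreProj B).comp (MonoidHom.fst _ _)).eqLocus (C.q.comp (MonoidHom.snd _ _))

/-- Both iterated products are quotients of the triple fibred product, and they are compared there;
no map has to be defined directly on a fibred product with a quotient. -/
theorem baer_assoc (A B C : GroupTwist G) :
    ((A.baer B).baer C).Equivalent (A.baer (B.baer C)) := by
  let p₁ : A.fibre₃ B C →* (A.baer B).fibre C :=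
    { toFun := fun f => ⟨(A.baerMk B f.1.1, f.1.2), f.2⟩
      map_one' := rfl
      map_mul' := fun f g => rfl }
  have hp₁ : Continuous p₁ := Continuous.subtype_mk
    (((A.continuous_baerMk B).comp (continuous_fst.comp continuous_subtype_val)).prodMk
      (continuous_snd.comp continuous_subtype_val)) _
  let r₂ : A.fibre₃ B C →* B.fibre C :=
    { toFun := fun f => ⟨(f.1.1.1.2, f.1.2), f.1.1.2.symm.trans f.2⟩
      map_one' := rfl
      map_mul' := fun f g => rfl }
  have hr₂ : Continuous r₂ := Continuous.subtype_mk
    ((continuous_snd.comp (continuous_subtype_val.comp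
      (continuous_fst.comp continuous_subtype_val))).prodMk
      (continuous_snd.comp continuous_subtype_val)) _
  let r₁ : A.fibre₃ B C →* A.fibre (B.baer C) :=
    { toFun := fun f => ⟨(f.1.1.1.1, B.baerMk C (r₂ f)), f.1.1.2⟩
      map_one' := rfl
      map_mul' := fun f g => rfl }
  have hr₁ : Continuous r₁ := Continuous.subtype_mk
    ((continuous_fst.comp (continuous_subtype_val.comp
      (continuous_fst.comp continuous_subtype_val))).prodMk
      ((B.continuous_baerMk C).comp hr₂)) _
  refine equivalent_of_cover (((A.baer B).baerMk C).comp p₁) ((A.baerMk (B.baer C)).comp r₁)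
    (((A.baer B).continuous_baerMk C).comp hp₁) ((A.continuous_baerMk _).comp hr₁) ?_ ?_
    (fun f => rfl) ?_ ?_
  · exact isProperMap_of_diag (S := (A.fibre₃ B C : Set (A.fibre B × C.E)))
      ((A.isProperMap_fibreProj B).prodMap C.isProperMap_q) fun _ => Iff.rfl
  · refine ((A.baer B).surjective_baerMk C).comp ?_
    rintro ⟨⟨x, y⟩, hxy⟩
    obtain ⟨x, rfl⟩ := A.surjective_baerMk B x
    exact ⟨⟨(x, y), hxy⟩, rfl⟩
  · intro f hf
    obtain ⟨z, h1, h2⟩ := baerMk_eq_one_iff.1 hf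
    -- The class of the first two coordinates is `ι z` in `A * B`; after division by `(ι z, 1)` it
    -- is antidiagonal. Hence the three coordinates are `ι (w * z)`, `ι w⁻¹`, `ι z⁻¹`, with product
    -- of parameters equal to `1`.
    have h3 : A.baerMk B (f.1.1 * (A.fibreEmb B z)⁻¹) = 1 := by
      rw [map_mul, map_inv, mul_inv_eq_one]
      exact h1
    obtain ⟨w, h4, h5⟩ := baerMk_eq_one_iff.1 h3
    have h4' : f.1.1.1.1 = A.ι (w * z) := by
      rw [map_mul]
      exact mul_inv_eq_iff_eq_mul.1 h4
    have h5' : f.1.1.1.2 = B.ι w⁻¹ := by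
      have : f.1.1.1.2 * (1 : B.E)⁻¹ = B.ι w⁻¹ := h5
      rwa [inv_one, mul_one] at this
    refine (baerMk_eq_ι (f := r₁ f) h4' (baerMk_eq_ι (f := r₂ f) h5' h2)).trans ?_
    rw [← mul_inv, mul_inv_cancel, map_one]
  · intro z
    refine ⟨⟨(A.fibreEmb B z, 1), (A.q_ι z).trans (map_one C.q).symm⟩, rfl, ?_⟩
    refine (baerMk_eq_ι (z := z) (w := 1) rfl ?_).trans (by rw [mul_one])
    exact (map_one (B.baerMk C)).trans (map_one _).symm

variable [IsTopologicalGroup G] [LocallyCompactSpace G]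

variable (G) in
/-- The trivial twist `G × 𝕋`. -/
def trivialTwist : GroupTwist G where
  E := G × Circle
  ι := MonoidHom.inr G Circle
  q := MonoidHom.fst G Circle
  continuous_ι := continuous_const.prodMk continuous_id
  injective_ι _ _ h := congrArg Prod.snd h
  central z x := Prod.ext ((one_mul _).trans (mul_one _).symm) (mul_comm _ _)
  continuous_q := continuous_fst
  isOpenMap_q := isOpenMap_fst
  surjective_q g := ⟨(g, 1), rfl⟩
  exact := by
    ext x
    exact ⟨fun hx => ⟨x.2, Prod.ext (Eq.symm hx) rfl⟩, fun ⟨z, hz⟩ => by rw [← hz]; rfl⟩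

/-- The map `((g, z), x) ↦ ι(z) x` is multiplicative because `ι` is central. -/
theorem trivialTwist_baer (A : GroupTwist G) : ((trivialTwist G).baer A).Equivalent A := by
  let r : (trivialTwist G).fibre A →* A.E :=
    { toFun := fun f => A.ι f.1.1.2 * f.1.2
      map_one' := (mul_one _).trans (map_one _)
      map_mul' := fun f g => by
        change A.ι (f.1.1.2 * g.1.1.2) * (f.1.2 * g.1.2) = _
        rw [map_mul, mul_assoc, ← mul_assoc _ f.1.2, A.central _ f.1.2, mul_assoc, mul_assoc] }
  refine baer_equivalent_of_hom r ?_ (fun f => ?_) fun f z w h1 h2 => ?_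
  · have h : Continuous fun f : (trivialTwist G).fibre A => f.1.1 :=
      continuous_fst.comp continuous_subtype_val
    have h' : Continuous fun f : (trivialTwist G).fibre A => f.1.1.2 :=
      (continuous_snd (X := G) (Y := Circle)).comp h
    exact (A.continuous_ι.comp h').mul (continuous_snd.comp continuous_subtype_val)
  · change A.q (A.ι f.1.1.2 * f.1.2) = _
    rw [map_mul, q_ι, one_mul]
    exact f.2.symm
  · change A.ι f.1.1.2 * f.1.2 = _
    rw [h1, h2, map_mul]
    rfl

/-- Elements of the fibred product have the form `(x, x ι(z))`. Changing `x` by a circle element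
moves this pair along the antidiagonal, because `ι` is inverted in the first factor; so its class
depends only on `(q x, z) ∈ G × 𝕋`. -/
theorem conjTwist_baer (A : GroupTwist G) : (A.conjTwist.baer A).Equivalent (trivialTwist G) := by
  let p : A.E × Circle →* (trivialTwist G).E := A.q.prodMap (MonoidHom.id Circle)
  let s : A.E × Circle →* A.conjTwist.fibre A :=
    { toFun := fun f => ⟨(f.1, f.1 * A.ι f.2), by
        rw [mem_fibre]
        change A.q f.1 = A.q (f.1 * A.ι f.2)
        rw [map_mul, q_ι, mul_one]⟩
      map_one' := Subtype.ext (Prod.ext rfl ((one_mul _).trans (map_one _)))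
      map_mul' := fun f g => Subtype.ext (Prod.ext rfl (by
        change f.1 * g.1 * A.ι (f.2 * g.2) = f.1 * A.ι f.2 * (g.1 * A.ι g.2)
        rw [map_mul, mul_assoc, ← mul_assoc g.1, ← A.central f.2 g.1, mul_assoc, mul_assoc])) }
  have hs : Continuous s := Continuous.subtype_mk (continuous_fst.prodMk
    (continuous_fst.mul (A.continuous_ι.comp continuous_snd))) _
  -- The cover `E × 𝕋` maps onto the trivial twist, so the equivalence is built starting from there
  -- and then reversed.
  refine (GroupTwist.setoid G).symm (equivalent_of_cover p ((A.conjTwist.baerMk A).comp s)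
    (A.continuous_q.prodMap continuous_id) ((A.conjTwist.continuous_baerMk A).comp hs) ?_ ?_
    (fun f => rfl) (fun f hf => ?_) fun z => ⟨(1, z), ?_, ?_⟩)
  · exact A.isProperMap_q.comp isProperMap_fst_of_compactSpace
  · rintro ⟨g, z⟩
    obtain ⟨x, rfl⟩ := A.surjective_q g
    exact ⟨(x, z), rfl⟩
  · have h1 : A.q f.1 = 1 := congrArg Prod.fst hf
    have h2 : f.2 = 1 := congrArg Prod.snd hf
    obtain ⟨z, hz⟩ := A.exists_ι h1
    -- The pair `(ι z, ι z)` is antidiagonal with parameter `z⁻¹`, since the embedding of the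
    -- conjugate twist sends `z⁻¹` to `ι z`.
    refine baerMk_eq_one_iff.2 ⟨z⁻¹, ?_, ?_⟩
    · change f.1 = A.ι z⁻¹⁻¹
      rw [inv_inv, hz]
    · change f.1 * A.ι f.2 = A.ι z⁻¹⁻¹
      rw [inv_inv, hz, h2, map_one, mul_one]
  · exact Prod.ext (map_one A.q) rfl
  · refine (baerMk_eq_ι (z := 1) (w := z) (map_one _).symm (one_mul _)).trans ?_
    rw [one_mul]

end GroupTwist

/-! ### The abelian group `Twist(G)` -/

namespace Twist

variable {G : Type u} [Group G] [TopologicalSpace G]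

theorem mk_eq_mk_iff {A B : GroupTwist G} : Twist.mk A = Twist.mk B ↔ A.Equivalent B :=
  ⟨Quotient.exact, fun h => Quotient.sound h⟩

variable [IsTopologicalGroup G] [LocallyCompactSpace G] [T2Space G]

/-- The usual structure of an abelian group on the set of equivalence classes of twists. -/
instance : CommGroup (Twist G) where
  mul := Quotient.map₂ (fun A B => GroupTwist.baer A B)
    fun _ _ hA _ _ hB => GroupTwist.baer_congr hA hB
  one := Twist.mk (GroupTwist.trivialTwist G)
  inv := Quotient.map (GroupTwist.conjTwist (G := G)) fun _ _ hA => GroupTwist.conjTwist_congr hA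
  mul_assoc a b c := by
    induction a, b, c using Quotient.inductionOn₃ with
    | h A B C => exact Quotient.sound (GroupTwist.baer_assoc A B C)
  mul_comm a b := by
    induction a, b using Quotient.inductionOn₂ with
    | h A B => exact Quotient.sound (GroupTwist.baer_comm A B)
  one_mul a := by
    induction a using Quotient.inductionOn with
    | h A => exact Quotient.sound (GroupTwist.trivialTwist_baer A)
  mul_one a := by
    induction a using Quotient.inductionOn with
    | h A => exact Quotient.sound ((GroupTwist.setoid G).trans (GroupTwist.baer_comm _ _)
        (GroupTwist.trivialTwist_baer A))
  inv_mul_cancel a := by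
    induction a using Quotient.inductionOn with
    | h A => exact Quotient.sound (GroupTwist.conjTwist_baer A)

theorem mk_mul_mk (A B : GroupTwist G) : Twist.mk A * Twist.mk B = Twist.mk (A.baer B) := rfl

theorem inv_mk (A : GroupTwist G) : (Twist.mk A)⁻¹ = Twist.mk A.conjTwist := rfl

end Twist

/-! ### Twists of regular actions and of tensor products -/

namespace CompactAction

variable {G : Type u} [Group G] [TopologicalSpace G] [IsTopologicalGroup G]
  [LocallyCompactSpace G] [T2Space G]

/-- The homomorphism `x ↦ (q x, u x)` to `G_α` defined by a unitary representation `u` with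
`α_{q x} = Ad (u x)`. -/
def liftGrp (α : CompactAction G) {F : Type*} [Group F] (q : F →* G) (u : F →* (α.H ≃ₗᵢ[ℂ] α.H))
    (hu : ∀ x, α.act (q x) = Ad (u x)) : F →* α.twist.E :=
  (q.prod u).codRestrict α.grp hu

theorem continuous_liftGrp (α : CompactAction G) {F : Type*} [Group F] [TopologicalSpace F]
    {q : F →* G} {u : F →* (α.H ≃ₗᵢ[ℂ] α.H)} (hu : ∀ x, α.act (q x) = Ad (u x))
    (hqc : Continuous q) (huc : Continuous u) : Continuous (α.liftGrp q u hu) :=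
  Continuous.subtype_mk (hqc.prodMk huc) hu

theorem liftGrp_eq_ι (α : CompactAction G) {F : Type*} [Group F]
    {q : F →* G} {u : F →* (α.H ≃ₗᵢ[ℂ] α.H)} (hu : ∀ x, α.act (q x) = Ad (u x)) {x : F}
    {z : Circle} (hq : q x = 1) (hx : u x = scalarUnitary α.H z) :
    α.liftGrp q u hu x = α.twist.ι z :=
  Subtype.ext (Prod.ext hq hx)

/-- By construction of `α_E`, the unitary `ρ(x)` implements it at `q x`, and `ρ(ι z)` is the scalar
`z`; so `x ↦ (q x, ρ(x))` is a morphism of twists. -/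
theorem equivalent_twist_regularAction (A : GroupTwist G) :
    A.Equivalent A.regularAction.twist := by
  have hu : ∀ x, A.regularAction.act (A.q x) = Ad (A.regularRep x) := fun x =>
    actOfRep_apply A.surjective_q A.regularRep A.Ad_regularRep x
  exact GroupTwist.equivalent_of_hom (A.regularAction.liftGrp A.q A.regularRep hu)
    (A.regularAction.continuous_liftGrp hu A.continuous_q A.continuous_regularRep)
    (fun z => A.regularAction.liftGrp_eq_ι hu (A.q_ι z) (GroupTwist.regularRep_ι z)) fun x => rfl

/-- The morphism is `((g, v), (g, w)) ↦ (g, v ⊗ w)`. On `𝕋 × 𝕋` it multiplies scalars, which is the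
condition for it to factor through the product of twists. -/
theorem baer_equivalent_twist_tensor (α β : CompactAction G) :
    (α.twist.baer β.twist).Equivalent (α.tensor β).twist := by
  have hu : ∀ f : α.twist.fibre β.twist,
      (α.tensor β).act (α.twist.fibreProj β.twist f) = Ad (α.tensorRep β f) := fun f =>
    actOfRep_apply (α.twist.isOpenQuotientMap_fibreProj β.twist).surjective (α.tensorRep β)
      (α.Ad_tensorRep β) f
  refine GroupTwist.baer_equivalent_of_hom ((α.tensor β).liftGrp _ (α.tensorRep β) hu)
    ((α.tensor β).continuous_liftGrp hu
      (α.twist.isOpenQuotientMap_fibreProj β.twist).continuous (α.continuous_tensorRep β))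
    (fun f => rfl) fun f z w hz hw => ?_
  have h : α.tensorRep β f = scalarUnitary (HilbertTensor α.H β.H) (z * w) :=
    HilbertTensor.ext_unitary fun x y => by
      rw [tensorRep_htmul, hz, hw, rep_ι, rep_ι, scalarUnitary_apply, scalarUnitary_apply,
        scalarUnitary_apply, Circle.coe_mul, smul_htmul_smul]
  refine (α.tensor β).liftGrp_eq_ι hu ?_ h
  change α.twist.q f.1.1 = 1
  rw [hz, GroupTwist.q_ι]

end CompactAction

/-! ### Conjugate unitaries and the twist of the conjugate action -/

section ConjugateUnitary

variable {H : Type u} [NormedAddCommGroup H] [InnerProductSpace ℂ H]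

/-- The unitary `v̄` of the conjugate Hilbert space, `v̄ ξ̄ = (v ξ)‾`. -/
def conjUnitary : (H ≃ₗᵢ[ℂ] H) →* (Conjugate H ≃ₗᵢ[ℂ] Conjugate H) where
  toFun v :=
    { toFun := fun x => toConj (v (toConj.symm x))
      invFun := fun x => toConj (v.symm (toConj.symm x))
      left_inv := fun x => v.symm_apply_apply (toConj.symm x)
      right_inv := fun x => v.apply_symm_apply (toConj.symm x)
      map_add' := fun x y => map_add v (toConj.symm x) (toConj.symm y)
      map_smul' := fun c x => map_smul v (conj c) (toConj.symm x)
      norm_map' := fun x => v.norm_map (toConj.symm x) }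
  map_one' := rfl
  map_mul' _ _ := rfl

theorem continuous_conjUnitary :
    Continuous (conjUnitary : (H ≃ₗᵢ[ℂ] H) → (Conjugate H ≃ₗᵢ[ℂ] Conjugate H)) :=
  continuous_unitary_iff.2 fun x =>
    continuous_unitary_iff.1 (continuous_id (X := H ≃ₗᵢ[ℂ] H)) (toConj.symm x)

/-- Scalars act on the conjugate space through their complex conjugates; this is the source of the
inversion of `ι` in the conjugate twist. -/
theorem conjUnitary_scalarUnitary (z : Circle) :
    conjUnitary (scalarUnitary H z) = scalarUnitary (Conjugate H) z⁻¹ := by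
  refine LinearIsometryEquiv.ext fun x => ?_
  rw [scalarUnitary_apply, Circle.coe_inv_eq_conj]
  change toConj ((z : ℂ) • toConj.symm x) = toConj (conj (conj (z : ℂ)) • toConj.symm x)
  rw [Complex.conj_conj]

end ConjugateUnitary

namespace CompactAction

variable {G : Type u} [Group G] [TopologicalSpace G] [IsTopologicalGroup G]
  [LocallyCompactSpace G] [T2Space G]

/-- The representation `(g, v) ↦ v̄` of `G_α` on the conjugate Hilbert space. -/
def conjRep (α : CompactAction G) : α.twist.E →* (Conjugate α.H ≃ₗᵢ[ℂ] Conjugate α.H) :=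
  (conjUnitary (H := α.H)).comp α.rep

theorem continuous_conjRep (α : CompactAction G) : Continuous α.conjRep :=
  (continuous_conjUnitary (H := α.H)).comp α.continuous_rep

/-- The morphism is `(g, v) ↦ (g, v̄)`. -/
theorem conjTwist_equivalent_twist_conjAction (α : CompactAction G) :
    α.twist.conjTwist.Equivalent α.conjAction.twist := by
  -- Unfolding definitions, `conjAut (Ad v)` is `Ad v̄`.
  have hu : ∀ x, α.conjAction.act (α.twist.q x) = Ad (H := Conjugate α.H) (α.conjRep x) :=
    fun x => congrArg conjAut (α.act_q x)
  refine GroupTwist.equivalent_of_hom (A := α.twist.conjTwist)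
    (α.conjAction.liftGrp α.twist.q α.conjRep hu)
    (α.conjAction.continuous_liftGrp hu α.twist.continuous_q α.continuous_conjRep)
    (fun z => ?_) fun x => rfl
  refine α.conjAction.liftGrp_eq_ι hu (α.twist.q_ι z⁻¹) ?_
  -- Two inversions cancel: one from the embedding of the conjugate twist, one from passing to the
  -- conjugate unitary.
  refine (conjUnitary_scalarUnitary (H := α.H) z⁻¹).trans ?_
  rw [inv_inv]
  rfl

end CompactAction

/-! ### Calculus of rank one operators -/

section RankOne

variable {H : Type u} [NormedAddCommGroup H] [InnerProductSpace ℂ H]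

theorem inner_self_of_norm_eq_one {e : H} (he : ‖e‖ = 1) : (inner ℂ e e : ℂ) = 1 := by
  rw [inner_self_eq_norm_sq_to_K, he]
  simp

variable [CompleteSpace H]

theorem star_rk (η ξ : H) : star (rk η ξ) = rk ξ η :=
  Subtype.ext (InnerProductSpace.adjoint_rankOne η ξ)

theorem norm_rk (η ξ : H) : ‖rk η ξ‖ = ‖η‖ * ‖ξ‖ := InnerProductSpace.norm_rankOne η ξ

theorem rk_smul_left (c : ℂ) (η ξ : H) : rk (c • η) ξ = c • rk η ξ :=
  K.ext fun _ => smul_comm _ _ _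

theorem rk_smul_right (c : ℂ) (η ξ : H) : rk η (c • ξ) = conj c • rk η ξ := by
  rw [← star_rk, rk_smul_left, star_smul, star_rk]
  rfl

theorem rk_mul_rk (η ξ η' ξ' : H) : rk η ξ * rk η' ξ' = inner ℂ ξ η' • rk η ξ' := by
  rw [mul_rk, rk_apply, rk_smul_left]

/-- Minimality of rank one projections: compression leaves only a scalar. The one-dimensional
corners of bimodules come from this. -/
theorem rk_mul_mul_rk (T : K H) (η ξ η' ξ' : H) :
    rk η ξ * T * rk η' ξ' = inner ℂ ξ ((T : H →L[ℂ] H) η') • rk η ξ' := by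
  rw [mul_assoc, mul_rk, rk_mul_rk]

theorem Ad_rk (v : H ≃ₗᵢ[ℂ] H) (η ξ : H) : Ad v (rk η ξ) = rk (v η) (v ξ) := by
  refine K.ext fun x => ?_
  have h : inner ℂ ξ (v⁻¹ x) = inner ℂ (v ξ) x := by
    rw [← v.inner_map_map ξ]
    exact congrArg _ (v.apply_symm_apply x)
  rw [Ad_apply_apply, rk_apply, rk_apply, map_smul, h]

theorem continuous_rk : Continuous fun p : H × H => rk p.1 p.2 := by
  have h : Continuous fun p : H × H => InnerProductSpace.rankOne ℂ p.1 p.2 :=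
    (ContinuousLinearMap.smulRightL ℂ H H).continuous₂.comp
      (((innerSL ℂ).continuous.comp continuous_snd).prodMk continuous_fst)
  exact h.subtype_mk _

end RankOne

/-! ### Imprimitivity bimodules over compact operators and their rank one corners -/

namespace ImprimitivityBimodule

section General

variable {A B : Type u} [NonUnitalCStarAlgebra A] [NonUnitalCStarAlgebra B]
  (M : ImprimitivityBimodule A B)

theorem lin_lsmul_right (a : A) (x y : M.X) : M.lin x (M.lsmul a y) = M.lin x y * star a := by
  rw [← M.star_lin, M.lin_lsmul, star_mul, M.star_lin]

theorem rin_rsmul_left (b : B) (x y : M.X) : M.rin (M.rsmul b x) y = star b * M.rin x y := by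
  rw [← M.star_rin, M.rin_rsmul, star_mul, M.star_rin]

/-- The norm comes from the inner product, and `ₐ⟨a x, a x⟩ = a ₐ⟨x, x⟩ a*`. -/
theorem norm_lsmul_le (a : A) (x : M.X) : ‖M.lsmul a x‖ ≤ ‖a‖ * ‖x‖ := by
  refine le_of_sq_le_sq ?_ (by positivity)
  rw [← M.norm_lin_self, M.lin_lsmul, M.lin_lsmul_right]
  calc _ ≤ ‖a‖ * (‖M.lin x x‖ * ‖star a‖) :=
        (norm_mul_le _ _).trans (by gcongr; exact norm_mul_le _ _)
    _ = _ := by rw [M.norm_lin_self, norm_star]; ring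

theorem norm_rsmul_le (b : B) (x : M.X) : ‖M.rsmul b x‖ ≤ ‖b‖ * ‖x‖ := by
  refine le_of_sq_le_sq ?_ (by positivity)
  rw [← M.norm_rin_self, M.rin_rsmul, M.rin_rsmul_left]
  calc _ ≤ ‖star b‖ * ‖M.rin x x‖ * ‖b‖ :=
        (norm_mul_le _ _).trans (by gcongr; exact norm_mul_le _ _)
    _ = _ := by rw [M.norm_rin_self, norm_star]; ring

theorem continuous_lsmul : Continuous fun p : A × M.X => M.lsmul p.1 p.2 :=
  (M.lsmul.mkContinuous₂ 1 fun a x => by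
    rw [one_mul]; exact M.norm_lsmul_le a x).continuous₂

theorem continuous_rsmul : Continuous fun p : B × M.X => M.rsmul p.1 p.2 :=
  (M.rsmul.mkContinuous₂ 1 fun b x => by
    rw [one_mul]; exact M.norm_rsmul_le b x).continuous₂

/-- If the bimodule vanished, its inner products would span only `0`, contradicting fullness. -/
theorem exists_ne_zero [Nontrivial A] : ∃ x : M.X, x ≠ 0 := by
  by_contra! h
  obtain ⟨a, ha⟩ := exists_ne (0 : A)
  have h0 : ∀ x y, M.lin x y = 0 := fun x y => by
    have : M.lin ((0 : ℂ) • x) y = 0 := by rw [M.lin_smul, zero_smul]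
    rwa [zero_smul, ← h x] at this
  have h1 : Submodule.span ℂ {a | ∃ x y, M.lin x y = a} = ⊥ := by
    rw [Submodule.span_eq_bot]
    rintro _ ⟨x, y, rfl⟩
    exact h0 x y
  have h2 := M.full_lin.closure_eq
  have h3 : a ∈ closure ((⊥ : Submodule ℂ A) : Set A) := by
    rw [← h1, h2]
    trivial
  rw [Submodule.bot_coe, closure_singleton] at h3
  exact ha h3

end General

variable {H H' : Type u} [NormedAddCommGroup H] [InnerProductSpace ℂ H] [CompleteSpace H]
  [NormedAddCommGroup H'] [InnerProductSpace ℂ H'] [CompleteSpace H']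

/-- A vector `x` of norm one in the corner of a bimodule over algebras of compact operators cut out
by the rank one projections onto unit vectors `e` and `f`. -/
structure Frame (M : ImprimitivityBimodule (K H) (K H')) where
  e : H
  f : H'
  x : M.X
  norm_e : ‖e‖ = 1
  norm_f : ‖f‖ = 1
  norm_x : ‖x‖ = 1
  lsmul_x : M.lsmul (rk e e) x = x
  rsmul_x : M.rsmul (rk f f) x = x

variable (M : ImprimitivityBimodule (K H) (K H'))

/-- Take `e` to be a normalised vector in the range of `ₐ⟨x, x⟩`; the projection onto `e` then does
not annihilate `ₐ⟨x, x⟩`. -/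
theorem exists_lsmul_rk_ne_zero {x : M.X} (hx : x ≠ 0) :
    ∃ e : H, ‖e‖ = 1 ∧ M.lsmul (rk e e) x ≠ 0 := by
  have hne : M.lin x x ≠ 0 := fun h => by
    have := M.norm_lin_self x
    rw [h, norm_zero, eq_comm, sq_eq_zero_iff, norm_eq_zero] at this
    exact hx this
  obtain ⟨y, hy⟩ : ∃ y, (M.lin x x : H →L[ℂ] H) y ≠ 0 := by
    by_contra! h
    exact hne (K.ext h)
  set t := (M.lin x x : H →L[ℂ] H) y with ht
  have hn : ‖t‖ ≠ 0 := norm_ne_zero_iff.2 hy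
  refine ⟨((‖t‖ : ℂ)⁻¹) • t, ?_, fun h => ?_⟩
  · rw [norm_smul, norm_inv, Complex.norm_real, norm_norm, inv_mul_cancel₀ hn]
  · have h1 : rk (((‖t‖ : ℂ)⁻¹) • t) (((‖t‖ : ℂ)⁻¹) • t) * M.lin x x = 0 := by
      rw [← M.lin_lsmul, h]
      have := M.lin_smul 0 x x
      rwa [zero_smul, zero_smul] at this
    have h2 := congrArg (fun T : K H => (T : H →L[ℂ] H) y) h1
    simp only [K.mul_apply, rk_apply, ← ht, inner_smul_left] at h2
    change _ = (0 : H) at h2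
    simp [hn] at h2
    exact hy h2

theorem exists_rsmul_rk_ne_zero {x : M.X} (hx : x ≠ 0) :
    ∃ f : H', ‖f‖ = 1 ∧ M.rsmul (rk f f) x ≠ 0 := by
  have hne : M.rin x x ≠ 0 := fun h => by
    have := M.norm_rin_self x
    rw [h, norm_zero, eq_comm, sq_eq_zero_iff, norm_eq_zero] at this
    exact hx this
  obtain ⟨y, hy⟩ : ∃ y, (M.rin x x : H' →L[ℂ] H') y ≠ 0 := by
    by_contra! h
    exact hne (K.ext h)
  set t := (M.rin x x : H' →L[ℂ] H') y with ht
  have hn : ‖t‖ ≠ 0 := norm_ne_zero_iff.2 hy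
  refine ⟨((‖t‖ : ℂ)⁻¹) • t, ?_, fun h => ?_⟩
  · rw [norm_smul, norm_inv, Complex.norm_real, norm_norm, inv_mul_cancel₀ hn]
  -- The projection is self-adjoint, so it can be moved out of the first variable of the right inner
  -- product.
  · have h1 : rk (((‖t‖ : ℂ)⁻¹) • t) (((‖t‖ : ℂ)⁻¹) • t) * M.rin x x = 0 := by
      have h2 : M.rin (M.rsmul (rk (((‖t‖ : ℂ)⁻¹) • t) (((‖t‖ : ℂ)⁻¹) • t)) x) x = 0 := by
        rw [h, ← M.star_rin]
        have := M.rin_smul 0 x x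
        rw [zero_smul, zero_smul] at this
        rw [this, star_zero]
      rwa [M.rin_rsmul_left, star_rk] at h2
    have h2 := congrArg (fun T : K H' => (T : H' →L[ℂ] H') y) h1
    simp only [K.mul_apply, rk_apply, ← ht, inner_smul_left] at h2
    change _ = (0 : H') at h2
    simp [hn] at h2
    exact hy h2

/-- A nonzero vector survives suitable rank one projections on the left and then on the right. The
two actions commute, so the result is fixed by both projections; it remains to normalise it. -/
theorem nonempty_frame [Nontrivial H] : Nonempty M.Frame := by
  have : Nontrivial (K H) := by
    obtain ⟨e, he⟩ := exists_norm_eq H zero_le_one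
    refine ⟨⟨rk e e, 0, fun h => ?_⟩⟩
    have := norm_rk e e
    rw [h, he, norm_zero] at this
    norm_num at this
  obtain ⟨x, hx⟩ := M.exists_ne_zero
  obtain ⟨e, he, hex⟩ := M.exists_lsmul_rk_ne_zero hx
  obtain ⟨f, hf, hfx⟩ := M.exists_rsmul_rk_ne_zero hex
  set y := M.rsmul (rk f f) (M.lsmul (rk e e) x) with hy
  have hn : ‖y‖ ≠ 0 := norm_ne_zero_iff.2 hfx
  refine ⟨⟨e, f, ((‖y‖ : ℂ)⁻¹) • y, he, hf, ?_, ?_, ?_⟩⟩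
  · rw [norm_smul, norm_inv, Complex.norm_real, norm_norm, inv_mul_cancel₀ hn]
  · rw [map_smul, hy, M.lsmul_rsmul, ← M.lsmul_mul, rk_mul_rk, inner_self_of_norm_eq_one he,
      one_smul]
  · rw [map_smul, hy, ← M.rsmul_mul, rk_mul_rk, inner_self_of_norm_eq_one hf, one_smul]

namespace Frame

variable {M} (F : M.Frame)

theorem inner_e : (inner ℂ F.e F.e : ℂ) = 1 := inner_self_of_norm_eq_one F.norm_e

theorem inner_f : (inner ℂ F.f F.f : ℂ) = 1 := inner_self_of_norm_eq_one F.norm_f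

/-- As `x = x p` with `p` the projection onto `f`, the inner product is `p ⟨x, x⟩ p`, a multiple of
`p`. The coefficient is nonnegative because the inner product has the form `b* b`, and has modulus
one because `‖x‖ = 1`. -/
theorem rin_x : M.rin F.x F.x = rk F.f F.f := by
  obtain ⟨b, hb⟩ := M.rin_self_nonneg F.x
  have h1 : M.rin F.x F.x =
      inner ℂ F.f ((M.rin F.x F.x : H' →L[ℂ] H') F.f) • rk F.f F.f := by
    rw [← rk_mul_mul_rk]
    have hs : rk F.f F.f * M.rin F.x F.x * rk F.f F.f =
        star (rk F.f F.f) * M.rin F.x F.x * rk F.f F.f := by rw [star_rk]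
    rw [hs, ← M.rin_rsmul_left, ← M.rin_rsmul, F.rsmul_x]
  have h2 : inner ℂ F.f ((M.rin F.x F.x : H' →L[ℂ] H') F.f) =
      ((‖(b : H' →L[ℂ] H') F.f‖ ^ 2 : ℝ) : ℂ) := by
    rw [hb, K.mul_apply, ← K.star_inner, inner_self_eq_norm_sq_to_K]
    norm_cast
  have h3 := congrArg norm h1
  rw [M.norm_rin_self, F.norm_x, h2, norm_smul, norm_rk, F.norm_f, Complex.norm_real,
    Real.norm_of_nonneg (sq_nonneg _)] at h3
  rw [h1, h2]
  have h4 : ‖(b : H' →L[ℂ] H') F.f‖ ^ 2 = 1 := by linarith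
  rw [h4, Complex.ofReal_one, one_smul]

/-- The element of the bimodule which corresponds to the rank one operator `η ⊗ ζ*`. -/
def elem (η : H) (ζ : H') : M.X := M.lsmul (rk η F.e) (M.rsmul (rk F.f ζ) F.x)

theorem elem_smul_smul (c d : ℂ) (η : H) (ζ : H') :
    F.elem (c • η) (d • ζ) = (c * conj d) • F.elem η ζ := by
  simp only [elem, rk_smul_left, rk_smul_right, map_smul, LinearMap.smul_apply, smul_smul, mul_comm]

/-- Compressing back to the corner recovers the matrix coefficients of `η ⊗ ζ*`, which makes it
possible to separate these elements. -/
theorem corner_elem (η η' : H) (ζ ζ' : H') :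
    M.lsmul (rk F.e η') (M.rsmul (rk ζ' F.f) (F.elem η ζ)) =
      (inner ℂ η' η * inner ℂ ζ ζ' : ℂ) • F.x := by
  rw [elem, ← M.lsmul_rsmul, ← M.lsmul_mul, ← M.rsmul_mul, rk_mul_rk, rk_mul_rk, map_smul, map_smul,
    LinearMap.smul_apply, LinearMap.smul_apply, map_smul, F.rsmul_x, F.lsmul_x, smul_smul]

theorem x_ne_zero : F.x ≠ 0 := fun h => by
  have := F.norm_x
  rw [h, norm_zero] at this
  exact zero_ne_one this

/-- Used to see that the unitary on `H'` is determined by the action on the bimodule and the unitary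
on `H`. -/
theorem elem_right_injective : Function.Injective (F.elem F.e) := fun ζ ζ' h => by
  refine ext_inner_right ℂ fun θ => ?_
  have h1 := F.corner_elem F.e F.e ζ θ
  rw [h, F.corner_elem, F.inner_e, one_mul, one_mul] at h1
  exact (smul_left_injective ℂ F.x_ne_zero h1).symm

theorem continuous_elem : Continuous fun p : H × H' => F.elem p.1 p.2 :=
  M.continuous_lsmul.comp ((continuous_rk.comp (continuous_fst.prodMk continuous_const)).prodMk
    (M.continuous_rsmul.comp ((continuous_rk.comp
      (continuous_const.prodMk continuous_snd)).prodMk continuous_const)))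

/-- The corner of the bimodule is one-dimensional. -/
theorem exists_eq_smul {y : M.X} (h : M.lsmul (rk F.e F.e) y = y) (h' : M.rsmul (rk F.f F.f) y = y) :
    ∃ c : ℂ, y = c • F.x := by
  refine ⟨inner ℂ F.e ((M.lin y F.x : H →L[ℂ] H) F.e), ?_⟩
  have h1 : M.lin y F.x = inner ℂ F.e ((M.lin y F.x : H →L[ℂ] H) F.e) • rk F.e F.e := by
    rw [← rk_mul_mul_rk, ← M.lin_lsmul, h]
    conv_rhs => rw [← star_rk, ← M.lin_lsmul_right, F.lsmul_x]
  -- The relation `y ⟨x, x⟩ = ⟨y, x⟩ x` between the two inner products reduces the claim to `ₐ⟨y,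
  -- x⟩`, which is a scalar multiple of the projection onto `e`.
  calc y = M.rsmul (M.rin F.x F.x) y := by rw [F.rin_x, h']
    _ = M.lsmul (M.lin y F.x) F.x := (M.lin_rin _ _ _).symm
    _ = _ := by rw [h1, map_smul, LinearMap.smul_apply, F.lsmul_x, ← h1]

/-- An isometry of the bimodule which is compatible with `Ad v` and `Ad w` is given by `v` and a
multiple of `w` on the elements `η ⊗ ζ*`. -/
theorem exists_circle (v : H ≃ₗᵢ[ℂ] H) (w : H' ≃ₗᵢ[ℂ] H') (Γ : M.X → M.X)
    (hl : ∀ a x, Γ (M.lsmul a x) = M.lsmul (Ad v a) (Γ x))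
    (hr : ∀ b x, Γ (M.rsmul b x) = M.rsmul (Ad w b) (Γ x)) (hn : ∀ x, ‖Γ x‖ = ‖x‖) :
    ∃ z : Circle, ∀ η ζ, Γ (F.elem η ζ) = F.elem (v η) ((scalarUnitary H' z * w) ζ) := by
  -- `Γ x` lies in the corner of `v e` and `w f`. Rank one partial isometries bring it back to the
  -- corner of `e` and `f`, where it is a multiple `c • x`.
  set y := M.lsmul (rk F.e (v F.e)) (M.rsmul (rk (w F.f) F.f) (Γ F.x)) with hy
  have h1 : M.lsmul (rk F.e F.e) y = y := by
    rw [hy, ← M.lsmul_mul, rk_mul_rk, F.inner_e, one_smul]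
  have h2 : M.rsmul (rk F.f F.f) y = y := by
    rw [hy, ← M.lsmul_rsmul, ← M.rsmul_mul, rk_mul_rk, F.inner_f, one_smul]
  have h3 : ∀ η ζ, Γ (F.elem η ζ) = M.lsmul (rk (v η) F.e) (M.rsmul (rk F.f (w ζ)) y) := by
    intro η ζ
    rw [elem, hl, hr, Ad_rk, Ad_rk, hy, ← M.lsmul_rsmul, ← M.rsmul_mul, ← M.lsmul_mul, rk_mul_rk,
      rk_mul_rk, F.inner_e, F.inner_f, one_smul, one_smul]
  obtain ⟨c, hc⟩ := F.exists_eq_smul h1 h2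
  have hel : F.elem F.e F.f = F.x := by rw [elem, F.rsmul_x, F.lsmul_x]
  have hnorm : ‖c‖ = 1 := by
    have hyc : ‖y‖ = ‖c‖ := by rw [hc, norm_smul, F.norm_x, mul_one]
    -- `y` arises from `Γ x` by contractions, and conversely `Γ x` arises from `y` by contractions.
    refine le_antisymm ?_ ?_
    · rw [← hyc, hy]
      refine (M.norm_lsmul_le _ _).trans ?_
      refine (mul_le_mul_of_nonneg_left (M.norm_rsmul_le _ _) (norm_nonneg _)).trans ?_
      rw [norm_rk, norm_rk, v.norm_map, w.norm_map, hn, F.norm_e, F.norm_f, F.norm_x]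
      norm_num
    · have h4 : ‖F.x‖ ≤ ‖y‖ := by
        rw [← hn, ← hel, h3]
        refine (M.norm_lsmul_le _ _).trans ?_
        refine (mul_le_mul_of_nonneg_left (M.norm_rsmul_le _ _) (norm_nonneg _)).trans ?_
        rw [norm_rk, norm_rk, v.norm_map, w.norm_map, F.norm_e, F.norm_f]
        norm_num
      rwa [F.norm_x, hyc] at h4
  -- The scalar is `conj c` because `η ⊗ ζ*` is conjugate linear in `ζ`.
  refine ⟨⟨conj c, mem_sphere_zero_iff_norm.2 (by rw [RCLike.norm_conj, hnorm])⟩, fun η ζ => ?_⟩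
  have h5 := F.elem_smul_smul 1 (conj c) (v η) (w ζ)
  rw [one_smul, one_mul, Complex.conj_conj] at h5
  refine Eq.trans ?_ h5.symm
  rw [h3, hc, map_smul, map_smul]
  rfl

end Frame

end ImprimitivityBimodule

/-! ### From Morita equivalences to equivalences of twists -/

namespace CompactAction

variable {G : Type u} [Group G] [TopologicalSpace G] [IsTopologicalGroup G]
  [LocallyCompactSpace G] [T2Space G] {α β : CompactAction G}

/-- The twists of Morita equivalent actions are equivalent. -/
theorem MoritaEquivalent.twist_equivalent (h : α.MoritaEquivalent β) :
    α.twist.Equivalent β.twist := by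
  obtain ⟨M, γ, hγc, hγl, hγr, hγlin, -⟩ := h
  obtain ⟨F⟩ := M.nonempty_frame
  -- Compatibility with the left inner product suffices, since automorphisms of C⋆-algebras are
  -- isometric.
  have hn : ∀ g x, ‖γ g x‖ = ‖x‖ := fun g x => by
    have h1 : ‖γ g x‖ ^ 2 = ‖x‖ ^ 2 := by
      rw [← M.norm_lin_self, ← M.norm_lin_self, hγlin, StarAlgEquiv.norm_map]
    exact (pow_left_inj₀ (norm_nonneg _) (norm_nonneg _) two_ne_zero).1 h1
  -- `R` consists of the pairs `(v, w)` over the same `g` with `γ_g (η ⊗ ζ*) = vη ⊗ (wζ)*`. It is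
  -- the graph of the desired isomorphism and serves as the cover.
  let R : Subgroup (α.twist.fibre β.twist) :=
    { carrier := {f | ∀ η ζ, γ (α.twist.q f.1.1) (F.elem η ζ) =
        F.elem (α.rep f.1.1 η) (β.rep f.1.2 ζ)}
      one_mem' := fun η ζ => by
        change γ 1 _ = _
        rw [map_one]
        rfl
      mul_mem' := fun {f f'} hf hf' η ζ => by
        change γ (α.twist.q f.1.1 * α.twist.q f'.1.1) _ = _
        rw [map_mul]
        exact (congrArg _ (hf' η ζ)).trans (hf _ _)
      inv_mem' := fun {f} hf η ζ => by
        have h1 := hf (α.rep f.1.1⁻¹ η) (β.rep f.1.2⁻¹ ζ)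
        have h2 : α.rep f.1.1 (α.rep f.1.1⁻¹ η) = η := by
          rw [map_inv]; exact (α.rep f.1.1).apply_symm_apply η
        have h3 : β.rep f.1.2 (β.rep f.1.2⁻¹ ζ) = ζ := by
          rw [map_inv]; exact (β.rep f.1.2).apply_symm_apply ζ
        rw [h2, h3] at h1
        change γ (α.twist.q f.1.1⁻¹) _ = F.elem (α.rep f.1.1⁻¹ η) (β.rep f.1.2⁻¹ ζ)
        rw [map_inv, map_inv, ← h1]
        exact (γ (α.twist.q f.1.1)).symm_apply_apply _ }
  -- Closedness makes `R` proper over `G`.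
  have hR : IsClosed (R : Set (α.twist.fibre β.twist)) := by
    have : (R : Set (α.twist.fibre β.twist)) = ⋂ (η : α.H) (ζ : β.H),
        {f | γ (α.twist.q f.1.1) (F.elem η ζ) = F.elem (α.rep f.1.1 η) (β.rep f.1.2 ζ)} := by
      ext f
      simp only [Set.mem_iInter]
      rfl
    rw [this]
    refine isClosed_iInter fun η => isClosed_iInter fun ζ => isClosed_eq ?_ ?_
    · exact (hγc _).comp (α.twist.isOpenQuotientMap_fibreProj β.twist).continuous
    · refine F.continuous_elem.comp (Continuous.prodMk ?_ ?_)
      · exact (continuous_unitary_iff.1 α.continuous_rep η).comp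
          (continuous_fst.comp continuous_subtype_val)
      · exact (continuous_unitary_iff.1 β.continuous_rep ζ).comp
          (continuous_snd.comp continuous_subtype_val)
  let p : R →* α.twist.E := ((MonoidHom.fst _ _).comp (Subgroup.subtype _)).comp R.subtype
  let r : R →* β.twist.E := ((MonoidHom.snd _ _).comp (Subgroup.subtype _)).comp R.subtype
  refine GroupTwist.equivalent_of_cover p r
    (continuous_fst.comp (continuous_subtype_val.comp continuous_subtype_val))
    (continuous_snd.comp (continuous_subtype_val.comp continuous_subtype_val)) ?_ ?_ ?_ ?_ ?_
  · exact (α.twist.isProperMap_fibreProj β.twist).comp hR.isClosedEmbedding_subtypeVal.isProperMap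
  -- Any `w` implementing `β_g` becomes a partner of `v` after multiplication by a suitable scalar.
  · rintro ⟨⟨g, v⟩, hv⟩
    obtain ⟨w, hw⟩ := Ad_surjective (β.act g)
    obtain ⟨z, hz⟩ := F.exists_circle v w (γ g)
      (fun a x => by rw [hγl]; exact congrArg (fun t => M.lsmul (t a) _) hv)
      (fun b x => by rw [hγr, ← hw]) (hn g)
    have hzw : β.act g = Ad (scalarUnitary β.H z * w) := by
      rw [map_mul, Ad_scalarUnitary, one_mul, hw]
    exact ⟨⟨⟨(⟨(g, v), hv⟩, ⟨(g, _), hzw⟩), rfl⟩, hz⟩, rfl⟩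
  · exact fun f => Eq.symm f.1.2
  · intro f hf
    have h1 : f.1.1.1 = 1 := hf
    have h2 : α.twist.q f.1.1.1 = 1 := by rw [h1, map_one]
    refine Subtype.ext (Prod.ext ((Eq.symm f.1.2).trans h2) (LinearIsometryEquiv.ext fun ζ => ?_))
    have h3 := f.2 F.e ζ
    rw [h2, h1, map_one, map_one] at h3
    exact (F.elem_right_injective h3).symm
  · intro z
    refine ⟨⟨⟨(α.twist.ι z, β.twist.ι z), ?_⟩, fun η ζ => ?_⟩, rfl, rfl⟩
    · rw [GroupTwist.mem_fibre, GroupTwist.q_ι, GroupTwist.q_ι]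
    -- The pair of scalars `(z, z)` belongs to `R` because `z * conj z = 1`.
    · change γ (α.twist.q (α.twist.ι z)) _ = F.elem ((z : ℂ) • η) ((z : ℂ) • ζ)
      rw [GroupTwist.q_ι, map_one, F.elem_smul_smul, Complex.mul_conj, Complex.normSq_eq_norm_sq,
        Circle.norm_coe, one_pow, Complex.ofReal_one, one_smul]
      rfl

end CompactAction

/-! ### The bimodule of compact operators between two Hilbert spaces -/

section CompactHom

open ContinuousLinearMap (adjoint)

variable {H H' : Type u} [NormedAddCommGroup H] [InnerProductSpace ℂ H]
  [NormedAddCommGroup H'] [InnerProductSpace ℂ H']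

variable (H H') in
/-- The rank one operators `H' → H`. -/
def rankOnes : Set (H' →L[ℂ] H) :=
  Set.range fun p : H × H' => InnerProductSpace.rankOne ℂ p.1 p.2

theorem isCompactOperator_rankOne (η : H) (ξ : H') :
    IsCompactOperator (InnerProductSpace.rankOne ℂ η ξ) :=
  (((isCompactOperator_id_iff_finiteDimensional (𝕜 := ℂ) (E := ℂ)).2 inferInstance).comp_clm
    (innerSL ℂ ξ)).clm_comp (ContinuousLinearMap.toSpanSingleton ℂ η)

variable (H H') in
/-- The Banach space of compact operators `H' → H`. -/
def compactHom : Submodule ℂ (H' →L[ℂ] H) where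
  carrier := {T | IsCompactOperator T}
  add_mem' ha hb := ha.add hb
  zero_mem' := isCompactOperator_zero
  smul_mem' c _ ha := ha.smul c

/-- The action `T ↦ v T w⁻¹` of pairs of unitaries on the compact operators `H' → H`. -/
def conjPair : (H ≃ₗᵢ[ℂ] H) × (H' ≃ₗᵢ[ℂ] H') →* (compactHom H H' ≃ₗ[ℂ] compactHom H H') where
  toFun p :=
    { toFun := fun T => ⟨(p.1 : H →L[ℂ] H) ∘L (T : H' →L[ℂ] H) ∘L (p.2.symm : H' →L[ℂ] H'),
        (T.2.comp_clm (p.2.symm : H' →L[ℂ] H')).clm_comp (p.1 : H →L[ℂ] H)⟩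
      invFun := fun T => ⟨(p.1.symm : H →L[ℂ] H) ∘L (T : H' →L[ℂ] H) ∘L (p.2 : H' →L[ℂ] H'),
        (T.2.comp_clm (p.2 : H' →L[ℂ] H')).clm_comp (p.1.symm : H →L[ℂ] H)⟩
      left_inv := fun T => by ext; simp
      right_inv := fun T => by ext; simp
      map_add' := fun S T => by ext; simp
      map_smul' := fun c T => by ext; simp }
  map_one' := rfl
  map_mul' _ _ := rfl

theorem conjPair_apply (p : (H ≃ₗᵢ[ℂ] H) × (H' ≃ₗᵢ[ℂ] H')) (T : compactHom H H') (x : H') :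
    (conjPair p T : H' →L[ℂ] H) x = p.1 ((T : H' →L[ℂ] H) (p.2.symm x)) := rfl

/-- Scalars commute with operators and cancel. Hence `T ↦ v T w⁻¹` depends only on the image in `G`
once the circles of the two twists are identified. -/
theorem conjPair_scalarUnitary (z : Circle) :
    conjPair (scalarUnitary H z, scalarUnitary H' z) = 1 := by
  refine LinearEquiv.ext fun T => Subtype.ext (ContinuousLinearMap.ext fun x => ?_)
  rw [conjPair_apply, scalarUnitary_apply, ← map_smul]
  exact congrArg _ ((scalarUnitary H' z).apply_symm_apply x)

/-- Conjugation turns `|η⟩⟨ξ|` into `|vη⟩⟨wξ|`, which depends norm continuously on the vectors; so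
strong continuity of `v` and `w` is enough. -/
theorem continuous_conj_of_mem_span {Y : Type*} [TopologicalSpace Y]
    {p : Y → (H ≃ₗᵢ[ℂ] H) × (H' ≃ₗᵢ[ℂ] H')} (hp : Continuous p) {T : H' →L[ℂ] H}
    (hT : T ∈ Submodule.span ℂ (rankOnes H H')) :
    Continuous fun y => ((p y).1 : H →L[ℂ] H) ∘L T ∘L ((p y).2.symm : H' →L[ℂ] H') := by
  induction hT using Submodule.span_induction with
  | mem T hT =>
    obtain ⟨⟨η, ξ⟩, rfl⟩ := hT
    have h1 : Continuous fun y => (p y).1 η := continuous_unitary_iff.1 (continuous_fst.comp hp) η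
    have h2 : Continuous fun y => (p y).2 ξ := continuous_unitary_iff.1 (continuous_snd.comp hp) ξ
    have h3 : Continuous fun y => InnerProductSpace.rankOne ℂ ((p y).1 η) ((p y).2 ξ) :=
      (ContinuousLinearMap.smulRightL ℂ H' H).continuous₂.comp
        (((innerSL ℂ).continuous.comp h2).prodMk h1)
    refine h3.congr fun y => ContinuousLinearMap.ext fun x => ?_
    have h4 : inner ℂ ((p y).2 ξ) x = inner ℂ ξ ((p y).2.symm x) := by
      rw [← (p y).2.inner_map_map ξ, LinearIsometryEquiv.apply_symm_apply]
    simp [h4]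
  | zero =>
    refine continuous_const.congr (f := fun _ => (0 : H' →L[ℂ] H)) fun y => ?_
    simp
  | add S T _ _ hS hT =>
    refine (hS.add hT).congr fun y => ?_
    simp
  | smul c T _ hT =>
    refine (hT.const_smul c).congr fun y => ?_
    simp

variable [CompleteSpace H] [CompleteSpace H']

/-- Compact operators between Hilbert spaces are limits of operators of finite rank. -/
theorem mem_closure_span_rankOnes {T : H' →L[ℂ] H} (hT : IsCompactOperator T) :
    T ∈ closure (Submodule.span ℂ (rankOnes H H') : Set (H' →L[ℂ] H)) := by
  rw [Metric.mem_closure_iff]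
  intro ε hε
  have hb := (IsCompactOperator.isCompact_closure_image_closedBall
    (f := (T : H' →ₗ[ℂ] H)) hT 1).totallyBounded.subset subset_closure
  obtain ⟨t, htf, hcov⟩ := Metric.totallyBounded_iff.1 hb (ε / 2) (half_pos hε)
  have hfin : FiniteDimensional ℂ (Submodule.span ℂ t) := FiniteDimensional.span_of_finite ℂ htf
  -- `t` is a finite `ε / 2`-net for the image of the unit ball. Projecting onto its span moves a
  -- point of that image by at most its distance to the net.
  set P := (Submodule.span ℂ t).starProjection with hP
  refine ⟨P ∘L T, ?_, ?_⟩
  · rw [hP, (stdOrthonormalBasis ℂ (Submodule.span ℂ t)).starProjection_eq_sum_rankOne,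
      ContinuousLinearMap.finsetSum_comp]
    refine Submodule.sum_mem _ fun i _ => Submodule.subset_span ?_
    rw [InnerProductSpace.rankOne_comp]
    exact ⟨(_, _), rfl⟩
  · rw [dist_eq_norm]
    refine lt_of_le_of_lt (ContinuousLinearMap.opNorm_le_of_unit_norm (half_pos hε).le
      fun z hz => ?_) (half_lt_self hε)
    have hz' := hcov ⟨z, by simp [hz], rfl⟩
    simp only [Set.mem_iUnion, exists_prop] at hz'
    obtain ⟨y, hy, hzy⟩ := hz'
    rw [Metric.mem_ball, dist_eq_norm] at hzy
    change ‖T z - P (T z)‖ ≤ ε / 2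
    rw [hP, Submodule.starProjection_minimal]
    refine (ciInf_le ⟨0, ?_⟩ (⟨y, Submodule.subset_span hy⟩ : Submodule.span ℂ t)).trans hzy.le
    rintro _ ⟨w, rfl⟩
    exact norm_nonneg _

/-- Finite rank approximation takes place among all bounded operators; the isometric inclusion `j`
of `K H` brings the approximants back. -/
theorem dense_span_of_rk_mem {S : Set (K H)} (hS : ∀ η ξ, rk η ξ ∈ S) :
    Dense (Submodule.span ℂ S : Set (K H)) := by
  intro T
  rw [Metric.mem_closure_iff]
  intro ε hε
  obtain ⟨R, hR, hTR⟩ := Metric.mem_closure_iff.1 (mem_closure_span_rankOnes T.2) ε hε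
  let j : K H →ₗ[ℂ] (H →L[ℂ] H) :=
    { toFun := fun T => T
      map_add' := fun _ _ => rfl
      map_smul' := fun _ _ => rfl }
  have hle : Submodule.span ℂ (rankOnes H H) ≤ (Submodule.span ℂ S).map j := by
    rw [Submodule.span_le]
    rintro _ ⟨⟨η, ξ⟩, rfl⟩
    exact ⟨rk η ξ, Submodule.subset_span (hS η ξ), rfl⟩
  obtain ⟨R, hR', rfl⟩ := hle hR
  exact ⟨R, hR', hTR⟩

/-- A positive compact operator is of the form `a* a` with `a` compact. -/
theorem exists_eq_star_mul_self {T : K H} (hT : 0 ≤ (T : H →L[ℂ] H)) :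
    ∃ a : K H, T = star a * a := by
  -- The square root is given by the non-unital functional calculus, which stays inside a closed
  -- star subalgebra.
  have hmem : CFC.sqrt (T : H →L[ℂ] H) ∈ compactOps H := by
    rw [CFC.sqrt_eq_real_sqrt _ hT]
    exact cfcₙ_mem (s := compactOps H) Real.sqrt T.2
  refine ⟨⟨_, hmem⟩, Subtype.ext ?_⟩
  have h1 : star (CFC.sqrt (T : H →L[ℂ] H)) = CFC.sqrt (T : H →L[ℂ] H) :=
    (CFC.sqrt_nonneg (T : H →L[ℂ] H)).isSelfAdjoint.star_eq
  change (T : H →L[ℂ] H) = star (CFC.sqrt (T : H →L[ℂ] H)) * CFC.sqrt (T : H →L[ℂ] H)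
  rw [h1, CFC.sqrt_mul_sqrt_self _ hT]

instance : CompleteSpace (compactHom H H') := by
  have h : IsClosed ((compactHom H H' : Submodule ℂ (H' →L[ℂ] H)) : Set (H' →L[ℂ] H)) :=
    isClosed_setOfPred_isCompactOperator
  exact h.completeSpace_coe

variable (H H') in
/-- The imprimitivity bimodule of compact operators `H' → H` between the algebras of compact
operators on `H` and `H'`. -/
def compactBimodule [Nontrivial H] [Nontrivial H'] : ImprimitivityBimodule (K H) (K H') where
  X := compactHom H H'
  lsmul := LinearMap.mk₂ ℂ
    (fun a x => ⟨(a : H →L[ℂ] H) ∘L (x : H' →L[ℂ] H), x.2.clm_comp (a : H →L[ℂ] H)⟩)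
    (fun _ _ _ => Subtype.ext (ContinuousLinearMap.add_comp _ _ _))
    (fun _ _ _ => Subtype.ext (ContinuousLinearMap.smul_comp _ _ _))
    (fun _ _ _ => Subtype.ext (ContinuousLinearMap.comp_add _ _ _))
    (fun _ _ _ => Subtype.ext (ContinuousLinearMap.comp_smul _ _ _))
  rsmul := LinearMap.mk₂ ℂ
    (fun b x => ⟨(x : H' →L[ℂ] H) ∘L (b : H' →L[ℂ] H'), x.2.comp_clm (b : H' →L[ℂ] H')⟩)
    (fun _ _ _ => Subtype.ext (ContinuousLinearMap.comp_add _ _ _))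
    (fun _ _ _ => Subtype.ext (ContinuousLinearMap.comp_smul _ _ _))
    (fun _ _ _ => Subtype.ext (ContinuousLinearMap.add_comp _ _ _))
    (fun _ _ _ => Subtype.ext (ContinuousLinearMap.smul_comp _ _ _))
  lin x y := ⟨(x : H' →L[ℂ] H) ∘L adjoint (y : H' →L[ℂ] H),
    x.2.comp_clm (adjoint (y : H' →L[ℂ] H))⟩
  rin x y := ⟨adjoint (x : H' →L[ℂ] H) ∘L (y : H' →L[ℂ] H),
    y.2.clm_comp (adjoint (x : H' →L[ℂ] H))⟩
  lsmul_mul _ _ _ := rfl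
  rsmul_mul _ _ _ := rfl
  lsmul_rsmul _ _ _ := rfl
  lin_add _ _ _ := Subtype.ext (ContinuousLinearMap.add_comp _ _ _)
  lin_smul _ _ _ := Subtype.ext (ContinuousLinearMap.smul_comp _ _ _)
  lin_lsmul _ _ _ := rfl
  star_lin x y := Subtype.ext (by
    change adjoint ((x : H' →L[ℂ] H) ∘L adjoint (y : H' →L[ℂ] H)) = _
    rw [ContinuousLinearMap.adjoint_comp, ContinuousLinearMap.adjoint_adjoint])
  lin_self_nonneg x := exists_eq_star_mul_self <|
    (ContinuousLinearMap.nonneg_iff_isPositive _).2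
      (ContinuousLinearMap.isPositive_self_comp_adjoint (x : H' →L[ℂ] H))
  norm_lin_self x := by
    have h := ContinuousLinearMap.norm_adjoint_comp_self (adjoint (x : H' →L[ℂ] H))
    rw [ContinuousLinearMap.adjoint_adjoint, LinearIsometryEquiv.norm_map, ← sq] at h
    exact h
  rin_add _ _ _ := Subtype.ext (ContinuousLinearMap.comp_add _ _ _)
  rin_smul _ _ _ := Subtype.ext (ContinuousLinearMap.comp_smul _ _ _)
  rin_rsmul _ _ _ := rfl
  star_rin x y := Subtype.ext (by
    change adjoint (adjoint (x : H' →L[ℂ] H) ∘L (y : H' →L[ℂ] H)) = _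
    rw [ContinuousLinearMap.adjoint_comp, ContinuousLinearMap.adjoint_adjoint])
  rin_self_nonneg x := exists_eq_star_mul_self <|
    (ContinuousLinearMap.nonneg_iff_isPositive _).2
      (ContinuousLinearMap.isPositive_adjoint_comp_self (x : H' →L[ℂ] H))
  norm_rin_self x := by
    have h := ContinuousLinearMap.norm_adjoint_comp_self (x : H' →L[ℂ] H)
    rw [← sq] at h
    exact h
  lin_rsmul b x y := Subtype.ext (by
    change ((x : H' →L[ℂ] H) ∘L (b : H' →L[ℂ] H')) ∘L adjoint (y : H' →L[ℂ] H) =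
      (x : H' →L[ℂ] H) ∘L adjoint ((y : H' →L[ℂ] H) ∘L adjoint (b : H' →L[ℂ] H'))
    rw [ContinuousLinearMap.adjoint_comp, ContinuousLinearMap.adjoint_adjoint]
    rfl)
  rin_lsmul a x y := Subtype.ext (by
    change adjoint ((a : H →L[ℂ] H) ∘L (x : H' →L[ℂ] H)) ∘L (y : H' →L[ℂ] H) =
      adjoint (x : H' →L[ℂ] H) ∘L (adjoint (a : H →L[ℂ] H) ∘L (y : H' →L[ℂ] H))
    rw [ContinuousLinearMap.adjoint_comp]
    rfl)
  lin_rin _ _ _ := rfl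
  -- For a unit vector `f`, `|η⟩⟨ξ| = |η⟩⟨f| (|ξ⟩⟨f|)*`, so every rank one operator is an inner
  -- product; the right-hand case is symmetric.
  full_lin := dense_span_of_rk_mem fun η ξ => by
    obtain ⟨f, hf⟩ := exists_norm_eq H' zero_le_one
    refine ⟨⟨InnerProductSpace.rankOne ℂ η f, ?_⟩, ⟨InnerProductSpace.rankOne ℂ ξ f, ?_⟩,
      Subtype.ext ?_⟩
    · exact isCompactOperator_rankOne _ _
    · exact isCompactOperator_rankOne _ _
    · change InnerProductSpace.rankOne ℂ η f ∘L adjoint (InnerProductSpace.rankOne ℂ ξ f) =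
        InnerProductSpace.rankOne ℂ η ξ
      rw [InnerProductSpace.adjoint_rankOne, InnerProductSpace.rankOne_comp_rankOne,
        inner_self_of_norm_eq_one hf, one_smul]
  full_rin := dense_span_of_rk_mem fun η ξ => by
    obtain ⟨e, he⟩ := exists_norm_eq H zero_le_one
    refine ⟨⟨InnerProductSpace.rankOne ℂ e η, ?_⟩, ⟨InnerProductSpace.rankOne ℂ e ξ, ?_⟩,
      Subtype.ext ?_⟩
    · exact isCompactOperator_rankOne _ _
    · exact isCompactOperator_rankOne _ _
    · change adjoint (InnerProductSpace.rankOne ℂ e η) ∘L InnerProductSpace.rankOne ℂ e ξ =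
        InnerProductSpace.rankOne ℂ η ξ
      rw [InnerProductSpace.adjoint_rankOne, InnerProductSpace.rankOne_comp_rankOne,
        inner_self_of_norm_eq_one he, one_smul]

section Covariance

variable (p : (H ≃ₗᵢ[ℂ] H) × (H' ≃ₗᵢ[ℂ] H'))

theorem adjoint_conjPair (T : compactHom H H') (x : H) :
    adjoint (conjPair p T : H' →L[ℂ] H) x =
      p.2 (adjoint (T : H' →L[ℂ] H) (p.1.symm x)) := by
  refine ext_inner_right ℂ fun y => ?_
  rw [ContinuousLinearMap.adjoint_inner_left, conjPair_apply, ← p.2.apply_symm_apply y,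
    p.2.inner_map_map, ContinuousLinearMap.adjoint_inner_left, p.2.symm_apply_apply,
    ← p.1.inner_map_map (p.1.symm x), p.1.apply_symm_apply]

variable [Nontrivial H] [Nontrivial H']

theorem conjPair_lsmul (a : K H) (T : compactHom H H') :
    conjPair p ((compactBimodule H H').lsmul a T) =
      (compactBimodule H H').lsmul (Ad p.1 a) (conjPair p T) := by
  refine Subtype.ext (ContinuousLinearMap.ext fun x => ?_)
  change p.1 ((a : H →L[ℂ] H) ((T : H' →L[ℂ] H) (p.2.symm x))) =
    p.1 ((a : H →L[ℂ] H) (p.1.symm (p.1 ((T : H' →L[ℂ] H) (p.2.symm x)))))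
  rw [p.1.symm_apply_apply]

theorem conjPair_rsmul (b : K H') (T : compactHom H H') :
    conjPair p ((compactBimodule H H').rsmul b T) =
      (compactBimodule H H').rsmul (Ad p.2 b) (conjPair p T) := by
  refine Subtype.ext (ContinuousLinearMap.ext fun x => ?_)
  change p.1 ((T : H' →L[ℂ] H) ((b : H' →L[ℂ] H') (p.2.symm x))) =
    p.1 ((T : H' →L[ℂ] H) (p.2.symm (p.2 ((b : H' →L[ℂ] H') (p.2.symm x)))))
  rw [p.2.symm_apply_apply]

theorem lin_conjPair (S T : compactHom H H') :
    (compactBimodule H H').lin (conjPair p S) (conjPair p T) =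
      Ad p.1 ((compactBimodule H H').lin S T) := by
  refine K.ext fun x => ?_
  change (conjPair p S : H' →L[ℂ] H) (adjoint (conjPair p T : H' →L[ℂ] H) x) =
    p.1 ((S : H' →L[ℂ] H) (adjoint (T : H' →L[ℂ] H) (p.1.symm x)))
  rw [adjoint_conjPair, conjPair_apply, p.2.symm_apply_apply]

theorem rin_conjPair (S T : compactHom H H') :
    (compactBimodule H H').rin (conjPair p S) (conjPair p T) =
      Ad p.2 ((compactBimodule H H').rin S T) := by
  refine K.ext fun x => ?_
  change adjoint (conjPair p S : H' →L[ℂ] H) ((conjPair p T : H' →L[ℂ] H) x) =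
    p.2 (adjoint (S : H' →L[ℂ] H) ((T : H' →L[ℂ] H) (p.2.symm x)))
  rw [adjoint_conjPair, conjPair_apply, p.1.symm_apply_apply]

end Covariance

/-- The action of pairs of unitaries on compact operators `H' → H` is strongly continuous. -/
theorem continuous_conjPair {Y : Type*} [TopologicalSpace Y]
    {p : Y → (H ≃ₗᵢ[ℂ] H) × (H' ≃ₗᵢ[ℂ] H')} (hp : Continuous p) (T : compactHom H H') :
    Continuous fun y => conjPair (p y) T := by
  -- Conjugation by unitaries is isometric, so approximating `T` by a finite rank operator
  -- approximates the orbit map uniformly in `y`.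
  refine Continuous.subtype_mk (continuous_of_uniform_approx_of_continuous fun s hs => ?_) _
  obtain ⟨ε, hε, hεs⟩ := Metric.mem_uniformity_dist.1 hs
  obtain ⟨S, hS, hTS⟩ := Metric.mem_closure_iff.1 (mem_closure_span_rankOnes T.2) ε hε
  refine ⟨_, continuous_conj_of_mem_span hp hS, fun y => hεs (lt_of_le_of_lt ?_ hTS)⟩
  rw [dist_eq_norm, dist_eq_norm]
  refine ContinuousLinearMap.opNorm_le_bound _ (norm_nonneg _) fun x => ?_
  have h1 := ContinuousLinearMap.le_opNorm ((T : H' →L[ℂ] H) - S) ((p y).2.symm x)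
  rw [LinearIsometryEquiv.norm_map, ← (p y).1.norm_map] at h1
  refine le_of_eq_of_le (congrArg norm ?_) h1
  simp

end CompactHom

/-! ### From equivalences of twists to Morita equivalences -/

namespace CompactAction

variable {G : Type u} [Group G] [TopologicalSpace G] [IsTopologicalGroup G]
  [LocallyCompactSpace G] [T2Space G] {α β : CompactAction G}

/-- Actions with equivalent twists are Morita equivalent. -/
theorem moritaEquivalent_of_twist_equivalent (h : α.twist.Equivalent β.twist) :
    α.MoritaEquivalent β := by
  obtain ⟨φ, hφι, hφq⟩ := h
  -- For `x = (g, v)` with `φ x = (g, w)`, this is the pair `(v, w)`.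
  let u : α.twist.E →* (α.H ≃ₗᵢ[ℂ] α.H) × (β.H ≃ₗᵢ[ℂ] β.H) :=
    α.rep.prod (β.rep.comp (φ : α.twist.E →* β.twist.E))
  have hu : Continuous u := α.continuous_rep.prodMk (β.continuous_rep.comp φ.continuous)
  have huα : ∀ x, α.act (α.twist.q x) = Ad (u x).1 := α.act_q
  have huβ : ∀ x, β.act (α.twist.q x) = Ad (u x).2 := fun x => by
    rw [← hφq]
    exact β.act_q (φ x)
  -- Since `φ` is the identity on the circle, kernel elements give pairs of equal scalars, and these
  -- act trivially; so the action descends to `γ` on `G`.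
  have hker : ∀ x, α.twist.q x = 1 → conjPair (u x) = 1 := fun x hx => by
    obtain ⟨z, rfl⟩ := α.twist.exists_ι hx
    have : u (α.twist.ι z) = (scalarUnitary α.H z, scalarUnitary β.H z) :=
      Prod.ext rfl ((congrArg β.rep (hφι z)).trans (β.rep_ι z))
    rw [this, conjPair_scalarUnitary]
  let γ : G →* (compactHom α.H β.H ≃ₗ[ℂ] compactHom α.H β.H) :=
    α.twist.q.liftOfSurjective α.twist.surjective_q ⟨conjPair.comp u, fun x hx => hker x hx⟩
  have hγ : ∀ x, γ (α.twist.q x) = conjPair (u x) :=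
    MonoidHom.liftOfRightInverse_comp_apply _ _ _ ⟨conjPair.comp u, fun x hx => hker x hx⟩
  refine ⟨compactBimodule α.H β.H, γ, fun T => ?_, fun g a T => ?_, fun g b T => ?_,
    fun g S T => ?_, fun g S T => ?_⟩
  · rw [α.twist.isOpenQuotientMap_q.isQuotientMap.continuous_iff]
    exact (continuous_conjPair hu T).congr fun x => congrArg (fun t => t T) (hγ x).symm
  all_goals
    obtain ⟨x, rfl⟩ := α.twist.surjective_q g
    have e : ∀ R, γ (α.twist.q x) R = conjPair (u x) R := fun R => congrArg (fun t => t R) (hγ x)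
  · rw [huα]
    exact (e _).trans ((conjPair_lsmul (u x) a T).trans (congrArg _ (e T).symm))
  · rw [huβ]
    exact (e _).trans ((conjPair_rsmul (u x) b T).trans (congrArg _ (e T).symm))
  · rw [huα]
    exact (congrArg₂ _ (e S) (e T)).trans (lin_conjPair (u x) S T)
  · rw [huβ]
    exact (congrArg₂ _ (e S) (e T)).trans (rin_conjPair (u x) S T)

end CompactAction

/-! ### The bijection `[α] ↦ [G_α]` and the group `Br(G)` -/

variable {G : Type u} [Group G] [TopologicalSpace G] [IsTopologicalGroup G]
  [LocallyCompactSpace G] [T2Space G]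

/-- The map `[α] ↦ [G_α]`. -/
def Br.twist : Br G → Twist G :=
  Quot.lift (fun α => Twist.mk α.twist) fun _ _ h => Twist.mk_eq_mk_iff.2 h.twist_equivalent

/-- Equality in `Br(G)` a priori means only the equivalence relation generated by Morita
equivalence. The twist is an invariant of it that already determines Morita equivalence, so
transitivity need not be proved with tensor products of bimodules. -/
theorem Br.mk_eq_mk_iff {α β : CompactAction G} : Br.mk α = Br.mk β ↔ α.MoritaEquivalent β :=
  ⟨fun h => CompactAction.moritaEquivalent_of_twist_equivalent
    (Twist.mk_eq_mk_iff.1 (congrArg Br.twist h)), fun h => Quot.sound h⟩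

theorem Br.twist_mk_regularAction (A : GroupTwist G) :
    Br.twist (Br.mk A.regularAction) = Twist.mk A :=
  (Twist.mk_eq_mk_iff.2 (CompactAction.equivalent_twist_regularAction A)).symm

theorem Br.twist_bijective : Function.Bijective (Br.twist (G := G)) := by
  constructor
  · rintro ⟨α⟩ ⟨β⟩ h
    exact Br.mk_eq_mk_iff.2
      (CompactAction.moritaEquivalent_of_twist_equivalent (Twist.mk_eq_mk_iff.1 h))
  · rintro ⟨A⟩
    exact ⟨_, Br.twist_mk_regularAction A⟩

variable (G) in
/-- The bijection `[α] ↦ [G_α]`. -/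
def Br.equivTwist : Br G ≃ Twist G := Equiv.ofBijective Br.twist Br.twist_bijective

/-- The group structure on `Br(G)` which makes `[α] ↦ [G_α]` an isomorphism. -/
instance : CommGroup (Br G) := (Br.equivTwist G).commGroup

variable (G) in
/-- The isomorphism `[α] ↦ [G_α]`. -/
def Br.mulEquivTwist : Br G ≃* Twist G := (Br.equivTwist G).mulEquiv

theorem Br.mulEquivTwist_mk (α : CompactAction G) :
    Br.mulEquivTwist G (Br.mk α) = Twist.mk α.twist := rfl

end GroupTwists

end

theorem proposition4p4 (G : Type u) [Group G] [TopologicalSpace G] [IsTopologicalGroup G]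
    [LocallyCompactSpace G] [T2Space G] :
    -- abelian group structures on `Twist(G)` and `Br(G)` and an isomorphism between them
    ∃ (_ : CommGroup (GroupTwists.Twist G)) (_ : CommGroup (GroupTwists.Br G))
      (Φ : GroupTwists.Twist G ≃* GroupTwists.Br G),
      -- the group structure on `Twist(G)` is the usual one
      (∀ A B : GroupTwists.GroupTwist G, GroupTwists.Twist.mk A * GroupTwists.Twist.mk B =
        GroupTwists.Twist.mk (A.baer B)) ∧
      (∀ A : GroupTwists.GroupTwist G,
        (GroupTwists.Twist.mk A)⁻¹ = GroupTwists.Twist.mk A.conjTwist) ∧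
      -- the classes in `Br(G)` are the Morita equivalence classes
      (∀ α β : GroupTwists.CompactAction G,
        GroupTwists.Br.mk α = GroupTwists.Br.mk β ↔ α.MoritaEquivalent β) ∧
      -- the isomorphism is the bijection `[E] ↦ [Ad ρ]`, with inverse `[α] ↦ [G_α]`
      (∀ A : GroupTwists.GroupTwist G,
        Φ (GroupTwists.Twist.mk A) = GroupTwists.Br.mk A.regularAction) ∧
      (∀ α : GroupTwists.CompactAction G,
        Φ.symm (GroupTwists.Br.mk α) = GroupTwists.Twist.mk α.twist) ∧
      -- the formulas for products and inverses in `Br(G)`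
      (∀ α β : GroupTwists.CompactAction G,
        GroupTwists.Br.mk α * GroupTwists.Br.mk β = GroupTwists.Br.mk (α.tensor β)) ∧
      (∀ α : GroupTwists.CompactAction G,
        (GroupTwists.Br.mk α)⁻¹ = GroupTwists.Br.mk α.conjAction) := by
  refine ⟨inferInstance, inferInstance, (GroupTwists.Br.mulEquivTwist G).symm,
    GroupTwists.Twist.mk_mul_mk, GroupTwists.Twist.inv_mk, fun _ _ => GroupTwists.Br.mk_eq_mk_iff,
    fun A => ?_, fun α => rfl, fun α β => ?_, fun α => ?_⟩
  · exact (MulEquiv.symm_apply_eq _).2 (GroupTwists.Br.twist_mk_regularAction A).symm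
  -- On the side of twists, the product formula is the equivalence of `G_α * G_β` with `G_{α ⊗ β}`.
  · apply (GroupTwists.Br.mulEquivTwist G).injective
    rw [map_mul, GroupTwists.Br.mulEquivTwist_mk, GroupTwists.Br.mulEquivTwist_mk,
      GroupTwists.Br.mulEquivTwist_mk, GroupTwists.Twist.mk_mul_mk]
    exact GroupTwists.Twist.mk_eq_mk_iff.2 (α.baer_equivalent_twist_tensor β)
  · apply (GroupTwists.Br.mulEquivTwist G).injective
    rw [map_inv, GroupTwists.Br.mulEquivTwist_mk, GroupTwists.Br.mulEquivTwist_mk,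
      GroupTwists.Twist.inv_mk]
    exact GroupTwists.Twist.mk_eq_mk_iff.2 α.conjTwist_equivalent_twist_conjAction
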